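/- Let $\mathbb F\in\{\mathbb R,\mathbb C,\mathbb H\}$, $d=\dim_{\mathbb R}\mathbb F$, $q\ge 1$, and let $M_{p,q}$ be the space of $p\times q$ matrices and $U_p$ the group of unitary $p\times p$ matrices over $\mathbb F$. Put $K_p=U_p\times U_q$ and $G_p=M_{p,q}\rtimes K_p$, where $(u,v)\in K_p$ acts on $M_{p,q}$ by $x\mapsto uxv^{-1}$. Embed $G_p$ in $G_{p+1}$ by adding a zero row to $x$ and replacing $u$ by $\mathrm{diag}(u,1)$, and let $G_\infty=\varinjlim G_p$ (with the inductive limit topology) and $K_\infty=\varinjlim K_p$. An Olshanski spherical function of $(G_\infty,K_\infty)$ is a continuous $K_\infty$-biinvariant function $\phi:G_\infty\to\mathbb C$ such that $$\phi(g)\phi(h)=\lim_{p\to\infty}\int_{K_p}\phi(gkh)\,dk\qquad\text{for all } g,h\in G_\infty,$$ where $dk$ is the normalized Haar measure of $K_p$. It is positive definite if $\sum_{k,l=1}^n c_k\overline{c_l}\,\phi(g_kg_l^{-1})\ge 0$ for all $n\in\mathbb N$, $g_1,\dots,g_n\in G_\infty$ and $c_1,\dots,c_n\in\mathbb C$. Let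 $C_q^B=\{\xi\in\mathbb R^q:\xi_1\ge\dots\ge\xi_q\ge 0\}$, and for $\xi\in C_q^B$ let $g_\xi\in G_\infty$ be the element with matrix part $\binom{\mathrm{diag}(\xi_1,\dots,\xi_q)}{0}$ and trivial $K_\infty$-part. The $g_\xi$ represent the double cosets in $K_\infty\backslash G_\infty/K_\infty$, so a $K_\infty$-biinvariant function $\phi$ is identified with the function $\xi\mapsto\phi(g_\xi)$ on $C_q^B$. For $k\ge 0$ and $y\in\mathbb C^q$ let $E_k(\cdot,y)$ be the Dunkl kernel of type $A_{q-1}$, that is, the unique real-analytic function $f$ on $\mathbb R^q$ with $f(0)=1$ and $$\partial_i f(x)+k\sum_{j\ne i}\frac{f(x)-f(s_{ij}x)}{x_i-x_j}=y_i f(x)\qquad(i=1,\dots,q)$$ whenever $x$ has pairwise distinct coordinates, where $s_{ij}$ exchanges the $i$-th and $j$-th coordinates. The Dunkl-Bessel function of type $A_{q-1}$ is its symmetrization $J_k^A(x,y)=\frac1{q!}\sum_{w\in S_q}E_k(wx,y)$. For $b\in\mathbb C^q$ define $$\psi_b(\xi)=J^A_{d/2}(\xi^2,-b),\qquad \xi\in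 C_q^B,\quad \xi^2=(\xi_1^2,\dots,\xi_q^2).$$ **Proposition.** For every $b\in C_q^B$, the function $\psi_b$ is a positive definite Olshanski spherical function of $(G_\infty,K_\infty)$: there is a positive definite Olshanski spherical function $\phi$ of $(G_\infty,K_\infty)$ with $\phi(g_\xi)=\psi_b(\xi)$ for all $\xi\in C_q^B$. -/

import Mathlib

open scoped Quaternion

noncomputable section

namespace OlshanskiPair

/-! ### The matrix motion groups and their inductive limit

`F` is one of `ℝ`, `ℂ`, `ℍ`.  The following property, shared by the three, is used only to see that
the unitary groups over `F` are compact. -/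

/-- `star x * x = ‖x‖ ^ 2` for all `x`, as holds for the conjugations of `ℝ`, `ℂ` and `ℍ`. -/
class NormStar (F : Type) [NormedDivisionRing F] [StarRing F] [NormedAlgebra ℝ F] : Prop where
  star_mul_self_eq : ∀ x : F, star x * x = algebraMap ℝ F (‖x‖ ^ 2)

instance : NormStar ℝ := ⟨fun x => by simp [pow_two]⟩

instance : NormStar ℂ := ⟨fun x => by
  simp [← Complex.normSq_eq_norm_sq, Complex.normSq_eq_conj_mul_self]⟩

instance : NormStar ℍ[ℝ] := ⟨fun x => by
  rw [Quaternion.star_mul_self, Quaternion.normSq_eq_norm_mul_self, pow_two]; rfl⟩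

section Padding

variable {F : Type} [NormedDivisionRing F]

/-- Appending zero rows, `x ↦ (x; 0)`. -/
def padRows (q : ℕ) {p p' : ℕ} (_h : p ≤ p') :
    Matrix (Fin p) (Fin q) F →+ Matrix (Fin p') (Fin q) F where
  toFun x := Matrix.of fun i j => if hi : (i : ℕ) < p then x ⟨i, hi⟩ j else 0
  map_zero' := by ext i j; simp
  map_add' x y := by
    ext i j
    by_cases hi : (i : ℕ) < p <;> simp [hi]

/-- The block matrix `diag(u, 1)`. -/
def padSquare {p p' : ℕ} (_h : p ≤ p') (u : Matrix (Fin p) (Fin p) F) :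
    Matrix (Fin p') (Fin p') F :=
  Matrix.of fun i j =>
    if hi : (i : ℕ) < p then (if hj : (j : ℕ) < p then u ⟨i, hi⟩ ⟨j, hj⟩ else 0)
    else if i = j then 1 else 0

theorem padSquare_one {p p' : ℕ} (h : p ≤ p') :
    padSquare h (1 : Matrix (Fin p) (Fin p) F) = 1 := by
  ext i j
  by_cases hi : (i : ℕ) < p <;> by_cases hj : (j : ℕ) < p <;>
    simp [padSquare, hi, hj, Matrix.one_apply, Fin.ext_iff]
  all_goals omega

theorem padSquare_mul {p p' : ℕ} (h : p ≤ p') (u v : Matrix (Fin p) (Fin p) F) :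
    padSquare h (u * v) = padSquare h u * padSquare h v := by
  obtain ⟨m, rfl⟩ := Nat.exists_eq_add_of_le h
  have e1 : ∀ (a : Fin m) (b : Fin p), Fin.natAdd p a ≠ Fin.castAdd m b := by
    intro a b hab
    have := congrArg Fin.val hab
    simp at this
    omega
  ext i j
  rw [Matrix.mul_apply, Fin.sum_univ_add]
  refine Fin.addCases (fun a => ?_) (fun a => ?_) i <;>
    refine Fin.addCases (fun b => ?_) (fun b => ?_) j <;>
    simp [padSquare, Matrix.mul_apply, e1]

theorem padRows_mul (q : ℕ) {p p' : ℕ} (h : p ≤ p') (u : Matrix (Fin p) (Fin p) F)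
    (x : Matrix (Fin p) (Fin q) F) (v : Matrix (Fin q) (Fin q) F) :
    padRows q h (u * x * v) = padSquare h u * padRows q h x * v := by
  have key : ∀ y : Matrix (Fin p) (Fin q) F,
      padRows q h (y * v) = padRows q h y * v := by
    intro y
    ext i j
    by_cases hi : (i : ℕ) < p <;> simp [padRows, Matrix.mul_apply, hi]
  rw [key]
  congr 1
  obtain ⟨m, rfl⟩ := Nat.exists_eq_add_of_le h
  ext i j
  rw [Matrix.mul_apply, Fin.sum_univ_add]
  refine Fin.addCases (fun a => ?_) (fun a => ?_) i
  · simp [padSquare, padRows, Matrix.mul_apply]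
  · have e1 : ∀ b : Fin p, Fin.natAdd p a ≠ Fin.castAdd m b := by
      intro b hab
      have := congrArg Fin.val hab
      simp at this
      omega
    simp [padSquare, padRows, Matrix.mul_apply, e1]

theorem padSquare_star [StarRing F] {p p' : ℕ} (h : p ≤ p') (u : Matrix (Fin p) (Fin p) F) :
    padSquare h (star u) = star (padSquare h u) := by
  ext i j
  by_cases hi : (i : ℕ) < p <;> by_cases hj : (j : ℕ) < p <;>
    simp [padSquare, hi, hj, Matrix.star_apply, Fin.ext_iff]
  · rw [if_neg (by omega)]; simp
  · omega
  · by_cases hij : (i : ℕ) = j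
    · simp [hij]
    · simp [hij, Ne.symm hij]

end Padding

section Groups

variable (F : Type) [NormedDivisionRing F] [StarRing F]

/-- The unitary group `U_p(F)` of `p × p` matrices `u` with `u* u = u u* = 1`. -/
abbrev U (p : ℕ) : Type := unitary (Matrix (Fin p) (Fin p) F)

/-- `K_p = U_p × U_q`. -/
abbrev K (p q : ℕ) : Type := U F p × U F q

/-- The action of `K_p` on the additive group of `p × q` matrices: `(u, v) • x = u x v⁻¹`. -/
def actionK (p q : ℕ) : K F p q →* MulAut (Multiplicative (Matrix (Fin p) (Fin q) F)) where
  toFun k :=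
    { toFun := fun x => .ofAdd (k.1.1 * x.toAdd * star k.2.1)
      invFun := fun x => .ofAdd (star k.1.1 * x.toAdd * k.2.1)
      left_inv := fun x => by
        apply Multiplicative.toAdd.injective
        have h1 := (Unitary.mem_iff.mp k.1.2).1
        have h2 := (Unitary.mem_iff.mp k.2.2).1
        simp only [Matrix.star_eq_conjTranspose] at h1 h2
        simp [Matrix.star_eq_conjTranspose, Matrix.mul_assoc, h2]
        rw [← Matrix.mul_assoc, h1, Matrix.one_mul]
      right_inv := fun x => by
        apply Multiplicative.toAdd.injective
        have h1 := (Unitary.mem_iff.mp k.1.2).2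
        have h2 := (Unitary.mem_iff.mp k.2.2).2
        simp only [Matrix.star_eq_conjTranspose] at h1 h2
        simp [Matrix.star_eq_conjTranspose, Matrix.mul_assoc, h2]
        rw [← Matrix.mul_assoc, h1, Matrix.one_mul]
      map_mul' := fun x y => by
        apply Multiplicative.toAdd.injective
        simp [Matrix.mul_add, Matrix.add_mul] }
  map_one' := by
    ext x : 1
    apply Multiplicative.toAdd.injective
    simp
  map_mul' k l := by
    ext x : 1
    apply Multiplicative.toAdd.injective
    simp [Matrix.mul_assoc]

/-- `G_p = M_{p,q}(F) ⋊ (U_p × U_q)`. -/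
abbrev G (p q : ℕ) : Type := Multiplicative (Matrix (Fin p) (Fin q) F) ⋊[actionK F p q] K F p q

/-- `G_p` carries the product topology of `M_{p,q}(F) × U_p × U_q`. -/
instance (p q : ℕ) : TopologicalSpace (G F p q) :=
  TopologicalSpace.induced SemidirectProduct.equivProd inferInstance

variable {F}

/-- The embedding `U_p → U_{p'}`, `u ↦ diag(u, 1)`. -/
def padUnitary {p p' : ℕ} (h : p ≤ p') : U F p →* U F p' where
  toFun u := ⟨padSquare h u.1, Unitary.mem_iff.mpr ⟨by
      rw [← padSquare_star, ← padSquare_mul, (Unitary.mem_iff.mp u.2).1, padSquare_one], by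
      rw [← padSquare_star, ← padSquare_mul, (Unitary.mem_iff.mp u.2).2, padSquare_one]⟩⟩
  map_one' := Subtype.ext (padSquare_one h)
  map_mul' u v := Subtype.ext (padSquare_mul h u.1 v.1)

/-- The embedding `G_p → G_{p'}`, `(x, (u, v)) ↦ ((x; 0), (diag(u, 1), v))`. -/
def embed (q : ℕ) {p p' : ℕ} (h : p ≤ p') : G F p q →* G F p' q :=
  SemidirectProduct.map (AddMonoidHom.toMultiplicative (padRows q h))
    ((padUnitary h).prodMap (MonoidHom.id _)) (fun k => by
      refine MonoidHom.ext fun x => ?_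
      apply Multiplicative.toAdd.injective
      simp [actionK, padUnitary, padRows_mul])

instance (q : ℕ) : DirectedSystem (fun p => G F p q)
    (fun _ _ h => (embed (F := F) q h : G F _ q → G F _ q)) where
  map_self p g := by
    apply SemidirectProduct.ext
    · apply Multiplicative.toAdd.injective
      ext i j
      simp [embed, padRows]
    · refine Prod.ext (Subtype.ext ?_) rfl
      ext i j
      simp [embed, padUnitary, padSquare]
  map_map p'' p' p h h' g := by
    apply SemidirectProduct.ext
    · apply Multiplicative.toAdd.injective
      ext i j
      by_cases hi : (i : ℕ) < p
      · have : (i : ℕ) < p' := by omega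
        simp [embed, padRows, hi, this]
      · by_cases hi' : (i : ℕ) < p' <;> simp [embed, padRows, hi, hi']
    · refine Prod.ext (Subtype.ext ?_) rfl
      ext i j
      by_cases hi : (i : ℕ) < p
      · have h1 : (i : ℕ) < p' := by omega
        by_cases hj : (j : ℕ) < p
        · have h2 : (j : ℕ) < p' := by omega
          simp [embed, padUnitary, padSquare, hi, hj, h1, h2]
        · by_cases h2 : (j : ℕ) < p' <;>
            simp [embed, padUnitary, padSquare, hi, hj, h1, h2]
      · by_cases h1 : (i : ℕ) < p' <;> by_cases h2 : (j : ℕ) < p' <;>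
          simp [embed, padUnitary, padSquare, hi, h1, h2, Fin.ext_iff]
        omega

variable (F)

/-- `G_∞ = M_{∞,q}(F) ⋊ (U_∞ × U_q)`, the inductive limit of the groups `G_p`. -/
def GInf (q : ℕ) : Type :=
  DirectLimit (fun p => G F p q) (fun p p' (h : p ≤ p') => embed (F := F) q h)

instance (q : ℕ) : Group (GInf F q) :=
  inferInstanceAs (Group (DirectLimit (fun p => G F p q)
    (fun p p' (h : p ≤ p') => embed (F := F) q h)))

variable {F}

/-- The canonical homomorphism `G_p → G_∞`. -/
def incl (p q : ℕ) : G F p q →* GInf F q where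
  toFun g := ⟦⟨p, g⟩⟧
  map_one' := (DirectLimit.one_def p).symm
  map_mul' g h := (DirectLimit.mul_def (f := fun p p' (h : p ≤ p') => embed (F := F) q h) p g h).symm

/-- The inductive limit topology: the finest one that makes all `G_p → G_∞` continuous. -/
instance (q : ℕ) : TopologicalSpace (GInf F q) :=
  ⨆ p, TopologicalSpace.coinduced (incl (F := F) p q) inferInstance

/-- The image of `k ∈ K_p` in `G_∞`. -/
def inclK (p q : ℕ) : K F p q →* GInf F q := (incl p q).comp SemidirectProduct.inr

variable (F) in
/-- `K_∞ = U_∞ × U_q`, the union of the groups `K_p` in `G_∞`. -/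
def KInf (q : ℕ) : Subgroup (GInf F q) := ⨆ p, (inclK (F := F) p q).range

end Groups

section Spherical

/-- The integral over a compact group against the normalized Haar measure. -/
def haarIntegral {H : Type} [Group H] [TopologicalSpace H] [IsTopologicalGroup H]
    [CompactSpace H] (f : H → ℂ) : ℂ :=
  letI : MeasurableSpace H := borel H
  haveI : BorelSpace H := ⟨rfl⟩
  ∫ k, f k ∂(MeasureTheory.Measure.haarMeasure (⊤ : TopologicalSpace.PositiveCompacts H))

variable {F : Type} [NormedDivisionRing F] [StarRing F] [NormedAlgebra ℝ F]

theorem norm_entry_le [NormStar F] {p : ℕ} (u : U F p) (i j : Fin p) : ‖u.1 i j‖ ≤ 1 := by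
  have h := congrFun (congrFun (Unitary.mem_iff.mp u.2).1 j) j
  simp only [Matrix.mul_apply, Matrix.star_apply, NormStar.star_mul_self_eq,
    Matrix.one_apply_eq] at h
  rw [← map_sum, ← map_one (algebraMap ℝ F)] at h
  have h2 := (algebraMap ℝ F).injective h
  have h3 : ‖u.1 i j‖ ^ 2 ≤ ∑ x, ‖u.1 x j‖ ^ 2 :=
    Finset.single_le_sum (f := fun x => ‖u.1 x j‖ ^ 2) (fun x _ => by positivity)
      (Finset.mem_univ i)
  have h4 := norm_nonneg (u.1 i j)
  nlinarith

instance [CStarRing F] [FiniteDimensional ℝ F] [NormStar F] (p : ℕ) : CompactSpace (U F p) := by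
  have : ProperSpace F := FiniteDimensional.proper ℝ F
  have hc : IsCompact (Set.pi Set.univ fun _ : Fin p => Set.pi Set.univ fun _ : Fin p =>
      Metric.closedBall (0 : F) 1) :=
    isCompact_univ_pi fun _ => isCompact_univ_pi fun _ => isCompact_closedBall _ _
  refine (isCompact_iff_compactSpace (s := (unitary (Matrix (Fin p) (Fin p) F) : Set (Matrix (Fin p) (Fin p) F)))).mp ?_
  have hcl := isClosed_unitary (R := Matrix (Fin p) (Fin p) F)
  refine IsCompact.of_isClosed_subset hc hcl ?_
  intro u hu i _ j _
  simpa using norm_entry_le ⟨u, hu⟩ i j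

/-- An Olshanski spherical function of `(G_∞, K_∞)`: a continuous `K_∞`-biinvariant function with
`φ(g) φ(h) = lim_{p → ∞} ∫_{K_p} φ(g k h) dk` for all `g, h`. -/
structure IsOlshanskiSpherical [CStarRing F] [FiniteDimensional ℝ F] [NormStar F] {q : ℕ}
    (φ : GInf F q → ℂ) : Prop where
  continuous : Continuous φ
  biinvariant : ∀ k ∈ KInf F q, ∀ l ∈ KInf F q, ∀ g, φ (k * g * l) = φ g
  product_formula : ∀ g h, Filter.Tendsto
    (fun p : ℕ => haarIntegral fun k : K F p q => φ (g * inclK p q k * h))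
    Filter.atTop (nhds (φ g * φ h))

/-- Positive definiteness of a function on a group: all the sums
`∑ k, l, c_k conj(c_l) φ(g_k g_l⁻¹)` are real and nonnegative. -/
def IsPositiveDefinite {H : Type} [Group H] (φ : H → ℂ) : Prop :=
  ∀ (n : ℕ) (g : Fin n → H) (c : Fin n → ℂ),
    0 ≤ (∑ k, ∑ l, c k * star (c l) * φ (g k * (g l)⁻¹)).re ∧
      (∑ k, ∑ l, c k * star (c l) * φ (g k * (g l)⁻¹)).im = 0

/-- The element `g_ξ = ((diag(ξ); 0), 1)` of `G_∞`. -/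
def gElt {q : ℕ} (ξ : Fin q → ℝ) : GInf F q :=
  incl q q (SemidirectProduct.inl (.ofAdd (Matrix.diagonal fun i => algebraMap ℝ F (ξ i))))

end Spherical

/-! ### Dunkl theory of type `A_{q-1}` -/

/-- The closed Weyl chamber `ξ_1 ≥ … ≥ ξ_q ≥ 0` of type `B_q`. -/
def chamberB (q : ℕ) : Set (Fin q → ℝ) := {ξ | Antitone ξ ∧ ∀ i, 0 ≤ ξ i}

/-- The Dunkl operator of type `A_{q-1}` with multiplicity `κ` in direction `e_i`:
`T_i f(x) = ∂_i f(x) + κ ∑_{j ≠ i} (f(x) - f(s_{ij} x)) / (x_i - x_j)`,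
for `x` with pairwise distinct coordinates; `s_{ij}` exchanges the coordinates `i` and `j`. -/
def dunklOp {q : ℕ} (κ : ℝ) (i : Fin q) (f : (Fin q → ℝ) → ℂ) (x : Fin q → ℝ) : ℂ :=
  fderiv ℝ f x (Pi.single i 1) +
    (κ : ℂ) * ∑ j ∈ Finset.univ.erase i,
      (f x - f (x ∘ Equiv.swap i j)) / ((x i - x j : ℝ) : ℂ)

/-- `f = E_κ(·, y)` is a Dunkl kernel with spectral parameter `y`: a real-analytic joint
eigenfunction, `T_i f = y_i f` for all `i`, with `f(0) = 1`.  As both sides extend continuously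
to all of `ℝ^q`, it suffices to ask for the equation where the coordinates of `x` are distinct. -/
structure IsDunklKernel {q : ℕ} (κ : ℝ) (y : Fin q → ℂ) (f : (Fin q → ℝ) → ℂ) : Prop where
  analytic : AnalyticOnNhd ℝ f Set.univ
  map_zero : f 0 = 1
  eigen : ∀ i, ∀ x : Fin q → ℝ, Function.Injective x → dunklOp κ i f x = y i * f x

/-- The Dunkl kernel `x ↦ E_κ(x, y)` of type `A_{q-1}`, the solution (unique for `κ ≥ 0`) of the
joint eigenvalue problem. -/
def dunklKernel {q : ℕ} (κ : ℝ) (x : Fin q → ℝ) (y : Fin q → ℂ) : ℂ :=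
  Classical.epsilon (IsDunklKernel κ y) x

/-- The Dunkl-Bessel function `J_κ^A(x, y)`, the symmetrization of the Dunkl kernel under the
symmetric group. -/
def dunklBesselA {q : ℕ} (κ : ℝ) (x : Fin q → ℝ) (y : Fin q → ℂ) : ℂ :=
  (q.factorial : ℂ)⁻¹ * ∑ w : Equiv.Perm (Fin q), dunklKernel κ (x ∘ w) y

/-- `ψ_b(ξ) = J_{d/2}^A(ξ², -b)` with `d = dim_ℝ F`. -/
def psi (F : Type) [NormedDivisionRing F] [NormedAlgebra ℝ F] {q : ℕ} (b : Fin q → ℂ)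
    (ξ : Fin q → ℝ) : ℂ :=
  dunklBesselA ((Module.finrank ℝ F : ℝ) / 2) (fun i => ξ i ^ 2) (-b)

/-- `ψ_b`, read as a `K_∞`-biinvariant function `φ` on `G_∞` through `φ(g_ξ) = ψ_b(ξ)` for `ξ` in
the chamber, is a positive definite Olshanski spherical function. -/
def PsiIsPositiveDefiniteSpherical (F : Type) [NormedDivisionRing F] [StarRing F]
    [NormedAlgebra ℝ F] [CStarRing F] [FiniteDimensional ℝ F] [NormStar F] {q : ℕ}
    (b : Fin q → ℂ) : Prop :=
  ∃ φ : GInf F q → ℂ, (∀ ξ ∈ chamberB q, φ (gElt ξ) = psi F b ξ) ∧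
    IsOlshanskiSpherical φ ∧ IsPositiveDefinite φ

end OlshanskiPair

end

/-! Everything rests on the integral formula `J(x, y) = ∫ exp(∑ x_m (u diag(y) u*)_{mm}) du` over `u
∈ U_q` for the Dunkl-Bessel function of multiplicity `d / 2`. At `x = ξ²`, `y = -b` it turns
`ψ_b(ξ)` into the mean over `w ∈ U_q` of `exp(-‖diag(ξ) w diag(√b)‖²)`. The same mean makes sense
for every matrix part `x` in place of `diag(ξ)`; it ignores appended zero rows and the action of
`K_p`, so it defines a biinvariant function on `G_∞` (`gaussSpherical`). For fixed `w` the integrand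
is a Gaussian in `x`, which gives positive definiteness. For the product formula, `x` is replaced by
`x + u y v*` in the exponent. The cross term is linear in the entries of `u`, whose mean size is at
most `p^(-1/2)`. In the limit the exponential splits into two factors, and averaging over `v` makes
them independent (`abs_haarMean_gaussMean_sub_le`).

The Dunkl kernel is given only by its characterization, so it has to be constructed and shown to be
unique. If `T_i E_{n+1} = y_i E_n` for homogeneous components, Euler's identity forces `(n + 1 +
(κ/2) ∑ (1 - s_{jl})) E_{n+1} = ⟨x, y⟩ E_n`. A minimum principle on the finite group `S_q` inverts
the operator on the left, with nonnegative coefficients of sum `1/(n+1)`. This defines the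
components and makes their sum converge like an exponential series (`dunklT_kernelPoly_succ`,
`norm_kernelMultilinear_le`). Uniqueness is an energy estimate along rays
(`IsDunklKernel.eq_of_injective`).

For the integral formula put `Q = u diag(y) u*`. Integration by parts along plane rotations shows
that `T_i` sends Haar moments weighted by `(Q^n)_{ii}` to those weighted by `(Q^{n+1})_{ii}`; the
multiplicity `d/2` comes from summing over an orthonormal basis of `F` (`dunklT_gramMoment`). Since
`∑ (Q^n)_{ii} = ∑ y_i^n`, the integral is a symmetric joint eigenfunction of the power sums of the
`T_i`, and these determine it (`eq_symKernelPoly`). -/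

noncomputable section

namespace OlshanskiPair

open MvPolynomial

/-! ### Dunkl operators on polynomials -/

section PolynomialDunkl

variable {q : ℕ}

/-- The action of the transposition `(i j)` on polynomials. -/
abbrev swapPoly (i j : Fin q) : MvPolynomial (Fin q) ℝ →ₐ[ℝ] MvPolynomial (Fin q) ℝ :=
  rename (Equiv.swap i j)

theorem swapPoly_self (i : Fin q) (f : MvPolynomial (Fin q) ℝ) : swapPoly i i f = f := by
  rw [swapPoly, Equiv.swap_self, Equiv.coe_refl, rename_id_apply]

theorem X_sub_X_ne_zero {i j : Fin q} (h : i ≠ j) :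
    (X i - X j : MvPolynomial (Fin q) ℝ) ≠ 0 :=
  sub_ne_zero.mpr fun e => h (X_injective e)

/-- Induction through the twisted Leibniz rule `f g - s(f g) = (f - s f) g + s f (g - s g)`, with
`g` a variable. -/
theorem X_sub_X_dvd_sub_swap (i j : Fin q) (f : MvPolynomial (Fin q) ℝ) :
    (X i - X j : MvPolynomial (Fin q) ℝ) ∣ f - swapPoly i j f := by
  induction f using MvPolynomial.induction_on with
  | C a => simp
  | add f g hf hg =>
    have : f + g - swapPoly i j (f + g) = (f - swapPoly i j f) + (g - swapPoly i j g) := by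
      rw [map_add]; ring
    rw [this]
    exact dvd_add hf hg
  | mul_X f l hf =>
    have : f * X l - swapPoly i j (f * X l) =
        (f - swapPoly i j f) * X l + swapPoly i j f * (X l - X (Equiv.swap i j l)) := by
      rw [map_mul, rename_X]; ring
    rw [this]
    refine dvd_add (hf.mul_right _) (Dvd.dvd.mul_left ?_ _)
    by_cases h1 : l = i
    · subst h1; simp
    · by_cases h2 : l = j
      · subst h2
        rw [Equiv.swap_apply_right, dvd_sub_comm]
      · rw [Equiv.swap_apply_of_ne_of_ne h1 h2, sub_self]
        exact dvd_zero _

/-- The divided difference `(f - s_{ij} f) / (x_i - x_j)`, set to be zero for `i = j`. -/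
def divDiffFun (i j : Fin q) (f : MvPolynomial (Fin q) ℝ) : MvPolynomial (Fin q) ℝ :=
  if i = j then 0 else (X_sub_X_dvd_sub_swap i j f).choose

/-- For `i = j` both sides vanish, so no distinctness hypothesis is needed here or in the sums
below. -/
theorem mul_divDiffFun (i j : Fin q) (f : MvPolynomial (Fin q) ℝ) :
    (X i - X j) * divDiffFun i j f = f - swapPoly i j f := by
  unfold divDiffFun
  split_ifs with h
  · subst h
    simp [swapPoly_self]
  · exact (X_sub_X_dvd_sub_swap i j f).choose_spec.symm

theorem divDiffFun_unique {i j : Fin q} (h : i ≠ j) {f g : MvPolynomial (Fin q) ℝ}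
    (hg : (X i - X j) * g = f - swapPoly i j f) : divDiffFun i j f = g :=
  mul_left_cancel₀ (X_sub_X_ne_zero h) ((mul_divDiffFun i j f).trans hg.symm)

/-- The divided difference as a linear map. -/
def divDiff (i j : Fin q) : MvPolynomial (Fin q) ℝ →ₗ[ℝ] MvPolynomial (Fin q) ℝ where
  toFun := divDiffFun i j
  map_add' f g := by
    by_cases h : i = j
    · simp [divDiffFun, h]
    · refine divDiffFun_unique h ?_
      rw [mul_add, mul_divDiffFun, mul_divDiffFun, map_add]; ring
  map_smul' r f := by
    by_cases h : i = j
    · simp [divDiffFun, h]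
    · refine divDiffFun_unique h ?_
      rw [RingHom.id_apply, mul_smul_comm, mul_divDiffFun, map_smul, smul_sub]

theorem mul_divDiff (i j : Fin q) (f : MvPolynomial (Fin q) ℝ) :
    (X i - X j) * divDiff i j f = f - swapPoly i j f := mul_divDiffFun i j f

theorem divDiff_self (i : Fin q) (f : MvPolynomial (Fin q) ℝ) : divDiff i i f = 0 := by
  simp [divDiff, divDiffFun]

theorem divDiff_unique {i j : Fin q} (h : i ≠ j) {f g : MvPolynomial (Fin q) ℝ}
    (hg : (X i - X j) * g = f - swapPoly i j f) : divDiff i j f = g := divDiffFun_unique h hg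

theorem divDiff_comm (i j : Fin q) (f : MvPolynomial (Fin q) ℝ) :
    divDiff j i f = - divDiff i j f := by
  by_cases h : j = i
  · subst h; simp [divDiff_self]
  · refine divDiff_unique h ?_
    have := mul_divDiff i j f
    rw [swapPoly, Equiv.swap_comm] at this
    linear_combination this

theorem divDiff_X_mul (i j l : Fin q) (f : MvPolynomial (Fin q) ℝ) :
    divDiff i j (X l * f) = X l * divDiff i j f +
      ((if i = l then 1 else 0) - (if j = l then 1 else 0)) * swapPoly i j f := by
  by_cases h : i = j
  · subst h; simp [divDiff_self]
  · refine divDiff_unique h ?_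
    rw [mul_add, mul_left_comm, mul_divDiff, map_mul, rename_X]
    by_cases h1 : i = l
    · subst h1
      simp [Ne.symm h]
      ring
    · by_cases h2 : j = l
      · subst h2
        simp [h]
        ring
      · rw [Equiv.swap_apply_of_ne_of_ne (Ne.symm h1) (Ne.symm h2)]
        simp [h1, h2]
        ring

theorem rename_divDiff (w : Equiv.Perm (Fin q)) (i j : Fin q) (f : MvPolynomial (Fin q) ℝ) :
    rename w (divDiff i j f) = divDiff (w i) (w j) (rename w f) := by
  by_cases h : i = j
  · subst h; simp [divDiff_self]
  · refine (divDiff_unique (fun e => h (w.injective e)) ?_).symm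
    have := congrArg (rename w) (mul_divDiff i j f)
    rw [map_mul, map_sub, rename_X, rename_X, map_sub] at this
    rw [this, rename_rename, rename_rename]
    congr 2
    congr 1
    ext l
    simp [Equiv.swap_apply_apply]

/-- The Dunkl operator on polynomials. -/
def dunklT (κ : ℝ) (i : Fin q) : MvPolynomial (Fin q) ℝ →ₗ[ℝ] MvPolynomial (Fin q) ℝ :=
  (pderiv i).toLinearMap + κ • ∑ j, divDiff i j

/-- The sum may run over all `j`, because the divided difference with `j = i` is zero. -/
theorem dunklT_apply (κ : ℝ) (i : Fin q) (f : MvPolynomial (Fin q) ℝ) :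
    dunklT κ i f = pderiv i f + κ • ∑ j, divDiff i j f := by
  simp [dunklT]

theorem divDiff_C (i j : Fin q) (a : ℝ) : divDiff i j (C a) = 0 := by
  by_cases h : i = j
  · subst h; simp [divDiff_self]
  · exact divDiff_unique h (by simp)

theorem dunklT_C (κ : ℝ) (i : Fin q) (a : ℝ) : dunklT κ i (C a) = 0 := by
  simp [dunklT_apply, divDiff_C]

/-- The commutation relation `[T_i, x_l] = δ_{il} + κ ∑_j (δ_{il} - δ_{jl}) s_{ij}`, from which the
commutativity of the `T_i` follows by induction on monomials. -/
theorem dunklT_X_mul (κ : ℝ) (i l : Fin q) (f : MvPolynomial (Fin q) ℝ) :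
    dunklT κ i (X l * f) = X l * dunklT κ i f + (if i = l then 1 else 0 : ℝ) • f +
      κ • ∑ j, ((if i = l then 1 else 0) - (if j = l then 1 else 0) : ℝ) • swapPoly i j f := by
  have h1 : pderiv i (X l * f) = X l * pderiv i f + (if i = l then 1 else 0 : ℝ) • f := by
    rw [Derivation.leibniz, pderiv_X, smul_eq_mul, smul_eq_mul]
    by_cases h : i = l
    · subst h; simp
    · simp [h, Ne.symm h]
  rw [dunklT_apply, h1, dunklT_apply]
  simp only [divDiff_X_mul, Finset.sum_add_distrib, mul_add, smul_add, Finset.mul_sum,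
    mul_smul_comm]
  have h2 : ∀ j, ((if i = l then 1 else 0) - (if j = l then 1 else 0) :
      MvPolynomial (Fin q) ℝ) * swapPoly i j f =
      ((if i = l then 1 else 0) - (if j = l then 1 else 0) : ℝ) • swapPoly i j f := by
    intro j
    split_ifs <;> simp
  simp only [h2]
  abel

theorem rename_pderiv (w : Equiv.Perm (Fin q)) (i : Fin q) (f : MvPolynomial (Fin q) ℝ) :
    rename w (pderiv i f) = pderiv (w i) (rename w f) :=
  (pderiv_rename w.injective i f).symm

theorem rename_dunklT (κ : ℝ) (w : Equiv.Perm (Fin q)) (i : Fin q)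
    (f : MvPolynomial (Fin q) ℝ) :
    rename w (dunklT κ i f) = dunklT κ (w i) (rename w f) := by
  rw [dunklT_apply, dunklT_apply, map_add, rename_pderiv, map_smul, map_sum]
  congr 2
  rw [← Equiv.sum_comp w fun j => divDiff (w i) j (rename w f)]
  simp only [rename_divDiff]

theorem dunklT_swapPoly (κ : ℝ) (i j l : Fin q) (f : MvPolynomial (Fin q) ℝ) :
    dunklT κ i (swapPoly j l f) = swapPoly j l (dunklT κ (Equiv.swap j l i) f) := by
  rw [swapPoly, rename_dunklT, Equiv.swap_apply_self]

theorem dunklT_comm (κ : ℝ) (i j : Fin q) (f : MvPolynomial (Fin q) ℝ) :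
    dunklT κ i (dunklT κ j f) = dunklT κ j (dunklT κ i f) := by
  by_cases hij : i = j
  · rw [hij]
  induction f using MvPolynomial.induction_on with
  | C a => simp [dunklT_C]
  | add f g hf hg => simp [hf, hg]
  | mul_X f l hf =>
    rw [mul_comm]
    simp only [dunklT_X_mul, map_add, map_smul, map_sum, hf, dunklT_swapPoly]
    -- Moving `T_j` past `s_{im}` changes its index only for `m = j`, so a single correction term
    -- appears. That term is symmetric in `i` and `j`, as is the rest.
    have key : ∀ i j : Fin q, i ≠ j →
        ∑ m, ((if i = l then 1 else 0) - (if m = l then 1 else 0) : ℝ) •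
          swapPoly i m (dunklT κ (Equiv.swap i m j) f) =
        ∑ m, ((if i = l then 1 else 0) - (if m = l then 1 else 0) : ℝ) •
          swapPoly i m (dunklT κ j f) +
        ((if i = l then 1 else 0) - (if j = l then 1 else 0) : ℝ) •
          (swapPoly i j (dunklT κ i f) - swapPoly i j (dunklT κ j f)) := by
      intro i j h
      rw [← sub_eq_iff_eq_add', ← Finset.sum_sub_distrib, Finset.sum_eq_single j]
      · rw [Equiv.swap_apply_right, ← smul_sub]
      · intro m _ hm
        by_cases h1 : m = i
        · subst h1; simp
        · rw [Equiv.swap_apply_of_ne_of_ne (Ne.symm h) (Ne.symm hm), sub_self]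
      · simp
    rw [key i j hij, key j i (Ne.symm hij), swapPoly, swapPoly, Equiv.swap_comm j i]
    simp only [smul_add]
    have h3 : ((if j = l then 1 else 0) - (if i = l then 1 else 0) : ℝ) •
          (rename (Equiv.swap i j) (dunklT κ j f) - rename (Equiv.swap i j) (dunklT κ i f)) =
        ((if i = l then 1 else 0) - (if j = l then 1 else 0) : ℝ) •
          (rename (Equiv.swap i j) (dunklT κ i f) - rename (Equiv.swap i j) (dunklT κ j f)) := by
      module
    rw [h3]
    abel

/-- Euler's identity for Dunkl operators. -/
theorem sum_X_mul_dunklT (κ : ℝ) {n : ℕ} {f : MvPolynomial (Fin q) ℝ} (hf : f.IsHomogeneous n) :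
    ∑ i, X i * dunklT κ i f =
      (n : ℝ) • f + (κ / 2) • ∑ i, ∑ j, (f - swapPoly i j f) := by
  simp only [dunklT_apply, mul_add, Finset.sum_add_distrib, hf.sum_X_mul_pderiv, mul_smul_comm,
    ← Finset.smul_sum]
  congr 1
  · rw [Nat.cast_smul_eq_nsmul]
  -- By antisymmetry of the divided differences, `∑ x_i D_{ij}` is half of `∑ (x_i - x_j) D_{ij}`.
  have h1 : ∑ i, ∑ j, (f - swapPoly i j f) =
      ∑ i, ∑ j, X i * divDiff i j f - ∑ i, ∑ j, X j * divDiff i j f := by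
    rw [← Finset.sum_sub_distrib]
    refine Finset.sum_congr rfl fun i _ => ?_
    rw [← Finset.sum_sub_distrib]
    refine Finset.sum_congr rfl fun j _ => ?_
    rw [← mul_divDiff]; ring
  have h2 : ∑ i, ∑ j, X j * divDiff i j f = - ∑ i, ∑ j, X i * divDiff i j f := by
    rw [Finset.sum_comm, ← Finset.sum_neg_distrib]
    refine Finset.sum_congr rfl fun i _ => ?_
    rw [← Finset.sum_neg_distrib]
    refine Finset.sum_congr rfl fun j _ => ?_
    rw [divDiff_comm i j]; ring
  rw [h1, h2, sub_neg_eq_add, ← two_smul ℝ, smul_smul, div_mul_cancel₀ _ (two_ne_zero' ℝ)]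
  simp only [Finset.mul_sum]

/-- A minimum principle for operators `n + c ∑ (1 - σ_a)`. -/
theorem nonneg_of_add_sum_sub_nonneg {Ω A : Type*} [Finite Ω] [Fintype A] (σ : A → Ω → Ω)
    {n c : ℝ} (hn : 0 < n) (hc : 0 ≤ c) {F : Ω → ℝ}
    (h : ∀ ω, 0 ≤ n * F ω + c * ∑ a, (F ω - F (σ a ω))) (ω : Ω) : 0 ≤ F ω := by
  have : Nonempty Ω := ⟨ω⟩
  -- At a minimum point every difference is nonpositive, so the inequality there forces `n F(m) ≥
  -- 0`.
  obtain ⟨m, hm⟩ := Finite.exists_min F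
  refine le_trans ?_ (hm ω)
  have h1 : ∑ a, (F m - F (σ a m)) ≤ 0 :=
    Finset.sum_nonpos fun a _ => sub_nonpos.mpr (hm _)
  have h2 := h m
  have h3 := mul_nonpos_of_nonneg_of_nonpos hc h1
  by_contra h4
  nlinarith

theorem eq_zero_of_add_sum_sub_eq_zero {Ω A : Type*} [Finite Ω] [Fintype A] (σ : A → Ω → Ω)
    {n c : ℝ} (hn : 0 < n) (hc : 0 ≤ c) {F : Ω → ℝ}
    (h : ∀ ω, n * F ω + c * ∑ a, (F ω - F (σ a ω)) = 0) (ω : Ω) : F ω = 0 := by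
  refine le_antisymm ?_ (nonneg_of_add_sum_sub_nonneg σ hn hc (fun ω => (h ω).ge) ω)
  have := nonneg_of_add_sum_sub_nonneg σ hn hc (F := fun ω => - F ω) (fun ω => ?_) ω
  · linarith
  · have e : ∑ a, (-F ω - -F (σ a ω)) = - ∑ a, (F ω - F (σ a ω)) := by
      rw [← Finset.sum_neg_distrib]
      exact Finset.sum_congr rfl fun a _ => by ring
    simp only [e]
    have := h ω
    linarith

/-- The operator `F_i ↦ n F_i + (κ / 2) ∑_{j,l} (F_i - s_{jl} F_{s_{jl} i})` on `q`-tuples of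
polynomials is injective. -/
theorem eq_zero_of_vector_euler {κ n : ℝ} (hκ : 0 ≤ κ) (hn : 0 < n)
    {F : Fin q → MvPolynomial (Fin q) ℝ}
    (h : ∀ i, n • F i + (κ / 2) • ∑ j, ∑ l,
      (F i - swapPoly j l (F (Equiv.swap j l i))) = 0) (i : Fin q) : F i = 0 := by
  refine MvPolynomial.funext fun x => ?_
  rw [map_zero]
  -- Evaluation on the `S_q`-orbit of `x` turns the polynomial identity into one for the function
  -- `(w, i) ↦ F_i(x ∘ w)` on a finite set, where the minimum principle applies.
  have := eq_zero_of_add_sum_sub_eq_zero (Ω := Equiv.Perm (Fin q) × Fin q) (A := Fin q × Fin q)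
    (fun a ω => (ω.1 * Equiv.swap a.1 a.2, Equiv.swap a.1 a.2 ω.2)) hn
    (c := κ / 2) (by positivity) (F := fun ω => eval (x ∘ ω.1) (F ω.2)) (fun ω => ?_) (1, i)
  · simpa using this
  · have := congrArg (eval (x ∘ ω.1)) (h ω.2)
    rw [map_zero] at this
    rw [← this, Fintype.sum_prod_type]
    simp [smul_eval, eval_rename, Function.comp_assoc]

theorem eq_zero_of_scalar_euler {κ n : ℝ} (hκ : 0 ≤ κ) (hn : 0 < n)
    {f : MvPolynomial (Fin q) ℝ}
    (h : n • f + (κ / 2) • ∑ j, ∑ l, (f - swapPoly j l f) = 0) : f = 0 := by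
  rcases q.eq_zero_or_pos with rfl | hq
  · simpa [hn.ne'] using h
  · exact eq_zero_of_vector_euler hκ hn (F := fun _ => f) (fun _ => h) ⟨0, hq⟩

end PolynomialDunkl

end OlshanskiPair

end

noncomputable section

namespace OlshanskiPair

open MvPolynomial

/-! ### The homogeneous components of the Dunkl kernel -/

section KernelComponents

variable {q : ℕ}

/-- The operator `n + (κ/2) ∑ (1 - s_{jl})` on functions on `S_q` is injective by the minimum
principle, hence surjective; `c` is the preimage of the delta function at `1`. The same principle
gives `c ≥ 0`. The total mass is found by summing over the group, where the differences cancel by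
translation invariance. -/
theorem exists_resolvent {κ n : ℝ} (hκ : 0 ≤ κ) (hn : 0 < n) :
    ∃ c : Equiv.Perm (Fin q) → ℝ, (∀ w, 0 ≤ c w) ∧ ∑ w, c w = n⁻¹ ∧
      ∀ w, n * c w + κ / 2 * ∑ j, ∑ l, (c w - c (Equiv.swap j l * w)) =
        if w = 1 then 1 else 0 := by
  have hκ2 : 0 ≤ κ / 2 := by positivity
  let L : (Equiv.Perm (Fin q) → ℝ) →ₗ[ℝ] (Equiv.Perm (Fin q) → ℝ) :=
    { toFun := fun c w => n * c w + κ / 2 * ∑ a : Fin q × Fin q,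
        (c w - c (Equiv.swap a.1 a.2 * w))
      map_add' := fun c c' => by
        ext w
        simp only [Pi.add_apply, add_sub_add_comm, Finset.sum_add_distrib]
        ring
      map_smul' := fun r c => by
        ext w
        simp only [Pi.smul_apply, smul_eq_mul, RingHom.id_apply, ← mul_sub, ← Finset.mul_sum]
        ring }
  have hinj : Function.Injective L := by
    rw [← LinearMap.ker_eq_bot, LinearMap.ker_eq_bot']
    intro c hc
    ext w
    exact eq_zero_of_add_sum_sub_eq_zero (fun (a : Fin q × Fin q) w => Equiv.swap a.1 a.2 * w)
      hn hκ2 (fun w => congrFun hc w) w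
  obtain ⟨c, hc⟩ := LinearMap.injective_iff_surjective.mp hinj fun w => if w = 1 then 1 else 0
  have hc' : ∀ w, n * c w + κ / 2 * ∑ a : Fin q × Fin q, (c w - c (Equiv.swap a.1 a.2 * w)) =
      if w = 1 then 1 else 0 := fun w => congrFun hc w
  refine ⟨c, ?_, ?_, fun w => ?_⟩
  · refine nonneg_of_add_sum_sub_nonneg (fun (a : Fin q × Fin q) w => Equiv.swap a.1 a.2 * w)
      hn hκ2 fun w => ?_
    rw [hc' w]
    split_ifs <;> norm_num
  · have h1 : ∑ w, (n * c w + κ / 2 * ∑ a : Fin q × Fin q,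
        (c w - c (Equiv.swap a.1 a.2 * w))) = 1 := by
      rw [Finset.sum_congr rfl fun w _ => hc' w]
      simp
    have h2 : ∑ w, ∑ a : Fin q × Fin q, (c w - c (Equiv.swap a.1 a.2 * w)) = 0 := by
      rw [Finset.sum_comm]
      refine Finset.sum_eq_zero fun a _ => ?_
      rw [Finset.sum_sub_distrib, sub_eq_zero]
      exact (Equiv.sum_comp (Equiv.mulLeft (Equiv.swap a.1 a.2)) c).symm
    rw [Finset.sum_add_distrib, ← Finset.mul_sum, ← Finset.mul_sum, h2, mul_zero, add_zero] at h1
    exact eq_inv_of_mul_eq_one_right h1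
  · rw [← hc' w, Fintype.sum_prod_type]

/-- The coefficients of the inverse of `n + (κ / 2) ∑_{j,l} (1 - s_{jl})` in the group algebra of
the symmetric group. -/
def resolvent {κ : ℝ} (hκ : 0 ≤ κ) (n : ℕ) : Equiv.Perm (Fin q) → ℝ :=
  (exists_resolvent (q := q) hκ (n := n + 1) (by positivity)).choose

variable {κ : ℝ} (hκ : 0 ≤ κ) (y : Fin q → ℝ)

theorem resolvent_nonneg (n : ℕ) (w : Equiv.Perm (Fin q)) : 0 ≤ resolvent hκ n w :=
  (exists_resolvent (q := q) hκ (n := n + 1) (by positivity)).choose_spec.1 w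

/-- The index `n` refers to the passage from degree `n` to degree `n + 1`, so the inverted operator
has leading constant `n + 1`. -/
theorem sum_resolvent (n : ℕ) :
    ∑ w : Equiv.Perm (Fin q), resolvent hκ n w = ((n : ℝ) + 1)⁻¹ :=
  (exists_resolvent (q := q) hκ (n := n + 1) (by positivity)).choose_spec.2.1

theorem resolvent_eq (n : ℕ) (w : Equiv.Perm (Fin q)) :
    ((n : ℝ) + 1) * resolvent hκ n w +
      κ / 2 * ∑ j, ∑ l, (resolvent hκ n w - resolvent hκ n (Equiv.swap j l * w)) =
        if w = 1 then 1 else 0 :=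
  (exists_resolvent (q := q) hκ (n := n + 1) (by positivity)).choose_spec.2.2 w

/-- The linear form `⟨·, y⟩`. -/
def linForm : MvPolynomial (Fin q) ℝ := ∑ l, y l • X l

theorem eval_linForm (x : Fin q → ℝ) : eval x (linForm y) = ∑ l, x l * y l := by
  simp [linForm, smul_eval, mul_comm]

/-- The component of degree `n` of the Dunkl kernel `E_κ(·, y)`. -/
def kernelPoly : ℕ → MvPolynomial (Fin q) ℝ
  | 0 => 1
  | n + 1 => ∑ w : Equiv.Perm (Fin q), resolvent hκ n w • rename w (linForm y * kernelPoly n)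

theorem kernelPoly_zero : kernelPoly hκ y 0 = 1 := rfl

theorem kernelPoly_succ (n : ℕ) : kernelPoly hκ y (n + 1) =
    ∑ w : Equiv.Perm (Fin q), resolvent hκ n w • rename w (linForm y * kernelPoly hκ y n) := rfl

theorem isHomogeneous_linForm : (linForm y).IsHomogeneous 1 :=
  IsHomogeneous.sum _ _ _ fun l _ => by
    rw [smul_eq_C_mul]
    simpa using (isHomogeneous_C _ (y l)).mul (isHomogeneous_X ℝ l)

theorem isHomogeneous_kernelPoly (n : ℕ) : (kernelPoly hκ y n).IsHomogeneous n := by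
  induction n with
  | zero => exact isHomogeneous_one _ _
  | succ n ih =>
    rw [kernelPoly_succ]
    refine IsHomogeneous.sum _ _ _ fun w _ => ?_
    rw [smul_eq_C_mul]
    have := ((isHomogeneous_linForm y).mul ih).rename_isHomogeneous (f := w)
    rw [add_comm 1 n] at this
    simpa using (isHomogeneous_C _ (resolvent hκ n w)).mul this

/-- This is Euler's identity for a component of degree `n + 1` with `T_i E_{n+1} = y_i E_n`. It
holds by construction, since the resolvent inverts the operator on the left; the eigenvalue
equations themselves are deduced from it afterwards. -/
theorem euler_kernelPoly_succ (n : ℕ) :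
    ((n : ℝ) + 1) • kernelPoly hκ y (n + 1) + (κ / 2) • ∑ j, ∑ l,
      (kernelPoly hκ y (n + 1) - swapPoly j l (kernelPoly hκ y (n + 1))) =
      linForm y * kernelPoly hκ y n := by
  set g := linForm y * kernelPoly hκ y n with hg
  set c := resolvent (q := q) hκ n with hc
  have h1 : ∀ j l : Fin q, swapPoly j l (kernelPoly hκ y (n + 1)) =
      ∑ w, c (Equiv.swap j l * w) • rename w g := by
    intro j l
    rw [kernelPoly_succ, map_sum, ← Equiv.sum_comp (Equiv.mulLeft (Equiv.swap j l))]
    refine Finset.sum_congr rfl fun w _ => ?_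
    rw [map_smul, rename_rename, ← hg]
    congr 2
    ext m
    simp
  simp only [h1]
  have h2 : ∀ j l : Fin q, kernelPoly hκ y (n + 1) - ∑ w, c (Equiv.swap j l * w) • rename w g =
      ∑ w, (c w - c (Equiv.swap j l * w)) • rename w g := by
    intro j l
    rw [kernelPoly_succ, ← Finset.sum_sub_distrib]
    exact Finset.sum_congr rfl fun w _ => (sub_smul _ _ _).symm
  have h3 : ∑ j, ∑ l, ∑ w, (c w - c (Equiv.swap j l * w)) • rename w g =
      ∑ w, (∑ j, ∑ l, (c w - c (Equiv.swap j l * w))) • rename w g := by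
    simp only [Finset.sum_smul]
    rw [Finset.sum_comm' (t' := Finset.univ) (s' := fun _ => Finset.univ) (by simp)]
    rw [Finset.sum_comm]
    simp only [Finset.sum_comm (s := (Finset.univ : Finset (Fin q)))
      (t := (Finset.univ : Finset (Equiv.Perm (Fin q))))]
  simp only [h2, h3]
  rw [kernelPoly_succ, ← hg, ← hc]
  rw [Finset.smul_sum, Finset.smul_sum, ← Finset.sum_add_distrib]
  simp only [smul_smul, ← add_smul, hc, resolvent_eq]
  rw [Finset.sum_eq_single 1]
  · simp [hg]
  · intro w _ hw; simp [hw]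
  · simp

theorem dunklT_linForm_mul (i : Fin q) (f : MvPolynomial (Fin q) ℝ) :
    dunklT κ i (linForm y * f) = linForm y * dunklT κ i f + y i • f +
      κ • ∑ j, (y i - y j) • swapPoly i j f := by
  simp only [linForm, Finset.sum_mul, map_sum, smul_mul_assoc, map_smul, dunklT_X_mul, smul_add,
    Finset.sum_add_distrib]
  congr 1
  · simp
  · simp only [smul_comm _ κ, ← Finset.smul_sum]
    congr 1
    simp only [Finset.smul_sum, smul_smul]
    rw [Finset.sum_comm]
    refine Finset.sum_congr rfl fun j _ => ?_
    rw [← Finset.sum_smul]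
    congr 1
    simp [mul_sub]

/-- Only transpositions moving `i` contribute, and each of them occurs twice among the pairs `(j,
l)`. -/
theorem sum_swap_smul (i : Fin q) (f : MvPolynomial (Fin q) ℝ) :
    ∑ j, ∑ l, (y i - y (Equiv.swap j l i)) • swapPoly j l f =
      (2 : ℝ) • ∑ j, (y i - y j) • swapPoly i j f := by
  have h : ∀ j l, (y i - y (Equiv.swap j l i)) • swapPoly j l f =
      (if j = i then (y i - y l) • swapPoly i l f else 0) +
      (if l = i then (y i - y j) • swapPoly i j f else 0) := by
    intro j l
    by_cases h1 : j = i
    · subst h1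
      by_cases h2 : l = j
      · subst h2; simp
      · simp [h2]
    · by_cases h2 : l = i
      · subst h2
        simp [h1, swapPoly, Equiv.swap_comm j l]
      · rw [Equiv.swap_apply_of_ne_of_ne (Ne.symm h1) (Ne.symm h2)]
        simp [h1, h2]
  simp only [h, Finset.sum_add_distrib]
  rw [two_smul]
  simp

theorem dunklT_kernelPoly_succ (n : ℕ) (i : Fin q) :
    dunklT κ i (kernelPoly hκ y (n + 1)) = y i • kernelPoly hκ y n := by
  -- The first half of the induction hypothesis says that `⟨x, y⟩ T_i E_n` is `y_i` times the Euler
  -- operator applied to `E_n`. For `n ≥ 1` it follows from `T_i E_n = y_i E_{n-1}` and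
  -- `euler_kernelPoly_succ`.
  suffices H : ∀ n, (∀ i, linForm y * dunklT κ i (kernelPoly hκ y n) =
      y i • ((n : ℝ) • kernelPoly hκ y n + (κ / 2) • ∑ j, ∑ l,
        (kernelPoly hκ y n - swapPoly j l (kernelPoly hκ y n)))) ∧
      ∀ i, dunklT κ i (kernelPoly hκ y (n + 1)) = y i • kernelPoly hκ y n from (H n).2 i
  intro n
  have step : ∀ n, (∀ i, linForm y * dunklT κ i (kernelPoly hκ y n) =
      y i • ((n : ℝ) • kernelPoly hκ y n + (κ / 2) • ∑ j, ∑ l,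
        (kernelPoly hκ y n - swapPoly j l (kernelPoly hκ y n)))) →
      ∀ i, dunklT κ i (kernelPoly hκ y (n + 1)) = y i • kernelPoly hκ y n := by
    intro n hn i
    rw [← sub_eq_zero]
    refine eq_zero_of_vector_euler hκ (n := n + 1) (by positivity) (F := fun i =>
      dunklT κ i (kernelPoly hκ y (n + 1)) - y i • kernelPoly hκ y n) (fun i => ?_) i
    -- Applying `T_i` to Euler's identity shows that the defects `T_i E_{n+1} - y_i E_n` solve the
    -- homogeneous vector Euler equation, which has only the zero solution.
    have h1 := congrArg (dunklT κ i) (euler_kernelPoly_succ hκ y n)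
    rw [dunklT_linForm_mul, hn i] at h1
    simp only [map_add, map_smul, map_sum, map_sub, dunklT_swapPoly] at h1
    have h2 := sum_swap_smul y i (kernelPoly hκ y n)
    have e1 : ∑ j, ∑ l, (dunklT κ i (kernelPoly hκ y (n + 1)) - y i • kernelPoly hκ y n -
        swapPoly j l (dunklT κ (Equiv.swap j l i) (kernelPoly hκ y (n + 1)) -
          y (Equiv.swap j l i) • kernelPoly hκ y n)) =
        ∑ j, ∑ l, (dunklT κ i (kernelPoly hκ y (n + 1)) -
          swapPoly j l (dunklT κ (Equiv.swap j l i) (kernelPoly hκ y (n + 1)))) -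
        y i • ∑ j, ∑ l, (kernelPoly hκ y n - swapPoly j l (kernelPoly hκ y n)) -
        ∑ j, ∑ l, (y i - y (Equiv.swap j l i)) • swapPoly j l (kernelPoly hκ y n) := by
      simp only [Finset.smul_sum, ← Finset.sum_sub_distrib]
      refine Finset.sum_congr rfl fun j _ => Finset.sum_congr rfl fun l _ => ?_
      rw [map_sub, map_smul]
      module
    rw [e1, h2]
    linear_combination (norm := module) h1
  induction n with
  | zero =>
    have h0 : ∀ i, linForm y * dunklT κ i (kernelPoly hκ y 0) =
      y i • (((0 : ℕ) : ℝ) • kernelPoly hκ y 0 + (κ / 2) • ∑ j, ∑ l,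
        (kernelPoly hκ y 0 - swapPoly j l (kernelPoly hκ y 0))) := by
      intro i
      rw [kernelPoly_zero, ← C_1, dunklT_C]
      simp
    exact ⟨h0, step 0 h0⟩
  | succ n ih =>
    have h0 : ∀ i, linForm y * dunklT κ i (kernelPoly hκ y (n + 1)) =
      y i • (((n + 1 : ℕ) : ℝ) • kernelPoly hκ y (n + 1) + (κ / 2) • ∑ j, ∑ l,
        (kernelPoly hκ y (n + 1) - swapPoly j l (kernelPoly hκ y (n + 1)))) := by
      intro i
      rw [ih.2 i, mul_smul_comm, Nat.cast_succ, euler_kernelPoly_succ]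
    exact ⟨h0, step _ h0⟩

end KernelComponents

end OlshanskiPair

end

noncomputable section

namespace OlshanskiPair

open MvPolynomial

/-! ### Existence of the Dunkl kernel -/

section Existence

variable {q : ℕ}

theorem hasFDerivAt_eval (p : MvPolynomial (Fin q) ℝ) (x : Fin q → ℝ) :
    HasFDerivAt (fun x => eval x p)
      (∑ i, eval x (pderiv i p) • (ContinuousLinearMap.proj i : (Fin q → ℝ) →L[ℝ] ℝ)) x := by
  induction p using MvPolynomial.induction_on with
  | C a => simpa using hasFDerivAt_const a x
  | add f g hf hg =>
    simp only [map_add, add_smul, Finset.sum_add_distrib]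
    exact hf.add hg
  | mul_X f l hf =>
    have h := hf.mul ((ContinuousLinearMap.proj l : (Fin q → ℝ) →L[ℝ] ℝ).hasFDerivAt (x := x))
    simp only [map_mul, eval_X]
    refine h.congr_fderiv ?_
    refine ContinuousLinearMap.ext fun v => ?_
    simp only [Derivation.leibniz, pderiv_X, smul_eq_mul, map_add, map_mul, eval_X]
    simp [add_mul, Finset.sum_add_distrib, Pi.single_apply, apply_ite, Finset.mul_sum, mul_assoc]

variable {κ : ℝ} (hκ : 0 ≤ κ) (y : Fin q → ℝ)

/-- Permutation of the coordinates, as a continuous linear map. -/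
def permCLM (w : Equiv.Perm (Fin q)) : (Fin q → ℝ) →L[ℝ] (Fin q → ℝ) :=
  ContinuousLinearMap.pi fun i => ContinuousLinearMap.proj (w i)

theorem norm_permCLM_le (w : Equiv.Perm (Fin q)) : ‖permCLM w‖ ≤ 1 :=
  ContinuousLinearMap.opNorm_le_bound _ zero_le_one fun x => by
    rw [one_mul]
    exact (pi_norm_le_iff_of_nonneg (norm_nonneg _)).mpr fun i => norm_le_pi_norm x (w i)

/-- The linear form `⟨·, y⟩` as a continuous linear map. -/
def linFormCLM : (Fin q → ℝ) →L[ℝ] ℝ := ∑ l, y l • ContinuousLinearMap.proj l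

theorem linFormCLM_apply (x : Fin q → ℝ) : linFormCLM y x = ∑ l, x l * y l := by
  simp [linFormCLM, mul_comm]

/-- Multilinear maps with the homogeneous components of the Dunkl kernel on the diagonal. -/
def kernelMultilinear : FormalMultilinearSeries ℝ (Fin q → ℝ) ℝ
  | 0 => ContinuousMultilinearMap.constOfIsEmpty ℝ _ 1
  | n + 1 => ∑ w : Equiv.Perm (Fin q), resolvent hκ n w •
      (((linFormCLM y).smulRight (kernelMultilinear n)).uncurryLeft).compContinuousLinearMap
        fun _ => permCLM w

theorem kernelMultilinear_diag (n : ℕ) (x : Fin q → ℝ) :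
    kernelMultilinear hκ y n (fun _ => x) = eval x (kernelPoly hκ y n) := by
  induction n generalizing x with
  | zero => simp [kernelMultilinear, kernelPoly]
  | succ n ih =>
    rw [kernelMultilinear, kernelPoly_succ, map_sum, _root_.sum_apply]
    refine Finset.sum_congr rfl fun w _ => ?_
    rw [smul_eval, eval_rename, map_mul, ← ih, eval_linForm, ← linFormCLM_apply]
    rfl

/-- Permutations of coordinates are contractions and the resolvent coefficients are nonnegative with
sum `1/(n+1)`, so each degree costs a factor `‖y‖/(n+1)`, where `‖y‖` is the norm of the linear
form. -/
theorem norm_kernelMultilinear_le (n : ℕ) :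
    ‖kernelMultilinear hκ y n‖ ≤ ‖linFormCLM y‖ ^ n / n.factorial := by
  induction n with
  | zero => simp [kernelMultilinear]
  | succ n ih =>
    rw [kernelMultilinear]
    refine (norm_sum_le _ _).trans ?_
    have h : ∀ w : Equiv.Perm (Fin q), ‖resolvent hκ n w •
        (((linFormCLM y).smulRight (kernelMultilinear hκ y n)).uncurryLeft).compContinuousLinearMap
          fun _ => permCLM w‖ ≤ resolvent hκ n w *
            (‖linFormCLM y‖ * (‖linFormCLM y‖ ^ n / n.factorial)) := by
      intro w
      rw [norm_smul, Real.norm_of_nonneg (resolvent_nonneg hκ n w)]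
      refine mul_le_mul_of_nonneg_left ?_ (resolvent_nonneg hκ n w)
      refine (ContinuousMultilinearMap.norm_compContinuousLinearMap_le _ _).trans ?_
      rw [ContinuousLinearMap.uncurryLeft_norm, ContinuousLinearMap.norm_smulRight_apply]
      refine (mul_le_of_le_one_right (by positivity) ?_).trans
        (mul_le_mul_of_nonneg_left ih (norm_nonneg _))
      exact Finset.prod_le_one (fun _ _ => norm_nonneg _) fun _ _ => norm_permCLM_le w
    refine (Finset.sum_le_sum fun w _ => h w).trans ?_
    rw [← Finset.sum_mul, sum_resolvent]
    refine le_of_eq ?_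
    rw [Nat.factorial_succ]
    push_cast
    have : (n.factorial : ℝ) ≠ 0 := by positivity
    field_simp
    ring

theorem kernelMultilinear_radius : (kernelMultilinear hκ y).radius = ⊤ := by
  refine FormalMultilinearSeries.radius_eq_top_of_summable_norm _ fun r => ?_
  refine Summable.of_nonneg_of_le (fun n => by positivity) (fun n => ?_)
    (Real.summable_pow_div_factorial (‖linFormCLM y‖ * r))
  refine (mul_le_mul_of_nonneg_right (norm_kernelMultilinear_le hκ y n) (by positivity)).trans ?_
  rw [mul_pow, div_mul_eq_mul_div]

/-- The Dunkl kernel `E_κ(·, y)` for real `y`. -/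
def dunklE (x : Fin q → ℝ) : ℝ := ∑' n, eval x (kernelPoly hκ y n)

theorem hasFPowerSeriesOnBall_dunklE :
    HasFPowerSeriesOnBall (dunklE hκ y) (kernelMultilinear hκ y) 0 ⊤ := by
  have h := (kernelMultilinear hκ y).hasFPowerSeriesOnBall
    (by rw [kernelMultilinear_radius]; exact ENNReal.zero_lt_top)
  rw [kernelMultilinear_radius] at h
  have e : (kernelMultilinear hκ y).sum = dunklE hκ y := by
    funext x
    simp [FormalMultilinearSeries.sum, dunklE, kernelMultilinear_diag]
  rwa [e] at h

theorem hasSum_dunklE (x : Fin q → ℝ) :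
    HasSum (fun n => eval x (kernelPoly hκ y n)) (dunklE hκ y x) := by
  have := (hasFPowerSeriesOnBall_dunklE hκ y).hasSum (y := x) (by simp)
  simpa [kernelMultilinear_diag] using this

theorem analyticOnNhd_dunklE : AnalyticOnNhd ℝ (dunklE hκ y) Set.univ := by
  have := (hasFPowerSeriesOnBall_dunklE hκ y).analyticOnNhd
  simpa using this

/-- The Lipschitz bound for a multilinear map on the diagonal of a ball. It provides the summable
majorant for termwise differentiation. -/
theorem norm_fderiv_kernelPoly_le (n : ℕ) {R : ℝ} {x : Fin q → ℝ}
    (hx : x ∈ Metric.ball (0 : Fin q → ℝ) R) :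
    ‖∑ i, eval x (pderiv i (kernelPoly hκ y n)) •
      (ContinuousLinearMap.proj i : (Fin q → ℝ) →L[ℝ] ℝ)‖ ≤
      ‖linFormCLM y‖ ^ n / n.factorial * n * R ^ (n - 1) := by
  have hR : 0 ≤ R := dist_nonneg.trans (Metric.mem_ball.mp hx).le
  rw [← (hasFDerivAt_eval (kernelPoly hκ y n) x).fderiv]
  have hlip : LipschitzOnWith (Real.toNNReal (‖linFormCLM y‖ ^ n / n.factorial * n * R ^ (n - 1)))
      (fun x => eval x (kernelPoly hκ y n)) (Metric.ball 0 R) := by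
    refine LipschitzOnWith.of_dist_le_mul fun a ha b hb => ?_
    rw [Real.coe_toNNReal _ (by positivity), dist_eq_norm, dist_eq_norm,
      ← kernelMultilinear_diag, ← kernelMultilinear_diag]
    refine ((kernelMultilinear hκ y n).norm_image_sub_le _ _).trans ?_
    rw [Fintype.card_fin]
    have h1 : ∀ v : Fin q → ℝ, ‖(fun _ : Fin n => v)‖ ≤ ‖v‖ := fun v =>
      pi_norm_const_le v
    have ha' : ‖a‖ ≤ R := by simpa using (Metric.mem_ball.mp ha).le
    have hb' : ‖b‖ ≤ R := by simpa using (Metric.mem_ball.mp hb).le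
    have h2 : max ‖(fun _ : Fin n => a)‖ ‖(fun _ : Fin n => b)‖ ≤ R :=
      max_le ((h1 a).trans ha') ((h1 b).trans hb')
    have h3 : ‖(fun _ : Fin n => a) - (fun _ : Fin n => b)‖ ≤ ‖a - b‖ := h1 (a - b)
    gcongr
    exact norm_kernelMultilinear_le hκ y n
  have := norm_fderiv_le_of_lipschitzOn ℝ (Metric.isOpen_ball.mem_nhds hx) hlip
  rwa [Real.coe_toNNReal _ (by positivity)] at this

theorem hasSum_fderiv_dunklE (x : Fin q → ℝ) (i : Fin q) :
    HasSum (fun n => eval x (pderiv i (kernelPoly hκ y n)))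
      (fderiv ℝ (dunklE hκ y) x (Pi.single i 1)) := by
  set R := ‖x‖ + 1
  have hx : x ∈ Metric.ball (0 : Fin q → ℝ) R := by simp [R]
  set L := ‖linFormCLM y‖
  have hu : Summable fun n : ℕ => L ^ n / n.factorial * n * R ^ (n - 1) := by
    rw [← summable_nat_add_iff 1]
    refine ((Real.summable_pow_div_factorial (L * R)).mul_left L).congr fun n => ?_
    rw [Nat.factorial_succ, Nat.add_sub_cancel, mul_pow]
    push_cast
    have : (n.factorial : ℝ) ≠ 0 := by positivity
    field_simp
    ring
  have hd : ∀ n, ∀ z ∈ Metric.ball (0 : Fin q → ℝ) R,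
      ‖∑ i, eval z (pderiv i (kernelPoly hκ y n)) •
        (ContinuousLinearMap.proj i : (Fin q → ℝ) →L[ℝ] ℝ)‖ ≤
          L ^ n / n.factorial * n * R ^ (n - 1) :=
    fun n z hz => norm_fderiv_kernelPoly_le hκ y n hz
  have h := hasFDerivAt_tsum_of_isPreconnected hu Metric.isOpen_ball
    (convex_ball (0 : Fin q → ℝ) R).isPreconnected
    (fun n z _ => hasFDerivAt_eval (kernelPoly hκ y n) z) hd hx
    (hasSum_dunklE hκ y x).summable hx
  have h' : fderiv ℝ (dunklE hκ y) x = _ := h.fderiv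
  rw [h']
  have hs : Summable fun n => ∑ i, eval x (pderiv i (kernelPoly hκ y n)) •
        (ContinuousLinearMap.proj i : (Fin q → ℝ) →L[ℝ] ℝ) :=
    Summable.of_norm_bounded hu fun n => hd n x hx
  have := hs.hasSum.mapL (ContinuousLinearMap.apply ℝ ℝ (Pi.single i 1 : Fin q → ℝ))
  simpa [Pi.single_apply] using this

theorem eval_divDiff {i j : Fin q} (f : MvPolynomial (Fin q) ℝ) {x : Fin q → ℝ}
    (hx : Function.Injective x) :
    eval x (divDiff i j f) = (eval x f - eval (x ∘ Equiv.swap i j) f) / (x i - x j) := by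
  by_cases h : i = j
  · subst h; simp [divDiff_self]
  · have h1 := congrArg (eval x) (mul_divDiff i j f)
    have h2 : x i - x j ≠ 0 := sub_ne_zero.mpr fun e => h (hx e)
    rw [map_mul, map_sub, map_sub, eval_X, eval_X, eval_rename] at h1
    rw [← h1, mul_div_cancel_left₀ _ h2]

/-- The series `∑ T_i E_n` is summed in two ways: termwise by the definition of `T_i`, and by `T_i
E_{n+1} = y_i E_n`, `T_i E_0 = 0`. -/
theorem dunklE_eigen (i : Fin q) {x : Fin q → ℝ} (hx : Function.Injective x) :
    fderiv ℝ (dunklE hκ y) x (Pi.single i 1) +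
      κ * ∑ j, (dunklE hκ y x - dunklE hκ y (x ∘ Equiv.swap i j)) / (x i - x j) =
      y i * dunklE hκ y x := by
  have h1 : HasSum (fun n => eval x (dunklT κ i (kernelPoly hκ y n)))
      (fderiv ℝ (dunklE hκ y) x (Pi.single i 1) +
      κ * ∑ j, (dunklE hκ y x - dunklE hκ y (x ∘ Equiv.swap i j)) / (x i - x j)) := by
    simp only [dunklT_apply, map_add, smul_eval, map_sum, eval_divDiff _ hx]
    refine (hasSum_fderiv_dunklE hκ y x i).add (HasSum.mul_left _ (hasSum_sum fun j _ => ?_))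
    exact ((hasSum_dunklE hκ y x).sub (hasSum_dunklE hκ y _)).div_const _
  have h2 : HasSum (fun n => eval x (dunklT κ i (kernelPoly hκ y n))) (y i * dunklE hκ y x) := by
    rw [← hasSum_nat_add_iff' 1]
    simp only [dunklT_kernelPoly_succ, smul_eval, Finset.range_one, Finset.sum_singleton,
      kernelPoly_zero]
    rw [← C_1, dunklT_C, map_zero, sub_zero]
    exact (hasSum_dunklE hκ y x).mul_left _
  exact h1.unique h2

theorem dunklE_zero : dunklE hκ y 0 = 1 := by
  have h := hasSum_dunklE hκ y 0
  refine h.unique ?_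
  have : ∀ n, n ≠ 0 → eval (0 : Fin q → ℝ) (kernelPoly hκ y n) = 0 := by
    intro n hn
    rw [eval_zero, constantCoeff_eq]
    exact (isHomogeneous_kernelPoly hκ y n).coeff_eq_zero (by simpa using hn.symm)
  have h2 := hasSum_single (f := fun n => eval (0 : Fin q → ℝ) (kernelPoly hκ y n)) 0 this
  simpa [kernelPoly_zero] using h2

theorem isDunklKernel_dunklE :
    IsDunklKernel κ (fun i => (y i : ℂ)) (fun x => (dunklE hκ y x : ℂ)) where
  analytic := (Complex.ofRealCLM.analyticOnNhd Set.univ).comp (analyticOnNhd_dunklE hκ y)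
    (Set.mapsTo_univ _ _)
  map_zero := by simp [dunklE_zero]
  eigen i x hx := by
    have hd : fderiv ℝ (fun x => (dunklE hκ y x : ℂ)) x (Pi.single i 1) =
        (fderiv ℝ (dunklE hκ y) x (Pi.single i 1) : ℂ) := by
      have h := ((analyticOnNhd_dunklE hκ y x (Set.mem_univ x)).differentiableAt).hasFDerivAt
      have h2 : HasFDerivAt (fun x => (dunklE hκ y x : ℂ))
        (Complex.ofRealCLM.comp (fderiv ℝ (dunklE hκ y) x)) x :=
        Complex.ofRealCLM.hasFDerivAt.comp x h
      rw [h2.fderiv]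
      simp
    -- The extra summand `j = i` is `0 / 0`, which is zero by convention.
    rw [dunklOp, hd, ← Complex.ofReal_mul, ← dunklE_eigen hκ y i hx,
      ← Finset.sum_erase_add _ _ (Finset.mem_univ i)]
    push_cast
    simp

end Existence

end OlshanskiPair

end

noncomputable section

namespace OlshanskiPair

open MvPolynomial

/-! ### Uniqueness of the Dunkl kernel -/

section Uniqueness

variable {q : ℕ} {κ : ℝ} {y : Fin q → ℂ}

theorem IsDunklKernel.differentiableAt {f : (Fin q → ℝ) → ℂ} (hf : IsDunklKernel κ y f)
    (x : Fin q → ℝ) : DifferentiableAt ℝ f x :=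
  (hf.analytic x (Set.mem_univ x)).differentiableAt

/-- Contracting the eigenvalue equations with `z` cancels the denominators `z_i - z_j`, as in
Euler's identity. What remains is a differential system along rays that couples only the points of
one `S_q`-orbit. -/
theorem IsDunklKernel.radial {f : (Fin q → ℝ) → ℂ} (hf : IsDunklKernel κ y f)
    {z : Fin q → ℝ} (hz : Function.Injective z) :
    fderiv ℝ f z z = (∑ i, (z i : ℂ) * y i) * f z -
      (κ / 2 : ℝ) * ∑ i, ∑ j, (f z - f (z ∘ Equiv.swap i j)) := by
  set D : Fin q → Fin q → ℂ :=
    fun i j => (f z - f (z ∘ Equiv.swap i j)) / ((z i - z j : ℝ) : ℂ) with hD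
  have h1 : ∀ i, fderiv ℝ f z (Pi.single i 1) = y i * f z - κ * ∑ j, D i j := by
    intro i
    rw [← hf.eigen i z hz, dunklOp, ← Finset.sum_erase_add _ _ (Finset.mem_univ i)]
    simp [hD]
  have h2 : fderiv ℝ f z z = ∑ i, (z i : ℂ) * fderiv ℝ f z (Pi.single i 1) := by
    have e := congrArg (fderiv ℝ f z) (Finset.univ_sum_single z).symm
    rw [e, map_sum]
    refine Finset.sum_congr rfl fun i _ => ?_
    have : (Pi.single i (z i) : Fin q → ℝ) = z i • Pi.single i 1 := by
      rw [← Pi.single_smul, smul_eq_mul, mul_one]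
    rw [this, map_smul, Complex.real_smul]
  have h3 : ∀ i j, f z - f (z ∘ Equiv.swap i j) = (z i - z j) * D i j := by
    intro i j
    by_cases h : i = j
    · subst h; simp
    · have : (z i - z j : ℂ) ≠ 0 := by
        rw [← Complex.ofReal_sub, Complex.ofReal_ne_zero]
        exact sub_ne_zero.mpr fun e => h (hz e)
      simp only [hD, Complex.ofReal_sub]
      rw [mul_div_cancel₀ _ this]
  have h4 : ∀ i j, D j i = - D i j := by
    intro i j
    simp only [hD]
    rw [Equiv.swap_comm, ← neg_sub (z i) (z j), Complex.ofReal_neg, div_neg]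
  have h5 : ∑ i, ∑ j, (z j : ℂ) * D i j = - ∑ i, ∑ j, (z i : ℂ) * D i j := by
    rw [Finset.sum_comm, ← Finset.sum_neg_distrib]
    refine Finset.sum_congr rfl fun i _ => ?_
    rw [← Finset.sum_neg_distrib]
    refine Finset.sum_congr rfl fun j _ => ?_
    rw [h4 i j]; ring
  have h6 : ∑ i, ∑ j, (f z - f (z ∘ Equiv.swap i j)) = 2 * ∑ i, ∑ j, (z i : ℂ) * D i j := by
    simp only [h3, sub_mul, Finset.sum_sub_distrib]
    rw [h5]; ring
  rw [h6, h2]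
  simp only [h1, mul_sub, Finset.sum_sub_distrib, Finset.sum_mul]
  congr 1
  · exact Finset.sum_congr rfl fun i _ => by ring
  · push_cast
    rw [show (κ / 2 * (2 * ∑ i, ∑ j, (z i : ℂ) * D i j) : ℂ) = κ * ∑ i, ∑ j, (z i : ℂ) * D i j by
      ring, Finset.mul_sum]
    refine Finset.sum_congr rfl fun i _ => ?_
    rw [Finset.mul_sum, Finset.mul_sum, Finset.mul_sum]
    exact Finset.sum_congr rfl fun j _ => by ring

/-- Each summand is at least `(‖h ω‖² - ‖h (e ω)‖²) / 2`, and these bounds add up to zero because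
`e` is a bijection. -/
theorem sum_inner_sub_comp_nonneg {Ω : Type*} [Fintype Ω] (e : Equiv.Perm Ω) (h : Ω → ℂ) :
    0 ≤ ∑ ω, inner ℝ (h ω) (h ω - h (e ω)) := by
  have h1 : ∀ ω, (‖h ω‖ ^ 2 - ‖h (e ω)‖ ^ 2) / 2 ≤ inner ℝ (h ω) (h ω - h (e ω)) := by
    intro ω
    rw [inner_sub_right, real_inner_self_eq_norm_sq]
    have := real_inner_le_norm (h ω) (h (e ω))
    nlinarith [sq_nonneg (‖h ω‖ - ‖h (e ω)‖)]
  refine le_trans (le_of_eq ?_) (Finset.sum_le_sum fun ω _ => h1 ω)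
  rw [← Finset.sum_div, Finset.sum_sub_distrib, Equiv.sum_comp e fun ω => ‖h ω‖ ^ 2]
  simp

theorem IsDunklKernel.eq_of_injective (hκ : 0 ≤ κ) {f g : (Fin q → ℝ) → ℂ}
    (hf : IsDunklKernel κ y f) (hg : IsDunklKernel κ y g) {x : Fin q → ℝ}
    (hx : Function.Injective x) : f x = g x := by
  set h : (Fin q → ℝ) → ℂ := fun z => f z - g z with hh
  have hdiff : ∀ z, HasFDerivAt h (fderiv ℝ f z - fderiv ℝ g z) z := fun z =>
    (hf.differentiableAt z).hasFDerivAt.sub (hg.differentiableAt z).hasFDerivAt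
  set a : Equiv.Perm (Fin q) → ℂ := fun w => ∑ i, (x (w i) : ℂ) * y i with ha
  set H : Equiv.Perm (Fin q) → ℝ → ℂ := fun w t => h (t • (x ∘ w)) with hH
  set d : Equiv.Perm (Fin q) → ℝ → ℂ := fun w t =>
    (fderiv ℝ f (t • (x ∘ w)) - fderiv ℝ g (t • (x ∘ w))) (x ∘ w) with hd
  have hder : ∀ w t, HasDerivAt (H w) (d w t) t := by
    intro w t
    have h1 : HasDerivAt (fun t : ℝ => t • (x ∘ w)) (x ∘ w) t := by
      simpa using (hasDerivAt_id t).smul_const (x ∘ w)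
    exact (hdiff (t • (x ∘ w))).comp_hasDerivAt t h1
  have hrad : ∀ w, ∀ t : ℝ, 0 < t → (t : ℂ) * d w t = t * a w * H w t -
      (κ / 2 : ℝ) * ∑ i, ∑ j, (H w t - H (w * Equiv.swap i j) t) := by
    intro w t ht
    have hinj : Function.Injective (t • (x ∘ w)) := fun i j e =>
      w.injective (hx (mul_left_cancel₀ ht.ne' e))
    have e1 : (t : ℂ) * d w t = fderiv ℝ f (t • (x ∘ w)) (t • (x ∘ w)) -
        fderiv ℝ g (t • (x ∘ w)) (t • (x ∘ w)) := by
      rw [map_smul, map_smul, hd, ← smul_sub, Complex.real_smul]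
      rfl
    have e2 : ∑ i, ((t • (x ∘ w)) i : ℂ) * y i = t * a w := by
      rw [ha, Finset.mul_sum]
      refine Finset.sum_congr rfl fun i _ => ?_
      simp [mul_assoc]
    have e3 : ∀ i j : Fin q, (t • (x ∘ w)) ∘ Equiv.swap i j =
        t • (x ∘ (w * Equiv.swap i j : Equiv.Perm (Fin q))) := fun i j => rfl
    have e4 : ∑ i, ∑ j, (H w t - H (w * Equiv.swap i j) t) =
        ∑ i, ∑ j, (f (t • (x ∘ w)) - f ((t • (x ∘ w)) ∘ Equiv.swap i j)) -
        ∑ i, ∑ j, (g (t • (x ∘ w)) - g ((t • (x ∘ w)) ∘ Equiv.swap i j)) := by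
      simp only [← Finset.sum_sub_distrib]
      refine Finset.sum_congr rfl fun i _ => Finset.sum_congr rfl fun j _ => ?_
      rw [e3]
      simp only [hH, hh]
      ring
    rw [e1, hf.radial hinj, hg.radial hinj, e2, e4]
    simp only [hH, hh]
    ring
  -- The energy of the difference of the two kernels on the orbit of `t x`. The reflection terms
  -- enter its derivative with a favourable sign because `κ ≥ 0`, so `V' ≤ 2 C V`.
  set V : ℝ → ℝ := fun t => ∑ w, ‖H w t‖ ^ 2 with hV
  set V' : ℝ → ℝ := fun t => ∑ w, 2 * inner ℝ (H w t) (d w t) with hV'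
  have hVder : ∀ t, HasDerivAt V (V' t) t := fun t =>
    HasDerivAt.fun_sum fun w _ => (hder w t).norm_sq
  set C : ℝ := ∑ w, ‖a w‖ with hC
  have hbound : ∀ t, 0 < t → V' t ≤ 2 * C * V t := by
    intro t ht
    have k1 : ∀ w, t * inner ℝ (H w t) (d w t) = t * inner ℝ (H w t) (a w * H w t) -
        κ / 2 * ∑ i, ∑ j, inner ℝ (H w t) (H w t - H (w * Equiv.swap i j) t) := by
      intro w
      have e := congrArg (fun z => inner ℝ (H w t) z) (hrad w t ht)
      simp only [← Complex.real_smul, inner_sub_right, inner_smul_right, inner_sum,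
        smul_mul_assoc] at e
      simp only [inner_sub_right]
      exact e
    have k2 : ∀ w, inner ℝ (H w t) (a w * H w t) ≤ C * ‖H w t‖ ^ 2 := by
      intro w
      refine (real_inner_le_norm _ _).trans ?_
      rw [norm_mul]
      have : ‖a w‖ ≤ C := Finset.single_le_sum (f := fun w => ‖a w‖)
        (fun _ _ => norm_nonneg _) (Finset.mem_univ w)
      nlinarith [sq_nonneg ‖H w t‖]
    have k3 : 0 ≤ ∑ w, ∑ i, ∑ j, inner ℝ (H w t) (H w t - H (w * Equiv.swap i j) t) := by
      rw [Finset.sum_comm]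
      refine Finset.sum_nonneg fun i _ => ?_
      rw [Finset.sum_comm]
      refine Finset.sum_nonneg fun j _ => ?_
      exact sum_inner_sub_comp_nonneg (Equiv.mulRight (Equiv.swap i j)) fun w => H w t
    have k4 : t * V' t ≤ t * (2 * C * V t) := by
      have : t * V' t = 2 * ∑ w, t * inner ℝ (H w t) (d w t) := by
        rw [hV', Finset.mul_sum, Finset.mul_sum]
        exact Finset.sum_congr rfl fun w _ => by ring
      rw [this]
      simp only [k1, Finset.sum_sub_distrib, ← Finset.mul_sum]
      have k5 : ∑ w, inner ℝ (H w t) (a w * H w t) ≤ C * V t := by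
        rw [hV, Finset.mul_sum]
        exact Finset.sum_le_sum fun w _ => k2 w
      nlinarith [mul_nonneg hκ k3, mul_le_mul_of_nonneg_left k5 ht.le]
    exact le_of_mul_le_mul_left k4 ht
  have hV0 : V 0 = 0 := by
    simp [hV, hH, hh, hf.map_zero, hg.map_zero]
  -- Grönwall's argument: `exp(-2Ct) V(t)` decreases from `V(0) = 0`, so `V(1) = 0`.
  have hanti : AntitoneOn (fun t => Real.exp (-(2 * C) * t) * V t) (Set.Ici 0) := by
    have hW : ∀ t, HasDerivAt (fun t => Real.exp (-(2 * C) * t) * V t)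
        (Real.exp (-(2 * C) * t) * (-(2 * C)) * V t + Real.exp (-(2 * C) * t) * V' t) t := by
      intro t
      have h1 : HasDerivAt (fun t => -(2 * C) * t) (-(2 * C)) t := by
        simpa using (hasDerivAt_id t).const_mul (-(2 * C))
      exact h1.exp.mul (hVder t)
    refine antitoneOn_of_deriv_nonpos (convex_Ici 0)
      (fun t _ => (hW t).continuousAt.continuousWithinAt)
      (fun t _ => (hW t).differentiableAt.differentiableWithinAt) fun t ht => ?_
    rw [interior_Ici] at ht
    rw [(hW t).deriv]
    have := mul_le_mul_of_nonneg_left (hbound t ht) (Real.exp_nonneg (-(2 * C) * t))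
    linarith
  have h1 := hanti (Set.mem_Ici.mpr le_rfl) (Set.mem_Ici.mpr zero_le_one) zero_le_one
  simp only [hV0, mul_zero] at h1
  have hV1 : V 1 ≤ 0 := by
    by_contra hc
    exact absurd h1 (not_le.mpr (mul_pos (Real.exp_pos _) (not_le.mp hc)))
  have h2 : ‖H 1 1‖ ^ 2 ≤ V 1 := Finset.single_le_sum (f := fun w => ‖H w 1‖ ^ 2)
    (fun _ _ => by positivity) (Finset.mem_univ 1)
  have h3 : H 1 1 = 0 := by
    rw [← norm_eq_zero, ← sq_eq_zero_iff]
    exact le_antisymm (h2.trans hV1) (by positivity)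
  simpa [hH, hh, sub_eq_zero] using h3

/-- Along the direction `(0, 1, …, q - 1)` any two coordinates agree for at most one value of `t`.
Hence every point is a limit of points with distinct coordinates. -/
theorem eventually_injective_add_smul (x : Fin q → ℝ) :
    ∀ᶠ t : ℝ in nhdsWithin 0 {0}ᶜ, Function.Injective fun i => x i + t * (i : ℝ) := by
  have h : ∀ i j : Fin q, i ≠ j → ∀ᶠ t : ℝ in nhdsWithin 0 {0}ᶜ,
      x i + t * (i : ℝ) ≠ x j + t * (j : ℝ) := by
    intro i j hij
    have hne : ((i : ℕ) : ℝ) - (j : ℕ) ≠ 0 :=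
      sub_ne_zero.mpr fun e => hij (Fin.ext (Nat.cast_injective e))
    have : ∀ᶠ t : ℝ in nhdsWithin 0 {0}ᶜ, t ≠ (x j - x i) / ((i : ℕ) - (j : ℕ)) := by
      by_cases h0 : (x j - x i) / (((i : ℕ) : ℝ) - (j : ℕ)) = 0
      · rw [h0]; exact self_mem_nhdsWithin
      · exact (eventually_ne_nhds (Ne.symm h0)).filter_mono nhdsWithin_le_nhds
    filter_upwards [this] with t ht e
    refine ht ?_
    rw [eq_div_iff hne]
    linarith
  have h' : ∀ᶠ t : ℝ in nhdsWithin 0 {0}ᶜ, ∀ i j : Fin q, i ≠ j →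
      x i + t * (i : ℝ) ≠ x j + t * (j : ℝ) := by
    simp only [Filter.eventually_all]
    exact h
  filter_upwards [h'] with t ht i j e
  by_contra hij
  exact ht i j hij e

theorem IsDunklKernel.unique (hκ : 0 ≤ κ) {f g : (Fin q → ℝ) → ℂ}
    (hf : IsDunklKernel κ y f) (hg : IsDunklKernel κ y g) : f = g := by
  funext x
  have hc : Continuous fun t : ℝ => (fun i => x i + t * ((i : ℕ) : ℝ) : Fin q → ℝ) := by fun_prop
  have key : ∀ f : (Fin q → ℝ) → ℂ, IsDunklKernel κ y f →
      Filter.Tendsto (fun t : ℝ => f fun i => x i + t * ((i : ℕ) : ℝ)) (nhdsWithin 0 {0}ᶜ)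
        (nhds (f x)) := by
    intro f hf
    have hfc : Continuous f :=
      continuous_iff_continuousAt.mpr fun x => (hf.differentiableAt x).continuousAt
    have := (hfc.comp hc).tendsto 0
    simp only [Function.comp_def, zero_mul, add_zero] at this
    exact this.mono_left nhdsWithin_le_nhds
  refine tendsto_nhds_unique_of_eventuallyEq (key f hf) (key g hg) ?_
  filter_upwards [eventually_injective_add_smul x] with t ht
  exact hf.eq_of_injective hκ hg ht

theorem dunklKernel_eq_dunklE (hκ : 0 ≤ κ) (y x : Fin q → ℝ) :
    dunklKernel κ x (fun i => (y i : ℂ)) = dunklE hκ y x := by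
  have h : IsDunklKernel κ (fun i => (y i : ℂ))
      (Classical.epsilon (IsDunklKernel κ fun i => (y i : ℂ))) :=
    Classical.epsilon_spec ⟨_, isDunklKernel_dunklE hκ y⟩
  exact congrFun (h.unique hκ (isDunklKernel_dunklE hκ y)) x

end Uniqueness

end OlshanskiPair

end

noncomputable section

namespace OlshanskiPair

open MvPolynomial

/-! ### Symmetric joint eigenfunctions of the power sums of Dunkl operators -/

section SymmetricEigen

/-- Polynomial evaluation needs a commutative target; the subalgebra generated by a commuting family
is one. -/
theorem exists_algHom_of_commute {ι R A : Type*} [CommRing R] [Ring A] [Algebra R A] (f : ι → A)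
    (hf : ∀ i j, f i * f j = f j * f i) : ∃ ρ : MvPolynomial ι R →ₐ[R] A, ∀ i, ρ (X i) = f i := by
  have hc : ∀ a ∈ Set.range f, ∀ b ∈ Set.range f, a * b = b * a := by
    rintro _ ⟨i, rfl⟩ _ ⟨j, rfl⟩
    exact hf i j
  have := Algebra.isMulCommutative_adjoin R hc
  open scoped IsMulCommutative in
  exact ⟨(Algebra.adjoin R (Set.range f)).val.comp (aeval fun i =>
    (⟨f i, Algebra.subset_adjoin (Set.mem_range_self i)⟩ : Algebra.adjoin R (Set.range f))),
    fun i => by simp⟩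

variable {q : ℕ}

/-- Newton's identities express the elementary symmetric polynomials through power sums over `ℝ`,
and the fundamental theorem on symmetric polynomials does the rest. -/
theorem isSymmetric_mem_of_psum_mem (S : Subalgebra ℝ (MvPolynomial (Fin q) ℝ))
    (hS : ∀ n, psum (Fin q) ℝ n ∈ S) {p : MvPolynomial (Fin q) ℝ} (hp : p.IsSymmetric) :
    p ∈ S := by
  have he : ∀ k, esymm (Fin q) ℝ k ∈ S := by
    intro k
    induction k using Nat.strong_induction_on with
    | _ k ih =>
      rcases k.eq_zero_or_pos with rfl | hk
      · rw [esymm_zero]; exact S.one_mem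
      · have h := mul_esymm_eq_sum (Fin q) ℝ k
        have h1 : (k : MvPolynomial (Fin q) ℝ) * esymm (Fin q) ℝ k ∈ S := by
          rw [h]
          have hm : (-1 : MvPolynomial (Fin q) ℝ) ∈ S := S.neg_mem S.one_mem
          refine S.mul_mem (S.pow_mem hm _) (S.sum_mem fun a ha => ?_)
          exact S.mul_mem (S.mul_mem (S.pow_mem hm _) (ih _ (Finset.mem_filter.mp ha).2)) (hS _)
        have h2 : esymm (Fin q) ℝ k =
            (k : ℝ)⁻¹ • ((k : MvPolynomial (Fin q) ℝ) * esymm (Fin q) ℝ k) := by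
          have : (k : ℝ) ≠ 0 := by positivity
          rw [← nsmul_eq_mul, ← Nat.cast_smul_eq_nsmul ℝ, smul_smul, inv_mul_cancel₀ this, one_smul]
        rw [h2]
        exact S.smul_mem h1 _
  obtain ⟨r, hr⟩ := esymmAlgHom_surjective (σ := Fin q) ℝ (n := q) (by simp) ⟨p, hp⟩
  have : p = aeval (fun i : Fin q => esymm (Fin q) ℝ (i + 1)) r := by
    rw [← esymmAlgHom_apply, hr]
  rw [this]
  have hr' : ∀ r : MvPolynomial (Fin q) ℝ,
      aeval (fun i : Fin q => esymm (Fin q) ℝ (i + 1)) r ∈ S := by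
    intro r
    induction r using MvPolynomial.induction_on with
    | C a => rw [aeval_C]; exact S.algebraMap_mem a
    | add f g hf hg => rw [map_add]; exact S.add_mem hf hg
    | mul_X f l hf => rw [map_mul, aeval_X]; exact S.mul_mem hf (he _)
  exact hr' r

/-- Multiplication by the nonzero linear form `X_i - X_j` raises every degree by one, so a divided
difference of a homogeneous polynomial has no component outside the expected degree. -/
theorem isHomogeneous_dunklT (κ : ℝ) {n : ℕ} (i : Fin q) {f : MvPolynomial (Fin q) ℝ}
    (hf : f.IsHomogeneous (n + 1)) : (dunklT κ i f).IsHomogeneous n := by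
  have hdiv : ∀ j, (divDiff i j f).IsHomogeneous n := by
    intro j
    by_cases hij : i = j
    · subst hij; rw [divDiff_self]; exact isHomogeneous_zero _ _ _
    have h1 : ((X i - X j) * divDiff i j f).IsHomogeneous (n + 1) := by
      rw [mul_divDiff]
      exact hf.sub hf.rename_isHomogeneous
    set g := divDiff i j f
    have h2 : ∀ m ∈ Finset.range (g.totalDegree + 1), m ≠ n → homogeneousComponent m g = 0 := by
      intro m hmem hm
      have h3 := congrArg (fun g => homogeneousComponent (1 + m) ((X i - X j) * g))
        (sum_homogeneousComponent g)
      simp only [Finset.mul_sum, map_sum] at h3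
      have h4 : ∀ k, homogeneousComponent (1 + m) ((X i - X j) * homogeneousComponent k g) =
          if m = k then (X i - X j) * homogeneousComponent k g else 0 := by
        intro k
        rw [homogeneousComponent_of_mem (((isHomogeneous_X ℝ i).sub (isHomogeneous_X ℝ j)).mul
          (homogeneousComponent_isHomogeneous k g))]
        simp
      simp only [h4] at h3
      rw [Finset.sum_ite_eq, if_pos hmem, homogeneousComponent_of_mem h1,
        if_neg (by omega)] at h3
      exact (mul_eq_zero.mp h3).resolve_left (X_sub_X_ne_zero hij)
    rw [← sum_homogeneousComponent g]
    refine IsHomogeneous.sum _ _ _ fun m hmem => ?_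
    by_cases hm : m = n
    · subst hm; exact homogeneousComponent_isHomogeneous _ _
    · rw [h2 m hmem hm]; exact isHomogeneous_zero _ _ _
  rw [dunklT_apply, smul_eq_C_mul]
  exact (hf.pderiv).add ((IsHomogeneous.sum _ _ _ fun j _ => hdiv j).C_mul κ)

/-- The Dunkl operator on sequences of polynomials, combined with a shift of the index. -/
def dunklShift (κ : ℝ) (i : Fin q) : Module.End ℝ (ℕ → MvPolynomial (Fin q) ℝ) :=
  LinearMap.pi fun N => (dunklT κ i).comp (LinearMap.proj (N + 1))

/-- A sequence whose `N`-th term is homogeneous of degree `N` stands for a formal power series. The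
shift compensates the drop in degree, so that eigenvalue equations for the series become eigenvalue
equations of an endomorphism. -/
theorem dunklShift_apply (κ : ℝ) (i : Fin q) (f : ℕ → MvPolynomial (Fin q) ℝ) (N : ℕ) :
    dunklShift κ i f N = dunklT κ i (f (N + 1)) := rfl

theorem exists_dunklHom (κ : ℝ) : ∃ ρ : MvPolynomial (Fin q) ℝ →ₐ[ℝ]
    Module.End ℝ (ℕ → MvPolynomial (Fin q) ℝ), ∀ i, ρ (X i) = dunklShift κ i :=
  exists_algHom_of_commute _ fun i j => by
    refine LinearMap.ext fun f => funext fun N => ?_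
    exact dunklT_comm κ i j _

/-- Polynomials in the shifted Dunkl operators. -/
def dunklHom (κ : ℝ) : MvPolynomial (Fin q) ℝ →ₐ[ℝ]
    Module.End ℝ (ℕ → MvPolynomial (Fin q) ℝ) := (exists_dunklHom κ).choose

theorem dunklHom_X (κ : ℝ) (i : Fin q) : dunklHom κ (X i) = dunklShift κ i :=
  (exists_dunklHom κ).choose_spec i

theorem rename_dunklHom (κ : ℝ) (w : Equiv.Perm (Fin q)) (p : MvPolynomial (Fin q) ℝ)
    (f : ℕ → MvPolynomial (Fin q) ℝ) :
    (fun N => rename w (dunklHom κ p f N)) = dunklHom κ (rename w p) fun N => rename w (f N) := by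
  induction p using MvPolynomial.induction_on generalizing f with
  | C a =>
    rw [rename_C, ← algebraMap_eq, AlgHom.commutes]
    funext N
    simp [Module.algebraMap_end_apply]
  | add p r hp hr =>
    funext N
    simp only [map_add, LinearMap.add_apply, Pi.add_apply]
    rw [← hp, ← hr]
  | mul_X p l hp =>
    rw [map_mul, map_mul, rename_X, map_mul, dunklHom_X, dunklHom_X, Module.End.mul_apply,
      Module.End.mul_apply, hp]
    congr 1
    funext N
    rw [dunklShift_apply, dunklShift_apply, rename_dunklT]

/-- Nondegeneracy of the Dunkl pairing for `κ ≥ 0`. By induction applied to the shifted sequences,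
all `T_i D_{N+1}` vanish, and Euler's identity then kills `D_{N+1}`. -/
theorem eq_zero_of_constantCoeff_dunklHom {κ : ℝ} (hκ : 0 ≤ κ)
    {D : ℕ → MvPolynomial (Fin q) ℝ} (hD : ∀ N, (D N).IsHomogeneous N)
    (h : ∀ p, constantCoeff (dunklHom κ p D 0) = 0) (N : ℕ) : D N = 0 := by
  induction N generalizing D with
  | zero =>
    have h0 := h 1
    rw [map_one, Module.End.one_apply] at h0
    have h1 := totalDegree_eq_zero_iff_eq_C.mp ((totalDegree_zero_iff_isHomogeneous _).mpr (hD 0))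
    rw [h1, ← constantCoeff_eq, h0, map_zero]
  | succ N ih =>
    have h1 : ∀ i, dunklT κ i (D (N + 1)) = 0 := by
      intro i
      refine ih (D := dunklShift κ i D) (fun M => isHomogeneous_dunklT κ i (hD (M + 1))) fun p => ?_
      rw [← dunklHom_X, ← Module.End.mul_apply, ← map_mul]
      exact h _
    have h2 := sum_X_mul_dunklT κ (hD (N + 1))
    simp only [h1, mul_zero, Finset.sum_const_zero] at h2
    exact eq_zero_of_scalar_euler hκ (n := (N + 1 : ℕ)) (by positivity) h2.symm

variable {κ : ℝ} (hκ : 0 ≤ κ) (y : Fin q → ℝ)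

/-- The transform of the kernel by `w` is again a joint eigenfunction, with the eigenvalues
permuted. A symmetric `p` does not see the permutation, which is why the symmetrized kernel is an
eigenfunction of `p(T)`. -/
theorem dunklHom_rename_kernelPoly (w : Equiv.Perm (Fin q)) (p : MvPolynomial (Fin q) ℝ) :
    dunklHom κ p (fun N => rename w (kernelPoly hκ y N)) =
      eval (y ∘ w.symm) p • fun N => rename w (kernelPoly hκ y N) := by
  induction p using MvPolynomial.induction_on with
  | C a =>
    rw [← algebraMap_eq, AlgHom.commutes, Module.algebraMap_end_apply, algebraMap_eq, eval_C]
  | add p r hp hr => rw [map_add, LinearMap.add_apply, hp, hr, map_add, add_smul]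
  | mul_X p l hp =>
    rw [map_mul, Module.End.mul_apply, dunklHom_X]
    have : dunklShift κ l (fun N => rename w (kernelPoly hκ y N)) =
        y (w.symm l) • fun N => rename w (kernelPoly hκ y N) := by
      funext N
      have := rename_dunklT κ w (w.symm l) (kernelPoly hκ y (N + 1))
      rw [Equiv.apply_symm_apply] at this
      rw [dunklShift_apply, ← this, dunklT_kernelPoly_succ, map_smul, Pi.smul_apply]
    rw [this, map_smul, hp, smul_smul, map_mul, eval_X, mul_comm]
    rfl

/-- The symmetrization of the components of the Dunkl kernel. -/
def symKernelPoly (N : ℕ) : MvPolynomial (Fin q) ℝ :=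
  (q.factorial : ℝ)⁻¹ • ∑ w : Equiv.Perm (Fin q), rename w (kernelPoly hκ y N)

theorem dunklHom_symKernelPoly {p : MvPolynomial (Fin q) ℝ} (hp : p.IsSymmetric) :
    dunklHom κ p (symKernelPoly hκ y) = eval y p • symKernelPoly hκ y := by
  have e : symKernelPoly hκ y = (q.factorial : ℝ)⁻¹ • ∑ w : Equiv.Perm (Fin q),
      fun N => rename w (kernelPoly hκ y N) := by
    funext N
    simp [symKernelPoly]
  have h : ∀ w : Equiv.Perm (Fin q), eval (y ∘ w.symm) p = eval y p := fun w => by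
    rw [← eval_rename, hp]
  rw [e, map_smul, map_sum]
  simp only [dunklHom_rename_kernelPoly, h, ← Finset.smul_sum]
  rw [smul_comm]

theorem rename_symKernelPoly (w : Equiv.Perm (Fin q)) (N : ℕ) :
    rename w (symKernelPoly hκ y N) = symKernelPoly hκ y N := by
  rw [symKernelPoly, map_smul, map_sum]
  congr 1
  rw [← Equiv.sum_comp (Equiv.mulLeft w) fun v => rename v (kernelPoly hκ y N)]
  refine Finset.sum_congr rfl fun v _ => ?_
  rw [rename_rename]
  rfl

theorem isHomogeneous_symKernelPoly (N : ℕ) : (symKernelPoly hκ y N).IsHomogeneous N := by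
  rw [symKernelPoly, smul_eq_C_mul]
  exact (IsHomogeneous.sum _ _ _ fun w _ =>
    (isHomogeneous_kernelPoly hκ y N).rename_isHomogeneous).C_mul _

theorem symKernelPoly_zero : symKernelPoly hκ y 0 = 1 := by
  have : (q.factorial : ℝ) ≠ 0 := by positivity
  simp [symKernelPoly, kernelPoly_zero, Finset.card_univ, Fintype.card_perm,
    ← Nat.cast_smul_eq_nsmul ℝ, smul_smul, this]

/-- The components of the symmetrized Dunkl kernel are determined by the action of the power sums
of the Dunkl operators. -/
theorem eq_symKernelPoly {m : ℕ → Fin q → ℕ → MvPolynomial (Fin q) ℝ}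
    {Φ : ℕ → MvPolynomial (Fin q) ℝ} (hm0 : ∀ i, m 0 i = Φ)
    (hm : ∀ n i N, dunklT κ i (m n i (N + 1)) = m (n + 1) i N)
    (hsum : ∀ n N, ∑ i, m n i N = (∑ i, y i ^ n) • Φ N) (hhom : ∀ N, (Φ N).IsHomogeneous N)
    (hsymm : ∀ (w : Equiv.Perm (Fin q)) N, rename w (Φ N) = Φ N) (h0 : Φ 0 = 1) (N : ℕ) :
    Φ N = symKernelPoly hκ y N := by
  -- The hypotheses on `m` say that `m n i = T_i^n Φ`.
  have hpow : ∀ n i, dunklHom κ (X i ^ n) Φ = m n i := by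
    intro n i
    induction n with
    | zero => rw [pow_zero, map_one, Module.End.one_apply, hm0]
    | succ n ih =>
      rw [pow_succ', map_mul, Module.End.mul_apply, ih, dunklHom_X]
      exact funext fun N => hm n i N
  -- The polynomials `p` with `p(T) Φ = p(y) Φ` form a subalgebra; `hsum` places the power sums in
  -- it, hence all symmetric polynomials.
  let S : Subalgebra ℝ (MvPolynomial (Fin q) ℝ) :=
    { carrier := {p | dunklHom κ p Φ = eval y p • Φ}
      mul_mem' := fun {a b} ha hb => by
        simp only [Set.mem_ofPred_eq] at ha hb ⊢
        rw [map_mul, Module.End.mul_apply, hb, map_smul, ha, smul_smul, map_mul, mul_comm]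
      add_mem' := fun {a b} ha hb => by
        simp only [Set.mem_ofPred_eq] at ha hb ⊢
        rw [map_add, LinearMap.add_apply, ha, hb, map_add, add_smul]
      algebraMap_mem' := fun r => by
        simp only [Set.mem_ofPred_eq]
        rw [AlgHom.commutes, Module.algebraMap_end_apply, algebraMap_eq, eval_C] }
  have hΦ : ∀ p : MvPolynomial (Fin q) ℝ, p.IsSymmetric → dunklHom κ p Φ = eval y p • Φ := by
    intro p hp
    refine isSymmetric_mem_of_psum_mem S (fun n => ?_) hp
    change dunklHom κ (psum (Fin q) ℝ n) Φ = eval y (psum (Fin q) ℝ n) • Φ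
    rw [psum, map_sum, LinearMap.sum_apply]
    simp only [hpow]
    funext N
    rw [Finset.sum_apply, hsum, Pi.smul_apply]
    simp
  set D : ℕ → MvPolynomial (Fin q) ℝ := Φ - symKernelPoly hκ y with hDdef
  have hDsym : ∀ p : MvPolynomial (Fin q) ℝ, p.IsSymmetric → dunklHom κ p D = eval y p • D := by
    intro p hp
    rw [hDdef, map_sub, hΦ p hp, dunklHom_symKernelPoly hκ y hp, smul_sub]
  have hD0 : D 0 = 0 := by
    rw [hDdef, Pi.sub_apply, h0, symKernelPoly_zero, sub_self]
  have hDren : ∀ w : Equiv.Perm (Fin q), (fun N => rename w (D N)) = D := by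
    intro w
    funext N
    rw [hDdef, Pi.sub_apply, map_sub, hsymm, rename_symKernelPoly]
  have hl : ∀ (w : Equiv.Perm (Fin q)) p, constantCoeff (dunklHom κ (rename w p) D 0) =
      constantCoeff (dunklHom κ p D 0) := by
    intro w p
    have h1 := congrFun (rename_dunklHom κ w p D) 0
    rw [hDren w] at h1
    rw [← h1, constantCoeff_rename]
  -- The functional `p ↦ (p(T) D)(0)` is invariant under permutations since `D` is, so `p` may be
  -- replaced by its symmetrization. For symmetric `p` the value is `p(y) D_0 = 0`.
  have hz : ∀ p, constantCoeff (dunklHom κ p D 0) = 0 := by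
    intro p
    have hs : (∑ w : Equiv.Perm (Fin q), rename w p).IsSymmetric := by
      intro v
      rw [map_sum, ← Equiv.sum_comp (Equiv.mulLeft v) fun w => rename w p]
      exact Finset.sum_congr rfl fun w _ => by rw [rename_rename]; rfl
    have h1 : constantCoeff (dunklHom κ (∑ w : Equiv.Perm (Fin q), rename w p) D 0) = 0 := by
      rw [hDsym _ hs, Pi.smul_apply, hD0, smul_zero, map_zero]
    rw [map_sum, LinearMap.sum_apply, Finset.sum_apply, map_sum] at h1
    simp only [hl] at h1
    rw [Finset.sum_const, Finset.card_univ, Fintype.card_perm, Fintype.card_fin,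
      smul_eq_zero] at h1
    exact h1.resolve_left (Nat.factorial_ne_zero q)
  have hfin := eq_zero_of_constantCoeff_dunklHom hκ
    (fun N => (hhom N).sub (isHomogeneous_symKernelPoly hκ y N)) hz N
  exact sub_eq_zero.mp hfin

end SymmetricEigen

end OlshanskiPair

end

noncomputable section

namespace OlshanskiPair

/-! ### Means over compact groups -/

section HaarMean

open MeasureTheory

variable {H : Type} [Group H] [TopologicalSpace H] [IsTopologicalGroup H] [CompactSpace H]

/-- The mean of a real function over a compact group. -/
def haarMean (f : H → ℝ) : ℝ :=
  letI : MeasurableSpace H := borel H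
  haveI : BorelSpace H := ⟨rfl⟩
  ∫ k, f k ∂(Measure.haarMeasure (⊤ : TopologicalSpace.PositiveCompacts H))

theorem haarIntegral_ofReal (f : H → ℝ) : haarIntegral (fun k => (f k : ℂ)) = haarMean f := by
  let _ : MeasurableSpace H := borel H
  have _ : BorelSpace H := ⟨rfl⟩
  exact integral_ofReal

instance isProbabilityMeasure_haarMeasure_top [MeasurableSpace H] [BorelSpace H] :
    IsProbabilityMeasure (Measure.haarMeasure (⊤ : TopologicalSpace.PositiveCompacts H)) :=
  ⟨Measure.haarMeasure_self⟩

theorem continuous_integrable_haar [MeasurableSpace H] [BorelSpace H] {f : H → ℝ}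
    (hf : Continuous f) :
    Integrable f (Measure.haarMeasure (⊤ : TopologicalSpace.PositiveCompacts H)) :=
  hf.integrable_of_hasCompactSupport (HasCompactSupport.of_compactSpace f)

theorem haarMean_const (c : ℝ) : haarMean (fun _ : H => c) = c := by
  let _ : MeasurableSpace H := borel H
  have _ : BorelSpace H := ⟨rfl⟩
  simp [haarMean]

theorem haarMean_add {f g : H → ℝ} (hf : Continuous f) (hg : Continuous g) :
    haarMean (fun u => f u + g u) = haarMean f + haarMean g := by
  let _ : MeasurableSpace H := borel H
  have _ : BorelSpace H := ⟨rfl⟩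
  exact integral_add (continuous_integrable_haar hf) (continuous_integrable_haar hg)

theorem haarMean_sub {f g : H → ℝ} (hf : Continuous f) (hg : Continuous g) :
    haarMean (fun u => f u - g u) = haarMean f - haarMean g := by
  let _ : MeasurableSpace H := borel H
  have _ : BorelSpace H := ⟨rfl⟩
  exact integral_sub (continuous_integrable_haar hf) (continuous_integrable_haar hg)

theorem haarMean_const_mul (c : ℝ) (f : H → ℝ) :
    haarMean (fun u => c * f u) = c * haarMean f := by
  let _ : MeasurableSpace H := borel H
  have _ : BorelSpace H := ⟨rfl⟩
  exact integral_const_mul c f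

theorem haarMean_sum {ι : Type*} (s : Finset ι) {f : ι → H → ℝ} (hf : ∀ i, Continuous (f i)) :
    haarMean (fun u => ∑ i ∈ s, f i u) = ∑ i ∈ s, haarMean (f i) := by
  let _ : MeasurableSpace H := borel H
  have _ : BorelSpace H := ⟨rfl⟩
  exact integral_finsetSum s fun i _ => continuous_integrable_haar (hf i)

theorem haarMean_mono {f g : H → ℝ} (hf : Continuous f) (hg : Continuous g) (h : ∀ u, f u ≤ g u) :
    haarMean f ≤ haarMean g := by
  let _ : MeasurableSpace H := borel H
  have _ : BorelSpace H := ⟨rfl⟩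
  exact integral_mono (continuous_integrable_haar hf) (continuous_integrable_haar hg) h

theorem haarMean_nonneg {f : H → ℝ} (h : ∀ u, 0 ≤ f u) : 0 ≤ haarMean f := by
  let _ : MeasurableSpace H := borel H
  have _ : BorelSpace H := ⟨rfl⟩
  exact integral_nonneg h

theorem abs_haarMean_sub_le {f g b : H → ℝ} (hf : Continuous f) (hg : Continuous g)
    (hb : Continuous b) (h : ∀ u, |f u - g u| ≤ b u) : |haarMean f - haarMean g| ≤ haarMean b := by
  rw [← haarMean_sub hf hg, abs_le, neg_le_iff_add_nonneg,
    ← haarMean_add (f := fun u => f u - g u) (hf.sub hg) hb]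
  refine ⟨haarMean_nonneg fun u => ?_, haarMean_mono (hf.sub hg) hb fun u => (abs_le.mp (h u)).2⟩
  linarith [(abs_le.mp (h u)).1]

theorem haarMean_mul_left (h : H) (f : H → ℝ) : haarMean (fun u => f (h * u)) = haarMean f := by
  let _ : MeasurableSpace H := borel H
  have _ : BorelSpace H := ⟨rfl⟩
  exact integral_mul_left_eq_self f h

theorem haarMean_swap {H' : Type} [Group H'] [TopologicalSpace H'] [IsTopologicalGroup H']
    [CompactSpace H'] {f : H → H' → ℝ} (hf : Continuous f.uncurry) :
    haarMean (fun a => haarMean fun b => f a b) = haarMean fun b => haarMean fun a => f a b := by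
  let _ : MeasurableSpace H := borel H
  have _ : BorelSpace H := ⟨rfl⟩
  let _ : MeasurableSpace H' := borel H'
  have _ : BorelSpace H' := ⟨rfl⟩
  exact integral_integral_swap_of_hasCompactSupport hf (HasCompactSupport.of_compactSpace _)

theorem continuous_haarMean {Y : Type*} [TopologicalSpace Y] {f : Y → H → ℝ}
    (hf : Continuous f.uncurry) : Continuous fun y => haarMean (f y) := by
  let _ : MeasurableSpace H := borel H
  have _ : BorelSpace H := ⟨rfl⟩
  rw [← continuousOn_univ]
  exact continuousOn_integral_of_compact_support (k := Set.univ) isCompact_univ hf.continuousOn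
    fun _ x _ hx => absurd (Set.mem_univ x) hx

/-- Unimodularity from left invariance alone: the double mean of `f(v⁻¹ u)` is evaluated in both
orders. -/
theorem haarMean_inv {f : H → ℝ} (hf : Continuous f) :
    haarMean (fun u => f u⁻¹) = haarMean f := by
  have h1 : haarMean (fun v : H => haarMean fun u => f (v⁻¹ * u)) = haarMean f := by
    simp only [haarMean_mul_left, haarMean_const]
  rw [← h1, haarMean_swap (by fun_prop)]
  have h2 : ∀ u : H, haarMean (fun v => f (v⁻¹ * u)) = haarMean fun v => f v⁻¹ := by
    intro u
    have := haarMean_mul_left u⁻¹ fun v => f v⁻¹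
    rw [← this]
    congr 1
    funext v
    rw [mul_inv_rev, inv_inv]
  simp only [h2, haarMean_const]

theorem haarMean_mul_right (h : H) {f : H → ℝ} (hf : Continuous f) :
    haarMean (fun u => f (u * h)) = haarMean f := by
  rw [← haarMean_inv (f := fun u => f (u * h)) (by fun_prop),
    ← haarMean_mul_left h (fun u => f (u⁻¹ * h))]
  simp only [mul_inv_rev, inv_mul_cancel_right]
  exact haarMean_inv hf

/-- The projection of Haar measure is Haar measure: averaging over left translates in `H'` and
exchanging the means leaves only the mean of `f`. -/
theorem haarMean_comp_snd {H' : Type} [Group H'] [TopologicalSpace H'] [IsTopologicalGroup H']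
    [CompactSpace H'] {f : H' → ℝ} (hf : Continuous f) :
    haarMean (fun k : H × H' => f k.2) = haarMean f := by
  have h1 : ∀ h : H', haarMean (fun k : H × H' => f (h * k.2)) =
      haarMean (fun k : H × H' => f k.2) := fun h =>
    haarMean_mul_left ((1, h) : H × H') fun k => f k.2
  have h2 : haarMean (fun h : H' => haarMean fun k : H × H' => f (h * k.2)) =
      haarMean (fun k : H × H' => f k.2) := by
    simp only [h1, haarMean_const]
  rw [← h2, haarMean_swap (by fun_prop)]
  simp only [haarMean_mul_right _ hf, haarMean_const]

/-- The mean of the derivative of a function along a one-parameter group vanishes. -/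
theorem haarMean_deriv_eq_zero {r : ℝ → H} (hr0 : r 0 = 1) (hr : ∀ s t, r (s + t) = r s * r t)
    {g g' : H → ℝ} (hg : Continuous g) (hg' : Continuous g')
    (h : ∀ u, HasDerivAt (fun t => g (r t * u)) (g' u) 0) : haarMean g' = 0 := by
  let _ : MeasurableSpace H := borel H
  have _ : BorelSpace H := ⟨rfl⟩
  obtain ⟨C, hC⟩ := isCompact_univ.exists_bound_of_continuousOn hg'.continuousOn
  -- The group law carries the derivative at `0` to every `t`; differentiation under the mean then
  -- meets the constant `t ↦ ∫ g(r(t) u) du`.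
  have hd : ∀ u t, HasDerivAt (fun t => g (r t * u)) (g' (r t * u)) t := by
    intro u t
    have h1 := h (r t * u)
    rw [← sub_self t] at h1
    have h2 := h1.comp_sub_const t t
    refine h2.congr_of_eventuallyEq (Filter.Eventually.of_forall fun s => ?_)
    simp only [← mul_assoc, ← hr, sub_add_cancel]
  have key := hasDerivAt_integral_of_dominated_loc_of_deriv_le
    (μ := Measure.haarMeasure (⊤ : TopologicalSpace.PositiveCompacts H))
    (F := fun t u => g (r t * u)) (F' := fun t u => g' (r t * u)) (x₀ := (0 : ℝ))
    (bound := fun _ => C) Filter.univ_mem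
    (Filter.Eventually.of_forall fun t => (continuous_integrable_haar (by fun_prop)).1)
    (continuous_integrable_haar (by fun_prop)) (continuous_integrable_haar (by fun_prop)).1
    (Filter.Eventually.of_forall fun u t _ => hC _ (Set.mem_univ _)) (integrable_const C)
    (Filter.Eventually.of_forall fun u t _ => hd u t)
  have h2 := key.2
  have h3 : (fun t => ∫ u, g (r t * u) ∂(Measure.haarMeasure
      (⊤ : TopologicalSpace.PositiveCompacts H))) = fun _ => haarMean g :=
    funext fun t => haarMean_mul_left (r t) g
  rw [h3] at h2
  have h4 := h2.unique (hasDerivAt_const (0 : ℝ) (haarMean g))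
  simp only [hr0, one_mul] at h4
  exact h4

theorem hasSum_haarMean_exp {f : H → ℝ} (hf : Continuous f) :
    HasSum (fun n : ℕ => (n.factorial : ℝ)⁻¹ * haarMean fun u => f u ^ n)
      (haarMean fun u => Real.exp (f u)) := by
  let _ : MeasurableSpace H := borel H
  have _ : BorelSpace H := ⟨rfl⟩
  obtain ⟨C, hC⟩ := isCompact_univ.exists_bound_of_continuousOn hf.continuousOn
  simp only [← haarMean_const_mul]
  refine hasSum_integral_of_dominated_convergence (fun n _ => C ^ n / n.factorial)
    (fun n => (continuous_integrable_haar (by fun_prop)).1) (fun n => ?_)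
    (Filter.Eventually.of_forall fun _ => Real.summable_pow_div_factorial C)
    (integrable_const _) (Filter.Eventually.of_forall fun u => ?_)
  · refine Filter.Eventually.of_forall fun u => ?_
    rw [norm_mul, norm_inv, norm_pow, RCLike.norm_natCast, mul_comm, div_eq_mul_inv]
    gcongr
    exact hC u (Set.mem_univ u)
  · have := NormedSpace.expSeries_div_hasSum_exp (f u)
    rw [← Real.exp_eq_exp_ℝ] at this
    simpa [div_eq_mul_inv, mul_comm] using this

end HaarMean

end OlshanskiPair

end

noncomputable section

namespace OlshanskiPair

/-! ### Real parts and rotations -/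

section RealPart

/-- The real part on `F` together with an orthonormal basis of unit elements. -/
class RealPart (F : Type) [NormedDivisionRing F] [StarRing F] [NormedAlgebra ℝ F] where
  /-- the real part -/
  re : F →L[ℝ] ℝ
  re_mul_comm : ∀ x y, re (x * y) = re (y * x)
  re_star : ∀ x, re (star x) = re x
  re_algebraMap : ∀ r, re (algebraMap ℝ F r) = r
  /-- the dimension of `F` -/
  dim : ℕ
  dim_eq : dim = Module.finrank ℝ F
  /-- an orthonormal basis -/
  frame : Fin dim → F
  frame_mul_star : ∀ a, frame a * star (frame a) = 1
  star_mul_frame : ∀ a, star (frame a) * frame a = 1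
  sum_frame : ∀ x y, ∑ a, re (x * star (frame a)) * re (y * star (frame a)) = re (x * star y)

/-- The one-parameter group `exp(t A)` for `A ^ 3 = - A`. -/
def rotation {𝔸 : Type*} [Ring 𝔸] [Algebra ℝ 𝔸] (A : 𝔸) (t : ℝ) : 𝔸 :=
  1 + Real.sin t • A + (1 - Real.cos t) • (A * A)

section Rotation

variable {𝔸 : Type*} [Ring 𝔸] [Algebra ℝ 𝔸] {A : 𝔸}

theorem rotation_zero : rotation A 0 = 1 := by simp [rotation]

theorem rotation_add (hA : A * A * A = -A) (s t : ℝ) :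
    rotation A (s + t) = rotation A s * rotation A t := by
  have h1 : A * (A * A) = -A := by rw [← mul_assoc, hA]
  have h2 : A * A * (A * A) = -(A * A) := by rw [← mul_assoc, hA, neg_mul]
  simp only [rotation, mul_add, add_mul, one_mul, mul_one, hA, h1, h2,
    smul_mul_assoc, mul_smul_comm, Real.sin_add, Real.cos_add]
  module

/-- The terms are ordered so that every coefficient after the commutator vanishes to at least second
order at `t = 0`; only the commutator survives in the derivative. -/
theorem rotation_conj_eq (B : 𝔸) (t : ℝ) : rotation A t * B * rotation A (-t) =
    B + Real.sin t • (A * B - B * A) + (1 - Real.cos t) • (A * A * B + B * (A * A)) +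
      (Real.sin t * (1 - Real.cos t)) • (A * B * (A * A) - A * A * B * A) -
      (Real.sin t * Real.sin t) • (A * B * A) +
      ((1 - Real.cos t) * (1 - Real.cos t)) • (A * A * B * (A * A)) := by
  simp only [rotation, mul_add, add_mul, one_mul, mul_one,
    smul_mul_assoc, mul_smul_comm, Real.sin_neg, Real.cos_neg, mul_assoc]
  module

variable [StarRing 𝔸] [StarModule ℝ 𝔸]

theorem star_rotation (hs : star A = -A) (t : ℝ) : star (rotation A t) = rotation A (-t) := by
  simp [rotation, hs]

theorem rotation_mem_unitary (hA : A * A * A = -A) (hs : star A = -A) (t : ℝ) :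
    rotation A t ∈ unitary 𝔸 := by
  rw [Unitary.mem_iff, star_rotation hs, ← rotation_add hA, ← rotation_add hA]
  simp [rotation_zero]

end Rotation

theorem hasDerivAt_rotation_conj {n : ℕ} {F : Type} [NormedDivisionRing F] [NormedAlgebra ℝ F]
    (A B : Matrix (Fin n) (Fin n) F) (i j : Fin n) :
    HasDerivAt (fun t => (rotation A t * B * rotation A (-t)) i j) ((A * B - B * A) i j) 0 := by
  have hs : HasDerivAt (fun t : ℝ => Real.sin t) 1 0 := by
    simpa using Real.hasDerivAt_sin 0
  have hc : HasDerivAt (fun t : ℝ => 1 - Real.cos t) 0 0 := by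
    simpa using (Real.hasDerivAt_cos 0).const_sub 1
  have key := (((((hasDerivAt_const (0 : ℝ) (B i j)).fun_add
    (hs.smul_const ((A * B) i j - (B * A) i j))).fun_add
    (hc.smul_const ((A * A * B + B * (A * A)) i j))).fun_add
    ((hs.fun_mul hc).smul_const ((A * B * (A * A)) i j - (A * A * B * A) i j))).fun_sub
    ((hs.fun_mul hs).smul_const ((A * B * A) i j))).fun_add
    ((hc.fun_mul hc).smul_const ((A * A * B * (A * A)) i j))
  simp only [zero_smul, one_smul, zero_add, add_zero, mul_zero, zero_mul, sub_zero,
    Real.sin_zero, Real.cos_zero, sub_self] at key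
  refine key.congr_of_eventuallyEq (Filter.Eventually.of_forall fun t => ?_)
  exact congrFun (congrFun (rotation_conj_eq B t) i) j

end RealPart

end OlshanskiPair

end

noncomputable section

namespace OlshanskiPair

/-! ### The matrices `u diag(y ^ n) u*` -/

section Gram

set_option linter.unusedSectionVars false

variable {F : Type} [NormedDivisionRing F] [StarRing F] {q : ℕ}

/-- The infinitesimal rotation `a e_{ij} - a* e_{ji}`. -/
def skewUnit (i j : Fin q) (a : F) : Matrix (Fin q) (Fin q) F :=
  Matrix.single i j a - Matrix.single j i (star a)

theorem star_skewUnit (i j : Fin q) (a : F) : star (skewUnit i j a) = - skewUnit i j a := by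
  simp [skewUnit, Matrix.star_eq_conjTranspose, Matrix.conjTranspose_single]

/-- The square is minus the projection to the coordinates `i` and `j`, because `a` is a unit with
inverse `a*`. -/
theorem skewUnit_cube {i j : Fin q} (hij : i ≠ j) {a : F} (h1 : a * star a = 1)
    (h2 : star a * a = 1) :
    skewUnit i j a * skewUnit i j a * skewUnit i j a = - skewUnit i j a := by
  simp only [skewUnit, sub_mul, mul_sub]
  simp [hij, Ne.symm hij, h1, h2, neg_add_eq_sub]

theorem skewUnit_mul_apply_left {i j : Fin q} (hij : i ≠ j) (a : F)
    (B : Matrix (Fin q) (Fin q) F) (k : Fin q) : (skewUnit i j a * B) i k = a * B j k := by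
  simp [skewUnit, sub_mul, hij]

theorem skewUnit_mul_apply_right {i j : Fin q} (hij : i ≠ j) (a : F)
    (B : Matrix (Fin q) (Fin q) F) (k : Fin q) :
    (skewUnit i j a * B) j k = - (star a * B i k) := by
  simp [skewUnit, sub_mul, Ne.symm hij]

theorem skewUnit_mul_apply_of_ne {i j m : Fin q} (hi : m ≠ i) (hj : m ≠ j) (a : F)
    (B : Matrix (Fin q) (Fin q) F) (k : Fin q) : (skewUnit i j a * B) m k = 0 := by
  simp [skewUnit, sub_mul, hi, hj]

theorem mul_skewUnit_apply_right {i j : Fin q} (hij : i ≠ j) (a : F)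
    (B : Matrix (Fin q) (Fin q) F) (k : Fin q) : (B * skewUnit i j a) k j = B k i * a := by
  simp [skewUnit, mul_sub, Ne.symm hij]

theorem mul_skewUnit_apply_left {i j : Fin q} (hij : i ≠ j) (a : F)
    (B : Matrix (Fin q) (Fin q) F) (k : Fin q) :
    (B * skewUnit i j a) k i = - (B k j * star a) := by
  simp [skewUnit, mul_sub, hij]

theorem mul_skewUnit_apply_of_ne {i j m : Fin q} (hi : m ≠ i) (hj : m ≠ j) (a : F)
    (B : Matrix (Fin q) (Fin q) F) (k : Fin q) : (B * skewUnit i j a) k m = 0 := by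
  simp [skewUnit, mul_sub, hi, hj]

variable [NormedAlgebra ℝ F] (y : Fin q → ℝ)

/-- The matrix `u diag(y ^ n) u*`. -/
def gramMat (n : ℕ) (u : U F q) : Matrix (Fin q) (Fin q) F :=
  u.1 * Matrix.diagonal (fun l => algebraMap ℝ F (y l ^ n)) * star u.1

/-- The diagonal entries of `u diag(y ^ n) u*`. -/
def gramDiag (n : ℕ) (i : Fin q) (u : U F q) : ℝ := ∑ l, y l ^ n * ‖u.1 i l‖ ^ 2

theorem gramMat_apply (n : ℕ) (u : U F q) (i j : Fin q) :
    gramMat y n u i j = ∑ l, y l ^ n • (u.1 i l * star (u.1 j l)) := by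
  rw [gramMat, Matrix.mul_apply]
  refine Finset.sum_congr rfl fun l _ => ?_
  rw [Matrix.mul_diagonal, Matrix.star_apply, ← Algebra.commutes, mul_assoc, Algebra.smul_def]

theorem gramMat_mul (n m : ℕ) (u : U F q) : gramMat y n u * gramMat y m u = gramMat y (n + m) u := by
  have h : star u.1 * u.1 = 1 := (Unitary.mem_iff.mp u.2).1
  have : gramMat y n u * gramMat y m u = u.1 * Matrix.diagonal (fun l => algebraMap ℝ F (y l ^ n)) *
      (star u.1 * u.1) * Matrix.diagonal (fun l => algebraMap ℝ F (y l ^ m)) * star u.1 := by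
    simp only [gramMat, mul_assoc]
  rw [this, h, mul_one, mul_assoc u.1, Matrix.diagonal_mul_diagonal, gramMat]
  simp only [← map_mul, pow_add]

theorem gramMat_mul_left (n : ℕ) (v u : U F q) :
    gramMat y n (v * u) = v.1 * gramMat y n u * star v.1 := by
  simp only [gramMat, Submonoid.coe_mul, star_mul, mul_assoc]

section

variable [StarModule ℝ F]

theorem star_gramMat_apply (n : ℕ) (u : U F q) (i j : Fin q) :
    star (gramMat y n u i j) = gramMat y n u j i := by
  simp [gramMat_apply]

end

section

variable [CStarRing F] [NormStar F]

theorem mul_star_self_eq (x : F) : x * star x = algebraMap ℝ F (‖x‖ ^ 2) := by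
  have := NormStar.star_mul_self_eq (star x)
  rwa [star_star, norm_star] at this

theorem gramMat_self (n : ℕ) (u : U F q) (i : Fin q) :
    gramMat y n u i i = algebraMap ℝ F (gramDiag y n i u) := by
  simp [gramMat_apply, gramDiag, mul_star_self_eq, Algebra.smul_def]

end

variable [NormStar F]

theorem sum_norm_sq_col (u : U F q) (l : Fin q) : ∑ i, ‖u.1 i l‖ ^ 2 = 1 := by
  have h := congrFun (congrFun (Unitary.mem_iff.mp u.2).1 l) l
  simp only [Matrix.mul_apply, Matrix.star_apply, NormStar.star_mul_self_eq,
    Matrix.one_apply_eq] at h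
  rw [← map_sum, ← map_one (algebraMap ℝ F)] at h
  exact (algebraMap ℝ F).injective h

theorem sum_norm_sq_row [CStarRing F] (u : U F q) (l : Fin q) : ∑ i, ‖u.1 l i‖ ^ 2 = 1 := by
  have h := congrFun (congrFun (Unitary.mem_iff.mp u.2).2 l) l
  simp only [Matrix.mul_apply, Matrix.star_apply, mul_star_self_eq,
    Matrix.one_apply_eq] at h
  rw [← map_sum, ← map_one (algebraMap ℝ F)] at h
  exact (algebraMap ℝ F).injective h

theorem gramDiag_zero [CStarRing F] (i : Fin q) (u : U F q) : gramDiag y 0 i u = 1 := by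
  simp [gramDiag, sum_norm_sq_row]

theorem sum_gramDiag (n : ℕ) (u : U F q) : ∑ i, gramDiag y n i u = ∑ l, y l ^ n := by
  simp only [gramDiag]
  rw [Finset.sum_comm]
  simp [← Finset.mul_sum, sum_norm_sq_col]

theorem continuous_entry (i j : Fin q) : Continuous fun u : U F q => u.1 i j :=
  continuous_subtype_val.matrix_elem i j

theorem continuous_gramDiag (n : ℕ) (i : Fin q) : Continuous (gramDiag (F := F) y n i) :=
  continuous_finsetSum _ fun l _ => continuous_const.mul ((continuous_entry i l).norm.pow 2)

theorem continuous_gramMat [CStarRing F] (n : ℕ) (i j : Fin q) :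
    Continuous fun u : U F q => gramMat y n u i j := by
  simp only [gramMat_apply]
  exact continuous_finsetSum _ fun l _ =>
    ((continuous_entry i l).mul (continuous_entry j l).star).const_smul _

variable [CStarRing F] [StarModule ℝ F] [RealPart F]

/-- The pairing of the entries of `u diag(y ^ n) u*` and `u diag(y) u*`. -/
def gramPair (n : ℕ) (i j : Fin q) (u : U F q) : ℝ :=
  RealPart.re (gramMat y n u i j * star (gramMat y 1 u i j))

theorem gramPair_self (n : ℕ) (i : Fin q) (u : U F q) :
    gramPair y n i i u = gramDiag y n i u * gramDiag y 1 i u := by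
  rw [gramPair, star_gramMat_apply, gramMat_self, gramMat_self, ← map_mul, RealPart.re_algebraMap]

/-- With `Q = u diag(y) u*` this is the diagonal entry `(Q^n Q)_{ii}`. It is the step that raises
the exponent from `n` to `n + 1`. -/
theorem sum_gramPair (n : ℕ) (i : Fin q) (u : U F q) :
    ∑ j, gramPair y n i j u = gramDiag y (n + 1) i u := by
  simp only [gramPair, star_gramMat_apply]
  rw [← map_sum, ← Matrix.mul_apply, gramMat_mul, gramMat_self, RealPart.re_algebraMap]

theorem continuous_gramPair (n : ℕ) (i j : Fin q) : Continuous (gramPair (F := F) y n i j) :=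
  (RealPart.re (F := F)).continuous.comp
    ((continuous_gramMat y n i j).mul (continuous_gramMat y 1 i j).star)

/-- The linear form `∑ x_m (u diag(y) u*)_{mm}`. -/
def gramForm (x : Fin q → ℝ) (u : U F q) : ℝ := ∑ m, x m * gramDiag y 1 m u

theorem continuous_gramForm (x : Fin q → ℝ) : Continuous (gramForm (F := F) y x) :=
  continuous_finsetSum _ fun m _ => continuous_const.mul (continuous_gramDiag y 1 m)

section Rotate

variable {i j : Fin q} (hij : i ≠ j) {a : F} (h1 : a * star a = 1) (h2 : star a * a = 1)

/-- Rotations in the coordinate plane of `i` and `j`. -/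
def planeRotation (t : ℝ) : U F q :=
  ⟨rotation (skewUnit i j a) t,
    rotation_mem_unitary (skewUnit_cube hij h1 h2) (star_skewUnit i j a) t⟩

theorem planeRotation_zero : planeRotation hij h1 h2 0 = 1 := Subtype.ext rotation_zero

theorem planeRotation_add (s t : ℝ) : planeRotation hij h1 h2 (s + t) =
    planeRotation hij h1 h2 s * planeRotation hij h1 h2 t :=
  Subtype.ext (rotation_add (skewUnit_cube hij h1 h2) s t)

theorem hasDerivAt_gramMat_planeRotation (n : ℕ) (u : U F q) (k m : Fin q) :
    HasDerivAt (fun t => gramMat y n (planeRotation hij h1 h2 t * u) k m)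
      ((skewUnit i j a * gramMat y n u - gramMat y n u * skewUnit i j a) k m) 0 := by
  have := hasDerivAt_rotation_conj (skewUnit i j a) (gramMat y n u) k m
  refine this.congr_of_eventuallyEq (Filter.Eventually.of_forall fun t => ?_)
  simp only [gramMat_mul_left, planeRotation, star_rotation (star_skewUnit i j a)]

/-- The derivative is the real trace of `diag(x) [A, Q]`. Only the diagonal entries `i` and `j` of
the commutator are nonzero, with opposite real parts, whence the factor `x_i - x_j`. -/
theorem hasDerivAt_gramForm_planeRotation (x : Fin q → ℝ) (u : U F q) :
    HasDerivAt (fun t => gramForm y x (planeRotation hij h1 h2 t * u))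
      (2 * (x i - x j) * RealPart.re (gramMat y 1 u i j * star a)) 0 := by
  have hD : ∀ m v, gramDiag y 1 m v = RealPart.re (gramMat (F := F) y 1 v m m) := fun m v => by
    rw [gramMat_self, RealPart.re_algebraMap]
  have hm : ∀ m, HasDerivAt (fun t => x m * gramDiag y 1 m (planeRotation hij h1 h2 t * u))
      (x m * RealPart.re ((skewUnit i j a * gramMat y 1 u - gramMat y 1 u * skewUnit i j a) m m))
      0 := by
    intro m
    simp only [hD]
    exact ((RealPart.re (F := F)).hasFDerivAt.comp_hasDerivAt (0 : ℝ)
      (hasDerivAt_gramMat_planeRotation y hij h1 h2 1 u m m)).const_mul (x m)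
  refine (HasDerivAt.fun_sum fun m _ => hm m).congr_deriv ?_
  set Q := gramMat y 1 u
  have e1 : RealPart.re (a * Q j i) = RealPart.re (Q i j * star a) := by
    rw [← RealPart.re_star, star_mul, star_gramMat_apply]
  have ei : RealPart.re ((skewUnit i j a * Q - Q * skewUnit i j a) i i) =
      2 * RealPart.re (Q i j * star a) := by
    rw [Matrix.sub_apply, skewUnit_mul_apply_left hij, mul_skewUnit_apply_left hij, sub_neg_eq_add,
      map_add, e1]
    ring
  have ej : RealPart.re ((skewUnit i j a * Q - Q * skewUnit i j a) j j) =
      -(2 * RealPart.re (Q i j * star a)) := by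
    rw [Matrix.sub_apply, skewUnit_mul_apply_right hij, mul_skewUnit_apply_right hij,
      map_sub, map_neg, RealPart.re_mul_comm (star a), RealPart.re_mul_comm (Q j i), e1]
    ring
  have e0 : ∀ m, m ≠ i → m ≠ j →
      RealPart.re ((skewUnit i j a * Q - Q * skewUnit i j a) m m) = 0 := by
    intro m hi hj
    rw [Matrix.sub_apply, skewUnit_mul_apply_of_ne hi hj, mul_skewUnit_apply_of_ne hi hj, sub_zero,
      map_zero]
  rw [Finset.sum_eq_add i j hij]
  · rw [ei, ej]; ring
  · intro m _ hm
    rw [e0 m hm.1 hm.2, mul_zero]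
  · simp
  · simp

theorem hasDerivAt_re_gramMat_planeRotation (n : ℕ) (u : U F q) :
    HasDerivAt (fun t => RealPart.re (gramMat y n (planeRotation hij h1 h2 t * u) i j * star a))
      (gramDiag y n j u - gramDiag y n i u) 0 := by
  have h := (RealPart.re (F := F)).hasFDerivAt.comp_hasDerivAt (0 : ℝ)
      ((hasDerivAt_gramMat_planeRotation y hij h1 h2 n u i j).mul_const (star a))
  refine h.congr_deriv ?_
  rw [Matrix.sub_apply, skewUnit_mul_apply_left hij, mul_skewUnit_apply_right hij, gramMat_self,
    gramMat_self, sub_mul, map_sub, ← Algebra.commutes, mul_assoc, mul_assoc, h1, mul_one, mul_one,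
    RealPart.re_algebraMap, RealPart.re_algebraMap]

end Rotate

variable [FiniteDimensional ℝ F]

/-- Integration by parts for `re((Q^n)_{ij} a*) · gramForm^(N+1)` along the plane rotation with
parameter `a`. Summing over an orthonormal basis of such `a` yields the factor `dim F` on the left
and the full pairing of `(Q^n)_{ij}` and `Q_{ij}` on the right. -/
theorem haarMean_gramDiag_sub {i j : Fin q} (hij : i ≠ j) (n N : ℕ) (x : Fin q → ℝ) :
    (RealPart.dim F : ℝ) * haarMean (fun u : U F q =>
      (gramDiag y n i u - gramDiag y n j u) * gramForm y x u ^ (N + 1)) =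
    2 * (N + 1) * (x i - x j) *
      haarMean fun u : U F q => gramPair y n i j u * gramForm y x u ^ N := by
  have key : ∀ a : F, a * star a = 1 → star a * a = 1 →
      haarMean (fun u : U F q =>
        (gramDiag y n i u - gramDiag y n j u) * gramForm y x u ^ (N + 1)) =
      2 * (N + 1) * (x i - x j) * haarMean fun u : U F q =>
        RealPart.re (gramMat y n u i j * star a) * RealPart.re (gramMat y 1 u i j * star a) *
          gramForm y x u ^ N := by
    intro a h1 h2
    have c1 : ∀ n, Continuous fun u : U F q => RealPart.re (gramMat y n u i j * star a) := fun n =>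
      (RealPart.re (F := F)).continuous.comp ((continuous_gramMat y n i j).mul continuous_const)
    have c2 := continuous_gramForm (F := F) y x
    have c3 := continuous_gramDiag (F := F) y n
    have cP : Continuous fun u : U F q => 2 * (N + 1) * (x i - x j) *
        (RealPart.re (gramMat y n u i j * star a) * RealPart.re (gramMat y 1 u i j * star a) *
          gramForm y x u ^ N) := continuous_const.mul (((c1 n).mul (c1 1)).mul (c2.pow _))
    have cQ : Continuous fun u : U F q =>
        (gramDiag y n i u - gramDiag y n j u) * gramForm y x u ^ (N + 1) :=
      ((c3 i).sub (c3 j)).mul (c2.pow _)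
    have hz := haarMean_deriv_eq_zero (planeRotation_zero hij h1 h2) (planeRotation_add hij h1 h2)
      (g := fun u => RealPart.re (gramMat y n u i j * star a) * gramForm y x u ^ (N + 1))
      (g' := fun u => 2 * (N + 1) * (x i - x j) *
        (RealPart.re (gramMat y n u i j * star a) * RealPart.re (gramMat y 1 u i j * star a) *
          gramForm y x u ^ N) -
        (gramDiag y n i u - gramDiag y n j u) * gramForm y x u ^ (N + 1))
      ((c1 n).mul (c2.pow _))
      (cP.sub cQ) (fun u => by
          have hd := (hasDerivAt_re_gramMat_planeRotation y hij h1 h2 n u).fun_mul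
            ((hasDerivAt_gramForm_planeRotation y hij h1 h2 x u).fun_pow (N + 1))
          refine hd.congr_deriv ?_
          rw [planeRotation_zero, one_mul]
          push_cast
          ring)
    rw [haarMean_sub cP cQ, haarMean_const_mul] at hz
    linarith
  have hsum := Finset.sum_congr rfl fun a (_ : a ∈ (Finset.univ : Finset (Fin (RealPart.dim F)))) =>
    key (RealPart.frame a) (RealPart.frame_mul_star a) (RealPart.star_mul_frame a)
  rw [Finset.sum_const, Finset.card_univ, Fintype.card_fin, nsmul_eq_mul] at hsum
  rw [hsum, ← Finset.mul_sum, ← haarMean_sum]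
  · congr 2
    funext u
    rw [← Finset.sum_mul, RealPart.sum_frame, gramPair]
  · intro a
    have c1 : ∀ n, Continuous fun u : U F q =>
        RealPart.re (gramMat y n u i j * star (RealPart.frame a)) := fun n =>
      (RealPart.re (F := F)).continuous.comp ((continuous_gramMat y n i j).mul continuous_const)
    exact ((c1 n).mul (c1 1)).mul ((continuous_gramForm y x).pow _)

end Gram

end OlshanskiPair

end

noncomputable section

namespace OlshanskiPair

open MvPolynomial

/-! ### The Dunkl-Bessel function as a matrix integral -/

/-! ### Moment polynomials of functions on a compact group -/

section MomentPolynomials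

variable {H : Type} [Group H] [TopologicalSpace H] [IsTopologicalGroup H] [CompactSpace H]
  {q : ℕ}

/-- The polynomial `x ↦ ∫ a (∑ x_l c_l) ^ N` for functions `a`, `c_l` on a compact group. -/
def momentPoly (c : Fin q → H → ℝ) : ℕ → (H → ℝ) → MvPolynomial (Fin q) ℝ
  | 0, a => C (haarMean a)
  | N + 1, a => ∑ l, X l * momentPoly c N fun u => a u * c l u

theorem momentPoly_succ (c : Fin q → H → ℝ) (N : ℕ) (a : H → ℝ) :
    momentPoly c (N + 1) a = ∑ l, X l * momentPoly c N fun u => a u * c l u := rfl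

theorem eval_momentPoly {c : Fin q → H → ℝ} (hc : ∀ l, Continuous (c l)) (N : ℕ) {a : H → ℝ}
    (ha : Continuous a) (x : Fin q → ℝ) :
    eval x (momentPoly c N a) = haarMean fun u => a u * (∑ l, x l * c l u) ^ N := by
  induction N generalizing a with
  | zero => simp [momentPoly]
  | succ N ih =>
    rw [momentPoly_succ, map_sum]
    have h : ∀ l, eval x (X l * momentPoly c N fun u => a u * c l u) =
        haarMean fun u => x l * (a u * c l u * (∑ l, x l * c l u) ^ N) := by
      intro l
      have hl : Continuous fun u => a u * c l u := ha.mul (hc l)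
      rw [map_mul, eval_X, ih hl, haarMean_const_mul]
    have hs : Continuous fun u => ∑ l, x l * c l u :=
      continuous_finsetSum _ fun l _ => continuous_const.mul (hc l)
    have hF : ∀ l, Continuous fun u => x l * (a u * c l u * (∑ l, x l * c l u) ^ N) := fun l =>
      continuous_const.mul ((ha.mul (hc l)).mul (hs.pow N))
    simp only [h]
    rw [← haarMean_sum _ hF]
    congr 1
    funext u
    rw [pow_succ', Finset.sum_mul, Finset.mul_sum]
    exact Finset.sum_congr rfl fun l _ => by ring

theorem isHomogeneous_momentPoly (c : Fin q → H → ℝ) (N : ℕ) (a : H → ℝ) :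
    (momentPoly c N a).IsHomogeneous N := by
  induction N generalizing a with
  | zero => exact isHomogeneous_C _ _
  | succ N ih =>
    rw [momentPoly_succ, add_comm]
    exact IsHomogeneous.sum _ _ _ fun l _ => (isHomogeneous_X ℝ l).mul (ih _)

theorem pderiv_momentPoly_succ (c : Fin q → H → ℝ) (N : ℕ) (a : H → ℝ) (i : Fin q) :
    pderiv i (momentPoly c (N + 1) a) = ((N : ℝ) + 1) • momentPoly c N fun u => a u * c i u := by
  induction N generalizing a with
  | zero =>
    rw [momentPoly_succ, map_sum, Finset.sum_eq_single i]
    · simp [momentPoly]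
    · intro l _ hl
      simp [momentPoly, pderiv_X_of_ne hl]
    · simp
  | succ N ih =>
    have h : ∀ l, pderiv i (X l * momentPoly c (N + 1) fun u => a u * c l u) =
        ((N : ℝ) + 1) • (X l * momentPoly c N fun u => a u * c i u * c l u) +
          if l = i then momentPoly c (N + 1) fun u => a u * c i u else 0 := by
      intro l
      rw [Derivation.leibniz, ih, smul_eq_mul, mul_smul_comm]
      congr 1
      · congr 3
        funext u
        ring
      · by_cases hl : l = i
        · subst hl; simp
        · simp [hl, pderiv_X_of_ne hl]
    rw [momentPoly_succ, map_sum]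
    simp only [h]
    rw [Finset.sum_add_distrib, ← Finset.smul_sum, Finset.sum_ite_eq' Finset.univ i,
      if_pos (Finset.mem_univ i)]
    rw [← momentPoly_succ]
    push_cast
    module

end MomentPolynomials

/-! ### Haar moments of `u diag(y) u*` under the Dunkl operators -/

section Identification

set_option linter.unusedSectionVars false

variable {F : Type} [NormedDivisionRing F] [StarRing F] [NormedAlgebra ℝ F] [CStarRing F]
  [FiniteDimensional ℝ F] [NormStar F] [StarModule ℝ F] [RealPart F] {q : ℕ} (y : Fin q → ℝ)

/-- Permutation matrices as unitary matrices. -/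
def permUnitary {p : ℕ} (w : Equiv.Perm (Fin p)) : U F p :=
  ⟨(w.permMatrix F : Matrix (Fin p) (Fin p) F), by
    rw [Unitary.mem_iff, Matrix.star_eq_conjTranspose, Matrix.conjTranspose_permMatrix,
      ← Matrix.permMatrix_mul, ← Matrix.permMatrix_mul]
    simp⟩

theorem permUnitary_mul_apply {p : ℕ} (w : Equiv.Perm (Fin p)) (u : U F p) (i l : Fin p) :
    (permUnitary w * u).1 i l = u.1 (w i) l := by
  change ((w.permMatrix F : Matrix (Fin p) (Fin p) F) * u.1) i l = _
  rw [PEquiv.toMatrix_toPEquiv_mul]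
  rfl

theorem gramDiag_permUnitary_mul (n : ℕ) (w : Equiv.Perm (Fin q)) (i : Fin q) (u : U F q) :
    gramDiag y n i (permUnitary w * u) = gramDiag y n (w i) u := by
  simp only [gramDiag, permUnitary_mul_apply]

/-- The polynomial `x ↦ ∫ a (∑ x_m (u diag(y) u*)_{mm}) ^ N du`. -/
def gramMoment (N : ℕ) (a : U F q → ℝ) : MvPolynomial (Fin q) ℝ :=
  momentPoly (gramDiag y 1) N a

theorem eval_gramMoment (N : ℕ) {a : U F q → ℝ} (ha : Continuous a) (x : Fin q → ℝ) :
    eval x (gramMoment y N a) = haarMean fun u => a u * gramForm y x u ^ N :=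
  eval_momentPoly (continuous_gramDiag y 1) N ha x

/-- Left invariance of Haar measure under permutation matrices. -/
theorem rename_gramMoment (w : Equiv.Perm (Fin q)) (n N : ℕ) (i : Fin q) :
    rename w (gramMoment y N (gramDiag (F := F) y n i)) =
      gramMoment y N (gramDiag (F := F) y n (w i)) := by
  refine MvPolynomial.funext fun x => ?_
  rw [eval_rename, eval_gramMoment _ _ (continuous_gramDiag y n _),
    eval_gramMoment _ _ (continuous_gramDiag y n _), ← haarMean_mul_left (permUnitary w)]
  congr 1
  funext u
  rw [gramDiag_permUnitary_mul]
  congr 2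
  simp only [gramForm, gramDiag_permUnitary_mul]
  exact Equiv.sum_comp w fun m => x m * gramDiag y 1 m u

/-- The partial derivative gives the pairing at `(i, i)`, and the divided difference with index `j`
gives the pairing at `(i, j)` by `haarMean_gramDiag_sub`. All of them have weight `N + 1` exactly
because `dim F = 2κ`, and their sum over `j` is `(Q^{n+1})_{ii}`. -/
theorem dunklT_gramMoment (n N : ℕ) (i : Fin q) :
    dunklT ((Module.finrank ℝ F : ℝ) / 2) i (gramMoment y (N + 1) (gramDiag (F := F) y n i)) =
      ((N : ℝ) + 1) • gramMoment y N (gramDiag (F := F) y (n + 1) i) := by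
  set κ : ℝ := (Module.finrank ℝ F : ℝ) / 2 with hκ
  have hdim : (RealPart.dim F : ℝ) = 2 * κ := by
    rw [hκ, RealPart.dim_eq]; ring
  have hκ0 : κ ≠ 0 := by
    have : 0 < Module.finrank ℝ F := Module.finrank_pos
    positivity
  have hdiv : ∀ j ∈ Finset.univ.erase i,
      κ • divDiff i j (gramMoment y (N + 1) (gramDiag (F := F) y n i)) =
        ((N : ℝ) + 1) • gramMoment y N (gramPair (F := F) y n i j) := by
    intro j hj
    have hij : i ≠ j := (Finset.ne_of_mem_erase hj).symm
    have : divDiff i j (gramMoment y (N + 1) (gramDiag (F := F) y n i)) =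
        (κ⁻¹ * ((N : ℝ) + 1)) • gramMoment y N (gramPair (F := F) y n i j) := by
      refine divDiff_unique hij ?_
      rw [swapPoly, rename_gramMoment, Equiv.swap_apply_left]
      refine MvPolynomial.funext fun x => ?_
      have hF : ∀ m, Continuous fun u : U F q => gramDiag y n m u * gramForm y x u ^ (N + 1) :=
        fun m => (continuous_gramDiag y n m).mul ((continuous_gramForm y x).pow _)
      rw [map_mul, map_sub, map_sub, eval_X, eval_X, smul_eval,
        eval_gramMoment _ _ (continuous_gramDiag y n _),
        eval_gramMoment _ _ (continuous_gramDiag y n _),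
        eval_gramMoment _ _ (continuous_gramPair y n _ _),
        ← haarMean_sub (hF _) (hF _)]
      have h := haarMean_gramDiag_sub (F := F) y hij n N x
      simp only [sub_mul (gramDiag y n i _)] at h
      rw [hdim] at h
      refine mul_left_cancel₀ (mul_ne_zero two_ne_zero hκ0) (Eq.trans ?_ h.symm)
      field_simp
    rw [this, smul_smul, mul_inv_cancel_left₀ hκ0]
  have hself : pderiv i (gramMoment y (N + 1) (gramDiag (F := F) y n i)) =
      ((N : ℝ) + 1) • gramMoment y N (gramPair (F := F) y n i i) := by
    rw [gramMoment, pderiv_momentPoly_succ, gramMoment]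
    congr 2
    funext u
    rw [gramPair_self]
  rw [dunklT_apply, hself, Finset.smul_sum, ← Finset.add_sum_erase _ _ (Finset.mem_univ i),
    divDiff_self, smul_zero, zero_add, Finset.sum_congr rfl hdiv,
    Finset.add_sum_erase _ (fun j => ((N : ℝ) + 1) • gramMoment y N (gramPair (F := F) y n i j))
      (Finset.mem_univ i), ← Finset.smul_sum]
  congr 1
  refine MvPolynomial.funext fun x => ?_
  have hF : ∀ j, Continuous fun u : U F q => gramPair y n i j u * gramForm y x u ^ N := fun j =>
    (continuous_gramPair y n i j).mul ((continuous_gramForm y x).pow _)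
  rw [map_sum, eval_gramMoment _ _ (continuous_gramDiag y _ _)]
  simp only [eval_gramMoment y N (continuous_gramPair y n i _)]
  rw [← haarMean_sum _ hF]
  simp only [← Finset.sum_mul, sum_gramPair]

theorem gramMoment_eq_symKernelPoly
    (hκ : (0 : ℝ) ≤ (Module.finrank ℝ F : ℝ) / 2) (N : ℕ) :
    (N.factorial : ℝ)⁻¹ • gramMoment y N (fun _ : U F q => 1) = symKernelPoly hκ y N := by
  have h0 : ∀ i, gramDiag (F := F) y 0 i = fun _ => 1 := fun i => funext fun u => gramDiag_zero y i u
  refine eq_symKernelPoly hκ y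
    (m := fun n i N => (N.factorial : ℝ)⁻¹ • gramMoment y N (gramDiag (F := F) y n i))
    (Φ := fun N => (N.factorial : ℝ)⁻¹ • gramMoment y N (fun _ : U F q => 1))
    (fun i => ?_) (fun n i N => ?_) (fun n N => ?_) (fun N => ?_) (fun w N => ?_) ?_ N
  · simp only [h0]
  · rw [map_smul, dunklT_gramMoment, smul_smul, Nat.factorial_succ]
    congr 1
    push_cast
    have h1 : (N.factorial : ℝ) ≠ 0 := by positivity
    have h2 : (N : ℝ) + 1 ≠ 0 := by positivity
    field_simp
  · rw [← Finset.smul_sum, smul_comm]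
    congr 1
    refine MvPolynomial.funext fun x => ?_
    have hF : ∀ i, Continuous fun u : U F q => gramDiag y n i u * gramForm y x u ^ N := fun i =>
      (continuous_gramDiag y n i).mul ((continuous_gramForm y x).pow _)
    rw [map_sum, smul_eval, eval_gramMoment _ _ continuous_const]
    simp only [eval_gramMoment y N (continuous_gramDiag (F := F) y n _)]
    rw [← haarMean_sum _ hF, ← haarMean_const_mul]
    simp only [← Finset.sum_mul, sum_gramDiag, one_mul]
  · rw [smul_eq_C_mul]
    exact (isHomogeneous_momentPoly _ _ _).C_mul _
  · rw [map_smul]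
    -- For `q ≥ 1` the constant `1` is `(Q^0)_{ii}`, so the permutation rule for diagonal weights
    -- applies.
    rcases q.eq_zero_or_pos with rfl | hq
    · rw [Subsingleton.elim w 1, Equiv.Perm.coe_one, rename_id_apply]
    · rw [← h0 ⟨0, hq⟩, rename_gramMoment, h0, h0]
  · simp [gramMoment, momentPoly, haarMean_const]

theorem sum_dunklE_eq_haarMean (hκ : (0 : ℝ) ≤ (Module.finrank ℝ F : ℝ) / 2) (x : Fin q → ℝ) :
    (q.factorial : ℝ)⁻¹ * ∑ w : Equiv.Perm (Fin q), dunklE hκ y (x ∘ w) =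
      haarMean fun u : U F q => Real.exp (gramForm y x u) := by
  have h1 : HasSum (fun N => eval x (symKernelPoly hκ y N))
      ((q.factorial : ℝ)⁻¹ * ∑ w : Equiv.Perm (Fin q), dunklE hκ y (x ∘ w)) := by
    simp only [symKernelPoly, smul_eval, map_sum, eval_rename]
    exact (hasSum_sum (s := Finset.univ)
      (f := fun (w : Equiv.Perm (Fin q)) N => eval (x ∘ w) (kernelPoly hκ y N))
      fun w _ => hasSum_dunklE hκ y (x ∘ w)).mul_left (q.factorial : ℝ)⁻¹
  refine h1.unique ?_
  simp only [← gramMoment_eq_symKernelPoly (F := F) y hκ, smul_eval,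
    eval_gramMoment y _ (continuous_const (Y := ℝ) (y := (1 : ℝ))), one_mul]
  exact hasSum_haarMean_exp (continuous_gramForm y x)

theorem psi_eq_haarMean (b ξ : Fin q → ℝ) :
    psi F (fun i => (b i : ℂ)) ξ =
      (haarMean fun u : U F q => Real.exp (gramForm (-b) (fun i => ξ i ^ 2) u) : ℝ) := by
  have hκ : (0 : ℝ) ≤ (Module.finrank ℝ F : ℝ) / 2 := by positivity
  have hb : (-fun i => (b i : ℂ)) = fun i => (((-b) i : ℝ) : ℂ) := by
    funext i; simp
  rw [psi, dunklBesselA, hb]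
  simp only [dunklKernel_eq_dunklE hκ]
  rw [← sum_dunklE_eq_haarMean (-b) hκ]
  push_cast
  rfl

end Identification

end OlshanskiPair

end

noncomputable section

namespace OlshanskiPair

/-! ### Gaussian means over the unitary group -/

/-! ### The real trace form on matrices -/

section MatrixPairing

set_option linter.unusedSectionVars false

variable {F : Type} [NormedDivisionRing F] [StarRing F] [NormedAlgebra ℝ F] [RealPart F]

/-- The real inner product `re tr(Y* X)`. -/
def matPair {p q : ℕ} (X Y : Matrix (Fin p) (Fin q) F) : ℝ :=
  RealPart.re (Matrix.trace (Y.conjTranspose * X))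

variable {p q : ℕ}

theorem matPair_add_left (X X' Y : Matrix (Fin p) (Fin q) F) :
    matPair (X + X') Y = matPair X Y + matPair X' Y := by
  simp [matPair, Matrix.mul_add]

theorem matPair_add_right (X Y Y' : Matrix (Fin p) (Fin q) F) :
    matPair X (Y + Y') = matPair X Y + matPair X Y' := by
  simp [matPair, Matrix.add_mul]

theorem matPair_neg_right (X Y : Matrix (Fin p) (Fin q) F) : matPair X (-Y) = - matPair X Y := by
  simp [matPair]

theorem matPair_neg_left (X Y : Matrix (Fin p) (Fin q) F) : matPair (-X) Y = - matPair X Y := by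
  simp [matPair]

theorem matPair_eq_sum (X Y : Matrix (Fin p) (Fin q) F) :
    matPair X Y = ∑ i, ∑ j, RealPart.re (X i j * star (Y i j)) := by
  simp only [matPair, Matrix.trace, Matrix.diag_apply, Matrix.mul_apply,
    Matrix.conjTranspose_apply, map_sum]
  rw [Finset.sum_comm]
  simp only [RealPart.re_mul_comm]

theorem matPair_comm (X Y : Matrix (Fin p) (Fin q) F) : matPair X Y = matPair Y X := by
  simp only [matPair_eq_sum]
  refine Finset.sum_congr rfl fun i _ => Finset.sum_congr rfl fun j _ => ?_
  rw [← RealPart.re_star, star_mul, star_star]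

theorem matPair_unitary_mul (u : U F p) (X Y : Matrix (Fin p) (Fin q) F) :
    matPair (u.1 * X) (u.1 * Y) = matPair X Y := by
  have h : u.1.conjTranspose * u.1 = 1 := (Unitary.mem_iff.mp u.2).1
  rw [matPair, matPair, Matrix.conjTranspose_mul, Matrix.mul_assoc,
    ← Matrix.mul_assoc u.1.conjTranspose, h, Matrix.one_mul]

theorem matPair_eq_sum_frame (X Y : Matrix (Fin p) (Fin q) F) :
    matPair X Y = ∑ α : Fin p × Fin q × Fin (RealPart.dim F),
      RealPart.re (X α.1 α.2.1 * star (RealPart.frame α.2.2)) *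
        RealPart.re (Y α.1 α.2.1 * star (RealPart.frame α.2.2)) := by
  rw [matPair_eq_sum, Fintype.sum_prod_type]
  simp only [Fintype.sum_prod_type, RealPart.sum_frame]

theorem matPair_self_add (X Y : Matrix (Fin p) (Fin q) F) :
    matPair (X + Y) (X + Y) = matPair X X + matPair Y Y + 2 * matPair X Y := by
  rw [matPair_add_left, matPair_add_right, matPair_add_right, matPair_comm Y X]
  ring

theorem matPair_self_sub (X Y : Matrix (Fin p) (Fin q) F) :
    matPair (X - Y) (X - Y) = matPair X X + matPair Y Y - 2 * matPair X Y := by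
  rw [sub_eq_add_neg, matPair_self_add, matPair_neg_right, matPair_neg_right, matPair_neg_left]
  ring

theorem matPair_padRows {p' : ℕ} (h : p ≤ p') (X Y : Matrix (Fin p) (Fin q) F) :
    matPair (padRows q h X) (padRows q h Y) = matPair X Y := by
  obtain ⟨m, rfl⟩ := Nat.exists_eq_add_of_le h
  simp [matPair_eq_sum, Fin.sum_univ_add, padRows]

theorem padRows_mul_right {p' : ℕ} (h : p ≤ p') (X : Matrix (Fin p) (Fin q) F)
    (V : Matrix (Fin q) (Fin q) F) : padRows q h X * V = padRows q h (X * V) := by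
  ext i j
  by_cases hi : (i : ℕ) < p <;> simp [padRows, Matrix.mul_apply, hi]

/-- A bound that is linear in the `‖u i k‖`, so that the cross term in the product formula is
controlled by the mean size of the entries of `u`. -/
theorem abs_matPair_mul_le (Z W : Matrix (Fin p) (Fin q) F) (u : Matrix (Fin p) (Fin p) F)
    [CStarRing F] {a c : Fin p → ℝ} {β : Fin q → ℝ}
    (hZ : ∀ i j, ‖Z i j‖ ≤ a i * β j) (hW : ∀ i j, ‖W i j‖ ≤ c i * β j) :
    |matPair Z (u * W)| ≤
      ‖RealPart.re (F := F)‖ * (∑ j, β j ^ 2) * ∑ i, ∑ k, a i * c k * ‖u i k‖ := by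
  have h : matPair Z (u * W) =
      ∑ j, ∑ i, ∑ k, RealPart.re (Z i j * star (u i k * W k j)) := by
    rw [matPair_eq_sum, Finset.sum_comm]
    refine Finset.sum_congr rfl fun j _ => Finset.sum_congr rfl fun i _ => ?_
    rw [Matrix.mul_apply, star_sum, Finset.mul_sum, map_sum]
  rw [h]
  have h2 : ∀ j i k, |RealPart.re (Z i j * star (u i k * W k j))| ≤
      ‖RealPart.re (F := F)‖ * β j ^ 2 * (a i * c k * ‖u i k‖) := by
    intro j i k
    rw [← Real.norm_eq_abs]
    refine ((RealPart.re (F := F)).le_opNorm _).trans ?_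
    rw [norm_mul, norm_star, norm_mul, mul_assoc ‖_‖ (β j ^ 2)]
    refine mul_le_mul_of_nonneg_left ?_ (norm_nonneg _)
    calc ‖Z i j‖ * (‖u i k‖ * ‖W k j‖) ≤ (a i * β j) * (‖u i k‖ * (c k * β j)) := by
          refine mul_le_mul (hZ i j) ?_ (by positivity) ((norm_nonneg _).trans (hZ i j))
          exact mul_le_mul_of_nonneg_left (hW k j) (norm_nonneg _)
      _ = β j ^ 2 * (a i * c k * ‖u i k‖) := by ring
  have h3 : ∀ C S : ℝ, C * (∑ j, β j ^ 2) * S = ∑ j, C * β j ^ 2 * S := fun C S => by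
    rw [Finset.mul_sum, Finset.sum_mul]
  rw [h3]
  refine (Finset.abs_sum_le_sum_abs _ _).trans (Finset.sum_le_sum fun j _ => ?_)
  rw [Finset.mul_sum]
  refine (Finset.abs_sum_le_sum_abs _ _).trans (Finset.sum_le_sum fun i _ => ?_)
  rw [Finset.mul_sum]
  exact (Finset.abs_sum_le_sum_abs _ _).trans (Finset.sum_le_sum fun k _ => h2 j i k)

end MatrixPairing

theorem abs_exp_neg_sub_exp_neg_le {a b : ℝ} (ha : 0 ≤ a) (hb : 0 ≤ b) :
    |Real.exp (-a) - Real.exp (-b)| ≤ |a - b| := by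
  wlog h : a ≤ b generalizing a b
  · rw [abs_sub_comm, abs_sub_comm a]
    exact this hb ha (le_of_not_ge h)
  have h1 : Real.exp (-b) = Real.exp (-a) * Real.exp (a - b) := by rw [← Real.exp_add]; ring_nf
  have h2 := Real.add_one_le_exp (a - b)
  have h3 : Real.exp (-a) ≤ 1 := Real.exp_le_one_iff.mpr (by linarith)
  have h4 := Real.exp_pos (-a)
  have h5 : Real.exp (a - b) ≤ 1 := Real.exp_le_one_iff.mpr (by linarith)
  rw [abs_of_nonneg (by nlinarith), abs_of_nonpos (by linarith)]
  nlinarith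

/-! ### Positive definiteness of exponentials of Gram kernels -/

section ExpKernel

variable {ι κ : Type*} [Fintype ι] [Fintype κ]

theorem sum_pow_kernel_nonneg (f : κ → ι → ℝ) (n : ℕ) (c : κ → ℝ) :
    0 ≤ ∑ k, ∑ l, c k * c l * (∑ α, f k α * f l α) ^ n := by
  induction n generalizing c with
  | zero =>
    simp only [pow_zero, mul_one, ← Finset.mul_sum, ← Finset.sum_mul]
    exact mul_self_nonneg _
  | succ n ih =>
    -- One factor of the power is absorbed into the coefficients, `c_k ↦ c_k f_k(α)`, separately for
    -- each `α`.
    have h : ∑ k, ∑ l, c k * c l * (∑ α, f k α * f l α) ^ (n + 1) =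
        ∑ α, ∑ k, ∑ l, (c k * f k α) * (c l * f l α) * (∑ α, f k α * f l α) ^ n := by
      symm
      rw [Finset.sum_comm]
      refine Finset.sum_congr rfl fun k _ => ?_
      rw [Finset.sum_comm]
      refine Finset.sum_congr rfl fun l _ => Eq.symm ?_
      rw [pow_succ', Finset.sum_mul, Finset.mul_sum]
      exact Finset.sum_congr rfl fun α _ => by ring
    rw [h]
    exact Finset.sum_nonneg fun α _ => ih _

theorem sum_exp_kernel_nonneg (f : κ → ι → ℝ) (c : κ → ℝ) :
    0 ≤ ∑ k, ∑ l, c k * c l * Real.exp (2 * ∑ α, f k α * f l α) := by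
  have h : HasSum (fun n : ℕ => ∑ k, ∑ l, c k * c l * ((2 * ∑ α, f k α * f l α) ^ n / n.factorial))
      (∑ k, ∑ l, c k * c l * Real.exp (2 * ∑ α, f k α * f l α)) := by
    refine hasSum_sum fun k _ => hasSum_sum fun l _ => HasSum.mul_left _ ?_
    have := NormedSpace.expSeries_div_hasSum_exp (2 * ∑ α, f k α * f l α)
    rwa [← Real.exp_eq_exp_ℝ] at this
  refine h.nonneg fun n => ?_
  have h2 : ∑ k, ∑ l, c k * c l * ((2 * ∑ α, f k α * f l α) ^ n / n.factorial) =
      2 ^ n / n.factorial * ∑ k, ∑ l, c k * c l * (∑ α, f k α * f l α) ^ n := by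
    simp only [Finset.mul_sum]
    refine Finset.sum_congr rfl fun k _ => Finset.sum_congr rfl fun l _ => ?_
    rw [← Finset.mul_sum, mul_pow]
    ring
  rw [h2]
  exact mul_nonneg (by positivity) (sum_pow_kernel_nonneg f n c)

end ExpKernel

/-! ### Gaussian weights averaged over the unitary group -/

section GaussMean

set_option linter.unusedSectionVars false

variable {F : Type} [NormedDivisionRing F] [StarRing F] [NormedAlgebra ℝ F] [RealPart F]
  [NormStar F] [CStarRing F] [FiniteDimensional ℝ F]

variable {p q : ℕ} (β : Fin q → ℝ)

theorem matPair_self (X : Matrix (Fin p) (Fin q) F) : matPair X X = ∑ i, ∑ j, ‖X i j‖ ^ 2 := by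
  simp only [matPair_eq_sum, mul_star_self_eq, RealPart.re_algebraMap]

theorem matPair_self_nonneg (X : Matrix (Fin p) (Fin q) F) : 0 ≤ matPair X X := by
  rw [matPair_self]
  positivity

variable (F) in
/-- The diagonal matrix with real entries `β`. -/
def realDiag : Matrix (Fin q) (Fin q) F := Matrix.diagonal fun j => algebraMap ℝ F (β j)

/-- `exp(- ‖x w diag(β)‖ ^ 2)`. -/
def gaussWeight (x : Matrix (Fin p) (Fin q) F) (w : U F q) : ℝ :=
  Real.exp (-matPair (x * w.1 * realDiag F β) (x * w.1 * realDiag F β))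

/-- The mean of `exp(- ‖x w diag(β)‖ ^ 2)` over `w ∈ U_q`. -/
def gaussMean (x : Matrix (Fin p) (Fin q) F) : ℝ := haarMean (gaussWeight β x)

theorem continuous_gaussWeight :
    Continuous fun y : Matrix (Fin p) (Fin q) F × U F q => gaussWeight β y.1 y.2 := by
  unfold gaussWeight
  simp only [matPair_self]
  have h : Continuous fun y : Matrix (Fin p) (Fin q) F × U F q => y.1 * y.2.1 * realDiag F β :=
    (continuous_fst.matrix_mul (continuous_subtype_val.comp continuous_snd)).matrix_mul
      continuous_const
  exact Real.continuous_exp.comp (continuous_finsetSum _ fun i _ => continuous_finsetSum _ fun j _ =>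
    ((h.matrix_elem i j).norm.pow 2)).neg

theorem continuous_gaussWeight_right (x : Matrix (Fin p) (Fin q) F) :
    Continuous (gaussWeight β x) :=
  (continuous_gaussWeight β).comp (f := fun w : U F q => (x, w)) (by fun_prop)

theorem continuous_gaussMean : Continuous (gaussMean (F := F) (p := p) β) :=
  continuous_haarMean (continuous_gaussWeight β)

theorem gaussMean_unitary_mul (u : U F p) (x : Matrix (Fin p) (Fin q) F) :
    gaussMean β (u.1 * x) = gaussMean β x := by
  unfold gaussMean gaussWeight
  simp only [Matrix.mul_assoc, matPair_unitary_mul]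

theorem gaussMean_mul_unitary (v : U F q) (x : Matrix (Fin p) (Fin q) F) :
    gaussMean β (x * v.1) = gaussMean β x := by
  rw [gaussMean, gaussMean, ← haarMean_mul_left v (gaussWeight β x)]
  congr 1
  funext w
  simp only [gaussWeight, Submonoid.coe_mul, Matrix.mul_assoc]

theorem gaussMean_padRows {p' : ℕ} (h : p ≤ p') (x : Matrix (Fin p) (Fin q) F) :
    gaussMean β (padRows q h x) = gaussMean β x := by
  unfold gaussMean gaussWeight
  simp only [padRows_mul_right, matPair_padRows]

theorem gaussMean_neg (x : Matrix (Fin p) (Fin q) F) : gaussMean β (-x) = gaussMean β x := by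
  unfold gaussMean gaussWeight
  simp only [Matrix.neg_mul, matPair_neg_left, matPair_neg_right, neg_neg]

theorem sum_gaussMean_sub_nonneg {n : ℕ} (x : Fin n → Matrix (Fin p) (Fin q) F) (c : Fin n → ℝ) :
    0 ≤ ∑ k, ∑ l, c k * c l * gaussMean β (x k - x l) := by
  have hF : ∀ k l, Continuous fun w : U F q => c k * c l * gaussWeight β (x k - x l) w :=
    fun k l => continuous_const.mul (continuous_gaussWeight_right β _)
  have hF2 : ∀ k, Continuous fun w : U F q => ∑ l, c k * c l * gaussWeight β (x k - x l) w :=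
    fun k => continuous_finsetSum _ fun l _ => hF k l
  have h : ∑ k, ∑ l, c k * c l * gaussMean β (x k - x l) =
      haarMean fun w : U F q => ∑ k, ∑ l, c k * c l * gaussWeight β (x k - x l) w := by
    rw [haarMean_sum _ hF2]
    refine Finset.sum_congr rfl fun k _ => ?_
    rw [haarMean_sum _ (hF k)]
    refine Finset.sum_congr rfl fun l _ => ?_
    rw [haarMean_const_mul]
    rfl
  rw [h]
  refine haarMean_nonneg fun w => ?_
  set Z := fun k => x k * w.1 * realDiag F β with hZ
  -- Expanding `‖Z_k - Z_l‖²` leaves `exp(2⟨Z_k, Z_l⟩)`; the factors `exp(-‖Z_k‖²)` go into the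
  -- coefficients.
  have key := sum_exp_kernel_nonneg
    (fun (k : Fin n) (α : Fin p × Fin q × Fin (RealPart.dim F)) =>
      RealPart.re (Z k α.1 α.2.1 * star (RealPart.frame α.2.2)))
    (fun k => c k * Real.exp (-matPair (Z k) (Z k)))
  simp only [← matPair_eq_sum_frame] at key
  refine key.trans_eq (Finset.sum_congr rfl fun k _ => Finset.sum_congr rfl fun l _ => ?_)
  have e : (x k - x l) * w.1 * realDiag F β = Z k - Z l := by simp [hZ, Matrix.sub_mul]
  rw [gaussWeight, e, matPair_self_sub, show -(matPair (Z k) (Z k) + matPair (Z l) (Z l) -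
    2 * matPair (Z k) (Z l)) = -matPair (Z k) (Z k) + -matPair (Z l) (Z l) +
    2 * matPair (Z k) (Z l) by ring, Real.exp_add, Real.exp_add]
  ring

theorem norm_mul_unitary_mul_realDiag_le (x : Matrix (Fin p) (Fin q) F) (w : U F q)
    (hβ : ∀ j, 0 ≤ β j) (i : Fin p) (j : Fin q) :
    ‖(x * w.1 * realDiag F β) i j‖ ≤ (∑ l, ‖x i l‖) * β j := by
  rw [realDiag, Matrix.mul_diagonal, norm_mul, norm_algebraMap', Real.norm_of_nonneg (hβ j)]
  refine mul_le_mul_of_nonneg_right ?_ (hβ j)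
  rw [Matrix.mul_apply]
  refine (norm_sum_le _ _).trans (Finset.sum_le_sum fun l _ => ?_)
  rw [norm_mul]
  exact mul_le_of_le_one_right (norm_nonneg _) (norm_entry_le w l j)

theorem continuous_entry_fst (i j : Fin p) : Continuous fun k : K F p q => k.1.1 i j :=
  (continuous_entry i j).comp continuous_fst

variable [StarModule ℝ F]

/-- Permuting rows shows that all entries of a column have the same mean square, and these sum to
`1`. -/
theorem haarMean_norm_sq_entry (i j : Fin p) :
    haarMean (fun k : K F p q => ‖k.1.1 i j‖ ^ 2) = (p : ℝ)⁻¹ := by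
  have hF : ∀ i, Continuous fun k : K F p q => ‖k.1.1 i j‖ ^ 2 := fun i =>
    (continuous_entry_fst i j).norm.pow 2
  have h1 : ∀ i', haarMean (fun k : K F p q => ‖k.1.1 i' j‖ ^ 2) =
      haarMean (fun k : K F p q => ‖k.1.1 i j‖ ^ 2) := by
    intro i'
    rw [← haarMean_mul_left ((permUnitary (Equiv.swap i' i), 1) : K F p q)
      (fun k : K F p q => ‖k.1.1 i' j‖ ^ 2)]
    congr 1
    funext k
    rw [Prod.fst_mul, permUnitary_mul_apply, Equiv.swap_apply_left]
  have h2 : ∑ i', haarMean (fun k : K F p q => ‖k.1.1 i' j‖ ^ 2) = 1 := by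
    rw [← haarMean_sum _ hF]
    simp only [sum_norm_sq_col, haarMean_const]
  simp only [h1, Finset.sum_const, Finset.card_univ, Fintype.card_fin, nsmul_eq_mul] at h2
  exact eq_inv_of_mul_eq_one_right h2

theorem haarMean_norm_entry_le (i j : Fin p) :
    haarMean (fun k : K F p q => ‖k.1.1 i j‖) ≤ (√p)⁻¹ := by
  have hp : 0 < (p : ℝ) := by exact_mod_cast i.pos
  have hs : 0 < √(p : ℝ) := Real.sqrt_pos.mpr hp
  have hss : √(p : ℝ) * √(p : ℝ) = p := Real.mul_self_sqrt hp.le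
  have hF : Continuous fun k : K F p q => √p / 2 * ‖k.1.1 i j‖ ^ 2 :=
    continuous_const.mul ((continuous_entry_fst i j).norm.pow 2)
  -- The inequality `t ≤ (√p)⁻¹/2 + (√p/2) t²` is tuned to equality at `t = (√p)⁻¹`; it replaces
  -- Cauchy-Schwarz.
  have h := haarMean_mono (f := fun k : K F p q => ‖k.1.1 i j‖)
    (g := fun k : K F p q => (√p)⁻¹ / 2 + √p / 2 * ‖k.1.1 i j‖ ^ 2)
    (continuous_entry_fst i j).norm (continuous_const.add hF) (fun k => by
      have : (√(p : ℝ))⁻¹ / 2 + √p / 2 * ‖k.1.1 i j‖ ^ 2 - ‖k.1.1 i j‖ =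
        (√(p : ℝ))⁻¹ / 2 * (1 - √p * ‖k.1.1 i j‖) ^ 2 := by
        field_simp
        ring
      have h2 : 0 ≤ (√(p : ℝ))⁻¹ / 2 * (1 - √p * ‖k.1.1 i j‖) ^ 2 := by positivity
      linarith)
  refine h.trans_eq ?_
  rw [haarMean_add continuous_const hF, haarMean_const, haarMean_const_mul,
    haarMean_norm_sq_entry]
  have hi : (p : ℝ)⁻¹ = (√p)⁻¹ * (√p)⁻¹ := by rw [← mul_inv, hss]
  rw [hi, div_mul_eq_mul_div, mul_inv_cancel_left₀ hs.ne', add_halves]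

end GaussMean

end OlshanskiPair

end

noncomputable section

namespace OlshanskiPair

/-! ### The spherical function on the inductive limit -/

section GInf

variable {F : Type} [NormedDivisionRing F] [StarRing F] {p q : ℕ}

theorem incl_embed {p' : ℕ} (h : p ≤ p') (g : G F p q) : incl p' q (embed q h g) = incl p q g :=
  (DirectLimit.eq_of_le (F := fun p => G F p q)
    (f := fun p p' (h : p ≤ p') => embed (F := F) q h) ⟨p, g⟩ p' h).symm

theorem exists_incl_eq (g : GInf F q) : ∃ p g', incl (F := F) p q g' = g := by
  obtain ⟨p, x, rfl⟩ := DirectLimit.exists_eq_mk _ g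
  exact ⟨p, x, rfl⟩

theorem exists_forall_incl_eq {ι : Type*} [Finite ι] (g : ι → GInf F q) :
    ∃ p, ∀ p', p ≤ p' → ∀ i, ∃ g', incl (F := F) p' q g' = g i := by
  have := Fintype.ofFinite ι
  choose n x hx using fun i => exists_incl_eq (g i)
  refine ⟨Finset.univ.sup n, fun p' hp' i => ⟨embed q ?_ (x i), ?_⟩⟩
  · exact (Finset.le_sup (Finset.mem_univ i)).trans hp'
  · rw [incl_embed, hx]

/-- The matrix part of an element of `G_p`. -/
def matPart (g : G F p q) : Matrix (Fin p) (Fin q) F := g.left.toAdd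

theorem matPart_mul (g h : G F p q) :
    matPart (g * h) = matPart g + g.right.1.1 * matPart h * star g.right.2.1 := rfl

theorem matPart_embed {p' : ℕ} (h : p ≤ p') (g : G F p q) :
    matPart (embed q h g) = padRows q h (matPart g) := rfl

end GInf

/-! ### Invariance, positivity and the product formula -/

section SphericalFunction

set_option linter.unusedSectionVars false

variable {F : Type} [NormedDivisionRing F] [StarRing F] [NormedAlgebra ℝ F] [RealPart F]
  [NormStar F] [CStarRing F] [FiniteDimensional ℝ F]

variable {p q : ℕ} (β : Fin q → ℝ)

theorem gaussMean_matPart_embed {p' : ℕ} (h : p ≤ p') (g : G F p q) :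
    gaussMean β (matPart (embed q h g)) = gaussMean β (matPart g) := by
  rw [matPart_embed, gaussMean_padRows]

/-- The function on `G_∞` with values `gaussMean β x` at the elements with matrix part `x`. -/
def gaussSpherical (g : GInf F q) : ℝ :=
  DirectLimit.lift (fun p p' (h : p ≤ p') => embed (F := F) q h)
    (fun _ g => gaussMean β (matPart g)) (fun _ _ h g => (gaussMean_matPart_embed β h g).symm) g

theorem gaussSpherical_incl (g : G F p q) :
    gaussSpherical β (incl p q g) = gaussMean β (matPart g) := rfl

theorem gaussMean_matPart_inr_mul_inr (k l : K F p q) (g : G F p q) :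
    gaussMean β (matPart (SemidirectProduct.inr k * g * SemidirectProduct.inr l)) =
      gaussMean β (matPart g) := by
  have h : matPart (SemidirectProduct.inr k * g * SemidirectProduct.inr l) =
      k.1.1 * matPart g * (k.2⁻¹).1 := by
    have h0 : ∀ k : K F p q, matPart (SemidirectProduct.inr k : G F p q) = 0 := fun _ => rfl
    rw [matPart_mul, matPart_mul, h0, h0, Matrix.mul_zero, Matrix.zero_mul, add_zero, zero_add]
    rfl
  rw [h, gaussMean_mul_unitary, gaussMean_unitary_mul]

/-- Left multiplication by the inverse of the `K`-part moves `g` and `h` into the translation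
subgroup without changing the double coset of `g h⁻¹`. The kernel thereby becomes a function of a
difference of matrices. -/
theorem gaussMean_matPart_mul_inv (g h : G F p q) :
    gaussMean β (matPart (g * h⁻¹)) =
      gaussMean β (matPart (SemidirectProduct.inr g.right⁻¹ * g) -
        matPart (SemidirectProduct.inr h.right⁻¹ * h)) := by
  set A : G F p q := SemidirectProduct.inr g.right⁻¹ * g with hA
  set B : G F p q := SemidirectProduct.inr h.right⁻¹ * h with hB
  have hA1 : A.right = 1 := inv_mul_cancel g.right
  have hB1 : B.right = 1 := inv_mul_cancel h.right
  have hmul : ∀ C D : G F p q, C.right = 1 → matPart (C * D) = matPart C + matPart D := by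
    intro C D hC
    rw [matPart_mul, hC]
    simp
  have hinv : matPart B⁻¹ = -matPart B := by
    rw [eq_neg_iff_add_eq_zero, add_comm, ← hmul B B⁻¹ hB1, mul_inv_cancel]
    rfl
  have e : g * h⁻¹ = SemidirectProduct.inr g.right * (A * B⁻¹) * SemidirectProduct.inr h.right⁻¹ := by
    rw [hA, hB, map_inv, map_inv]
    group
  rw [e, gaussMean_matPart_inr_mul_inr, hmul A B⁻¹ hA1, hinv, sub_eq_add_neg]

theorem continuous_gaussSpherical : Continuous (gaussSpherical (F := F) β) := by
  refine continuous_iSup_dom.mpr fun p => continuous_coinduced_dom.mpr ?_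
  have h0 : Continuous (SemidirectProduct.equivProd : G F p q ≃ _) := continuous_induced_dom
  have h : Continuous fun g : G F p q => matPart g := continuous_fst.comp h0
  exact (continuous_gaussMean β).comp h

theorem gaussSpherical_inclK_mul_inclK (k l : K F p q) (g : GInf F q) :
    gaussSpherical β (inclK p q k * g * inclK p q l) = gaussSpherical β g := by
  obtain ⟨r, hr⟩ := exists_forall_incl_eq fun _ : Unit => g
  obtain ⟨g', rfl⟩ := hr (max p r) (le_max_right _ _) ()
  have e : ∀ k : K F p q, inclK p q k = incl (max p r) q
      (SemidirectProduct.inr (padUnitary (le_max_left p r) k.1, k.2)) := fun k =>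
    (incl_embed (le_max_left p r) (SemidirectProduct.inr k)).symm.trans (by
      rw [embed, SemidirectProduct.map_inr]
      rfl)
  rw [e, e, ← map_mul, ← map_mul, gaussSpherical_incl, gaussMean_matPart_inr_mul_inr,
    gaussSpherical_incl]

theorem gaussSpherical_biinvariant {k l : GInf F q} (hk : k ∈ KInf F q) (hl : l ∈ KInf F q)
    (g : GInf F q) : gaussSpherical β (k * g * l) = gaussSpherical β g := by
  have h1 : ∀ g, gaussSpherical β (k * g) = gaussSpherical β g := by
    refine Subgroup.iSup_induction _ (C := fun k => ∀ g, gaussSpherical β (k * g) =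
      gaussSpherical β g) hk ?_ (fun g => by rw [one_mul]) fun a b ha hb g => by
        rw [mul_assoc, ha, hb]
    rintro p _ ⟨k, rfl⟩ g
    simpa using gaussSpherical_inclK_mul_inclK β k 1 g
  have h2 : ∀ g, gaussSpherical β (g * l) = gaussSpherical β g := by
    refine Subgroup.iSup_induction _ (C := fun l => ∀ g, gaussSpherical β (g * l) =
      gaussSpherical β g) hl ?_ (fun g => by rw [mul_one]) fun a b ha hb g => by
        rw [← mul_assoc, hb, ha]
    rintro p _ ⟨k, rfl⟩ g
    simpa using gaussSpherical_inclK_mul_inclK β 1 k g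
  rw [h2, h1]

theorem isPositiveDefinite_gaussSpherical :
    IsPositiveDefinite fun g : GInf F q => (gaussSpherical β g : ℂ) := by
  intro n g c
  obtain ⟨p, hp⟩ := exists_forall_incl_eq g
  choose g' hg' using hp p le_rfl
  obtain rfl : (fun i => incl p q (g' i)) = g := funext hg'
  set x := fun i => matPart (SemidirectProduct.inr (g' i).right⁻¹ * g' i) with hx
  have h : ∀ k l, gaussSpherical β (incl p q (g' k) * (incl p q (g' l))⁻¹) =
      gaussMean β (x k - x l) := fun k l => by
    rw [← map_inv, ← map_mul, gaussSpherical_incl, gaussMean_matPart_mul_inv]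
  simp only [h]
  have hsymm : ∀ k l, gaussMean β (x k - x l) = gaussMean β (x l - x k) := fun k l => by
    rw [← gaussMean_neg, neg_sub]
  constructor
  · have h1 := sum_gaussMean_sub_nonneg β x fun i => (c i).re
    have h2 := sum_gaussMean_sub_nonneg β x fun i => (c i).im
    have := add_nonneg h1 h2
    simp only [← Finset.sum_add_distrib] at this
    simp only [Complex.re_sum]
    refine this.trans_eq (Finset.sum_congr rfl fun k _ => Finset.sum_congr rfl fun l _ => ?_)
    simp
    ring
  · simp only [Complex.im_sum]
    set S := ∑ k, ∑ l, (c k * star (c l) * (gaussMean β (x k - x l) : ℂ)).im with hS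
    have : S = -S := by
      -- The kernel is real and symmetric, so exchanging `k` and `l` conjugates each term.
      conv_lhs => rw [hS, Finset.sum_comm]
      rw [hS, ← Finset.sum_neg_distrib]
      refine Finset.sum_congr rfl fun k _ => ?_
      rw [← Finset.sum_neg_distrib]
      refine Finset.sum_congr rfl fun l _ => ?_
      rw [hsymm l k]
      simp
      ring
    linarith

theorem continuous_K_action (y : Matrix (Fin p) (Fin q) F) :
    Continuous fun k : K F p q => k.1.1 * y * star k.2.1 := by
  refine (Continuous.matrix_mul ?_ continuous_const).matrix_mul ?_
  · exact continuous_subtype_val.comp continuous_fst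
  · exact (continuous_subtype_val.comp continuous_snd).star

/-- For fixed `w` the element `v⁻¹ w` is again Haar distributed, so the mean over `v` separates the
two factors. -/
theorem haarMean_mul_gaussWeight (x y : Matrix (Fin p) (Fin q) F) :
    haarMean (fun k : K F p q => haarMean fun w : U F q =>
      gaussWeight β x w * gaussWeight β y (k.2⁻¹ * w)) = gaussMean β x * gaussMean β y := by
  have hc := fun x : Matrix (Fin p) (Fin q) F => continuous_gaussWeight_right (F := F) β x
  have hcx := hc x
  have hcy := hc y
  rw [haarMean_swap (by fun_prop)]
  have h : ∀ w : U F q, haarMean (fun k : K F p q =>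
      gaussWeight β x w * gaussWeight β y (k.2⁻¹ * w)) = gaussMean β y * gaussWeight β x w := by
    intro w
    rw [haarMean_const_mul, mul_comm,
      haarMean_comp_snd (f := fun v : U F q => gaussWeight β y (v⁻¹ * w)) (by fun_prop),
      haarMean_inv (f := fun v : U F q => gaussWeight β y (v * w)) (by fun_prop),
      haarMean_mul_right w hcy]
    rfl
  simp only [h]
  rw [haarMean_const_mul, mul_comm]
  rfl

/-- With `Z = x w diag(β)` and `W = y v⁻¹ w diag(β)` the exponents are `‖Z + u W‖²` and `‖Z‖² +
‖W‖²`. They differ by the cross term only, and `t ↦ exp(-t)` is 1-Lipschitz for `t ≥ 0`. -/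
theorem abs_gaussWeight_sub_le (hβ : ∀ j, 0 ≤ β j) (x y : Matrix (Fin p) (Fin q) F)
    (k : K F p q) (w : U F q) :
    |gaussWeight β (x + k.1.1 * y * star k.2.1) w -
        gaussWeight β x w * gaussWeight β y (k.2⁻¹ * w)| ≤
      2 * (‖RealPart.re (F := F)‖ * (∑ j, β j ^ 2) *
        ∑ i, ∑ j, (∑ l, ‖x i l‖) * (∑ l, ‖y j l‖) * ‖k.1.1 i j‖) := by
  set Z := x * w.1 * realDiag F β with hZ
  set W := y * (k.2⁻¹ * w).1 * realDiag F β with hW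
  have e : (x + k.1.1 * y * star k.2.1) * w.1 * realDiag F β = Z + k.1.1 * W := by
    rw [hZ, hW, Matrix.add_mul, Matrix.add_mul]
    congr 1
    simp only [Matrix.mul_assoc, Submonoid.coe_mul]
    rfl
  rw [gaussWeight, gaussWeight, gaussWeight, e, ← hZ, ← hW, ← Real.exp_add, ← neg_add]
  refine (abs_exp_neg_sub_exp_neg_le (matPair_self_nonneg _)
    (add_nonneg (matPair_self_nonneg _) (matPair_self_nonneg _))).trans ?_
  rw [matPair_self_add, matPair_unitary_mul, add_sub_cancel_left, abs_mul, abs_two]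
  exact mul_le_mul_of_nonneg_left (abs_matPair_mul_le Z W k.1.1
    (norm_mul_unitary_mul_realDiag_le β x w hβ) (norm_mul_unitary_mul_realDiag_le β y _ hβ)) zero_le_two

theorem continuous_gaussMean_action (x y : Matrix (Fin p) (Fin q) F) :
    Continuous fun k : K F p q => gaussMean β (x + k.1.1 * y * star k.2.1) :=
  (continuous_gaussMean β).comp (continuous_const.add (continuous_K_action y))

variable [StarModule ℝ F]

theorem abs_haarMean_gaussMean_sub_le (hβ : ∀ j, 0 ≤ β j) (x y : Matrix (Fin p) (Fin q) F) :
    |haarMean (fun k : K F p q => gaussMean β (x + k.1.1 * y * star k.2.1)) -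
        gaussMean β x * gaussMean β y| ≤
      2 * (‖RealPart.re (F := F)‖ * (∑ j, β j ^ 2) *
        ((∑ i, ∑ l, ‖x i l‖) * (∑ i, ∑ l, ‖y i l‖) * (√p)⁻¹)) := by
  have hcx := continuous_gaussWeight_right β x
  have hcy := continuous_gaussWeight_right β y
  have hF : ∀ i j, Continuous fun k : K F p q =>
      (∑ l, ‖x i l‖) * (∑ l, ‖y j l‖) * ‖k.1.1 i j‖ := fun i j =>
    continuous_const.mul (continuous_entry_fst i j).norm
  have hF2 : ∀ i, Continuous fun k : K F p q =>
      ∑ j, (∑ l, ‖x i l‖) * (∑ l, ‖y j l‖) * ‖k.1.1 i j‖ := fun i =>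
    continuous_finsetSum _ fun j _ => hF i j
  have hF3 : Continuous fun k : K F p q =>
      ∑ i, ∑ j, (∑ l, ‖x i l‖) * (∑ l, ‖y j l‖) * ‖k.1.1 i j‖ :=
    continuous_finsetSum _ fun i _ => hF2 i
  rw [← haarMean_mul_gaussWeight]
  have hprod : Continuous (fun (k : K F p q) (w : U F q) =>
      gaussWeight β x w * gaussWeight β y (k.2⁻¹ * w)).uncurry := by
    change Continuous fun a : K F p q × U F q =>
      gaussWeight β x a.2 * gaussWeight β y (a.1.2⁻¹ * a.2)
    fun_prop
  refine (abs_haarMean_sub_le (continuous_gaussMean_action β x y) (continuous_haarMean hprod)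
    (b := fun k => 2 * (‖RealPart.re (F := F)‖ * (∑ j, β j ^ 2) *
        ∑ i, ∑ j, (∑ l, ‖x i l‖) * (∑ l, ‖y j l‖) * ‖k.1.1 i j‖))
    (continuous_const.mul (continuous_const.mul hF3)) fun k => ?_).trans ?_
  · have := abs_haarMean_sub_le (continuous_gaussWeight_right β (x + k.1.1 * y * star k.2.1))
      (hprod.comp (f := fun w => (k, w)) (by fun_prop)) continuous_const
      (abs_gaussWeight_sub_le β hβ x y k)
    rwa [haarMean_const] at this
  · rw [haarMean_const_mul, haarMean_const_mul, haarMean_sum _ hF2]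
    refine mul_le_mul_of_nonneg_left (mul_le_mul_of_nonneg_left ?_ (by positivity)) zero_le_two
    rw [Finset.sum_mul_sum, Finset.sum_mul]
    refine Finset.sum_le_sum fun i _ => ?_
    rw [haarMean_sum _ (hF i), Finset.sum_mul]
    refine Finset.sum_le_sum fun j _ => ?_
    rw [haarMean_const_mul]
    exact mul_le_mul_of_nonneg_left (haarMean_norm_entry_le i j) (by positivity)

theorem sum_norm_padRows {p' : ℕ} (h : p ≤ p') (x : Matrix (Fin p) (Fin q) F) :
    ∑ i, ∑ l, ‖padRows q h x i l‖ = ∑ i, ∑ l, ‖x i l‖ := by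
  obtain ⟨m, rfl⟩ := Nat.exists_eq_add_of_le h
  simp [Fin.sum_univ_add, padRows]

/-- The `K`-part of `g` is absorbed by left invariance of Haar measure, and the `K`-part of `h` does
not affect the matrix part of the product. -/
theorem haarMean_gaussSpherical (g h : G F p q) :
    haarMean (fun k : K F p q => gaussSpherical β (incl p q g * inclK p q k * incl p q h)) =
      haarMean fun k : K F p q => gaussMean β (matPart g + k.1.1 * matPart h * star k.2.1) := by
  rw [← haarMean_mul_left g.right
    (fun k : K F p q => gaussMean β (matPart g + k.1.1 * matPart h * star k.2.1))]
  congr 1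
  funext k
  have e : incl p q g * inclK p q k * incl p q h =
      incl p q (g * SemidirectProduct.inr k * h) := by
    rw [map_mul, map_mul]
    rfl
  rw [e, gaussSpherical_incl, matPart_mul, matPart_mul]
  have h0 : matPart (SemidirectProduct.inr k : G F p q) = 0 := rfl
  rw [h0, Matrix.mul_zero, Matrix.zero_mul, add_zero]
  rfl

theorem tendsto_haarMean_gaussSpherical (hβ : ∀ j, 0 ≤ β j) (g h : GInf F q) :
    Filter.Tendsto (fun p : ℕ => haarMean fun k : K F p q =>
      gaussSpherical β (g * inclK p q k * h)) Filter.atTop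
      (nhds (gaussSpherical β g * gaussSpherical β h)) := by
  obtain ⟨r, hr⟩ := exists_forall_incl_eq ![g, h]
  obtain ⟨g', hg⟩ := hr r le_rfl 0
  obtain ⟨h', hh⟩ := hr r le_rfl 1
  obtain rfl : incl r q g' = g := hg
  obtain rfl : incl r q h' = h := hh
  -- This constant is computed at the fixed level `r`; appending zero rows does not change it, so
  -- the error at level `p` is `C / √p`.
  set C := 2 * (‖RealPart.re (F := F)‖ * (∑ j, β j ^ 2) *
    ((∑ i, ∑ l, ‖matPart g' i l‖) * (∑ i, ∑ l, ‖matPart h' i l‖))) with hC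
  have hlim : Filter.Tendsto (fun p : ℕ => C * (√(p : ℝ))⁻¹) Filter.atTop (nhds 0) := by
    rw [← mul_zero C]
    exact (tendsto_inv_atTop_zero.comp (Real.tendsto_sqrt_atTop.comp
      tendsto_natCast_atTop_atTop)).const_mul C
  rw [tendsto_iff_norm_sub_tendsto_zero]
  refine squeeze_zero' (Filter.Eventually.of_forall fun p => norm_nonneg _) ?_ hlim
  filter_upwards [Filter.eventually_ge_atTop r] with p hp
  have key := abs_haarMean_gaussMean_sub_le β hβ (padRows q hp (matPart g'))
    (padRows q hp (matPart h'))
  rw [sum_norm_padRows, sum_norm_padRows, gaussMean_padRows, gaussMean_padRows] at key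
  rw [Real.norm_eq_abs, ← incl_embed hp g', ← incl_embed hp h', haarMean_gaussSpherical,
    gaussSpherical_incl, gaussSpherical_incl, matPart_embed, matPart_embed, gaussMean_padRows,
    gaussMean_padRows]
  refine key.trans_eq ?_
  rw [hC]
  ring

theorem isOlshanskiSpherical_gaussSpherical (hβ : ∀ j, 0 ≤ β j) :
    IsOlshanskiSpherical fun g : GInf F q => (gaussSpherical β g : ℂ) where
  continuous := Complex.continuous_ofReal.comp (continuous_gaussSpherical β)
  biinvariant k hk l hl g := by rw [gaussSpherical_biinvariant β hk hl]
  product_formula g h := by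
    simp only [haarIntegral_ofReal, ← Complex.ofReal_mul]
    exact (Complex.continuous_ofReal.tendsto _).comp (tendsto_haarMean_gaussSpherical β hβ g h)

theorem gaussSpherical_gElt {b : Fin q → ℝ} (hb : ∀ j, 0 ≤ b j) (ξ : Fin q → ℝ) :
    (gaussSpherical (fun j => √(b j)) (gElt (F := F) ξ) : ℂ) = psi F (fun i => (b i : ℂ)) ξ := by
  rw [psi_eq_haarMean]
  congr 1
  refine (gaussSpherical_incl _ _).trans ?_
  rw [gaussMean]
  congr 1
  funext u
  rw [gaussWeight]
  congr 1
  -- The choice `β = √b` makes the squared entry linear in `b_j`, as in `gramForm` at `-b` and `ξ²`.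
  have h : ∀ i j, ‖(Matrix.diagonal (fun i => algebraMap ℝ F (ξ i)) * u.1 *
      realDiag F (fun j => √(b j))) i j‖ ^ 2 = ξ i ^ 2 * (b j * ‖u.1 i j‖ ^ 2) := by
    intro i j
    rw [realDiag, Matrix.mul_diagonal, Matrix.diagonal_mul, norm_mul, norm_mul, norm_algebraMap',
      norm_algebraMap', mul_pow, mul_pow, Real.norm_eq_abs, Real.norm_eq_abs, sq_abs, sq_abs,
      Real.sq_sqrt (hb j)]
    ring
  change -matPair (Matrix.diagonal (fun i => algebraMap ℝ F (ξ i)) * u.1 *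
    realDiag F (fun j => √(b j))) (Matrix.diagonal (fun i => algebraMap ℝ F (ξ i)) * u.1 *
    realDiag F (fun j => √(b j))) = _
  rw [matPair_self]
  simp only [h, gramForm, gramDiag, pow_one, Finset.mul_sum, Pi.neg_apply, neg_mul, mul_neg,
    Finset.sum_neg_distrib]

theorem psiIsPositiveDefiniteSpherical {b : Fin q → ℝ} (hb : b ∈ chamberB q) :
    PsiIsPositiveDefiniteSpherical F (fun i => (b i : ℂ)) :=
  ⟨fun g => (gaussSpherical (fun j => √(b j)) g : ℂ), fun ξ _ => gaussSpherical_gElt hb.2 ξ,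
    isOlshanskiSpherical_gaussSpherical _ fun _ => Real.sqrt_nonneg _,
    isPositiveDefinite_gaussSpherical _⟩

end SphericalFunction

/-! ### The three fields -/

instance : RealPart ℝ where
  re := ContinuousLinearMap.id ℝ ℝ
  re_mul_comm x y := mul_comm x y
  re_star _ := rfl
  re_algebraMap _ := rfl
  dim := 1
  dim_eq := (Module.finrank_self ℝ).symm
  frame := fun _ => 1
  frame_mul_star _ := by simp
  star_mul_frame _ := by simp
  sum_frame x y := by simp

instance : RealPart ℂ where
  re := Complex.reCLM
  re_mul_comm x y := by rw [mul_comm]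
  re_star x := by simp
  re_algebraMap r := by simp
  dim := 2
  dim_eq := Complex.finrank_real_complex.symm
  frame := ![1, Complex.I]
  frame_mul_star a := by fin_cases a <;> simp
  star_mul_frame a := by fin_cases a <;> simp
  sum_frame x y := by simp [Fin.sum_univ_succ]

instance : StarModule ℝ ℍ[ℝ] := ⟨fun r x => by ext <;> simp⟩

/-- The real part of a quaternion. -/
def quaternionRe : ℍ[ℝ] →L[ℝ] ℝ := LinearMap.toContinuousLinearMap
  { toFun := fun x => x.re
    map_add' := fun _ _ => rfl
    map_smul' := fun _ _ => by simp }

theorem quaternionRe_apply (x : ℍ[ℝ]) : quaternionRe x = x.re := rfl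

/-- The basis `1, i, j, k` of the quaternions. -/
def quaternionFrame : Fin 4 → ℍ[ℝ] :=
  ![⟨1, 0, 0, 0⟩, ⟨0, 1, 0, 0⟩, ⟨0, 0, 1, 0⟩, ⟨0, 0, 0, 1⟩]

theorem normSq_quaternionFrame (a : Fin 4) : Quaternion.normSq (quaternionFrame a) = 1 := by
  rw [Quaternion.normSq_def']
  fin_cases a <;> simp [quaternionFrame]

instance : RealPart ℍ[ℝ] where
  re := quaternionRe
  re_mul_comm x y := by
    rw [quaternionRe_apply, quaternionRe_apply, Quaternion.re_mul, Quaternion.re_mul]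
    ring
  re_star x := Quaternion.re_star x
  re_algebraMap _ := rfl
  dim := 4
  dim_eq := Quaternion.finrank_eq_four.symm
  frame := quaternionFrame
  frame_mul_star a := by
    rw [Quaternion.self_mul_star, normSq_quaternionFrame, Quaternion.coe_one]
  star_mul_frame a := by
    rw [Quaternion.star_mul_self, normSq_quaternionFrame, Quaternion.coe_one]
  sum_frame x y := by
    simp only [quaternionRe_apply, Fin.sum_univ_four, Quaternion.re_mul, Quaternion.re_star,
      Quaternion.imI_star, Quaternion.imJ_star, Quaternion.imK_star]
    simp [quaternionFrame]

end OlshanskiPair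

end

open OlshanskiPair in
theorem proposition5p7 (q : ℕ) (hq : 1 ≤ q) (b : Fin q → ℝ) (hb : b ∈ chamberB q) :
    PsiIsPositiveDefiniteSpherical ℝ (fun i => (b i : ℂ)) ∧
    PsiIsPositiveDefiniteSpherical ℂ (fun i => (b i : ℂ)) ∧
    PsiIsPositiveDefiniteSpherical ℍ[ℝ] (fun i => (b i : ℂ)) :=
  ⟨psiIsPositiveDefiniteSpherical hb, psiIsPositiveDefiniteSpherical hb,
    psiIsPositiveDefiniteSpherical hb⟩
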